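/- Let $k$ be an algebraically closed field of characteristic $0$, let $V$ be an $s$-dimensional $k$-vector space, and let $G\subset GL(V)$ be a finite subgroup. Put $V'=V\oplus k$, let $G'\subset SL(V')$ be the image of $G$ under $g\mapsto \mathrm{diag}(g,\det(g)^{-1})$, let $m\ge 1$, let $\xi\in k$ be a primitive $m$-th root of unity, let $C_m\subset GL(V')$ be generated by $\mathrm{diag}(1,\dots,1,\xi)$, and let $\widetilde G=G'C_m\subset GL(V')$. Paths are composed from right to left. For a finite subgroup $H\subset GL(W)$ the skew group algebra $\wedge W*H$ is graded by exterior degree, and $\Lambda(H)=e(\wedge W*H)e$ denotes its basic algebra, where $e=\sum_i e_i$ is a sum of orthogonal primitive idempotents of degree $0$ such that the modules $(\wedge W*H)e_i$ represent every isomorphism class of indecomposable projective modules exactly once. A bound quiver of $\Lambda(H)$ is a finite quiver $Q$ with a set $\theta$ of quadratic relations (linear combinations of paths of length two with common source and target) such that all sufficiently long paths lie in the two-sided ideal $(\theta)$, together with an algebra isomorphism $kQ/(\theta)\cong\Lambda(H)$ that maps the trivial paths to the $e_i$ and the arrows to elements of degree $1$. A graded Nakayama automorphism of $kQ/(\theta)$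 inducing the permutation $\nu$ of the vertices is an algebra automorphism, also denoted $\nu$, with $\nu(e_i)=e_{\nu i}$, which maps arrows to linear combinations of arrows and satisfies $f(ab)=f(b\,\nu(a))$ for some nondegenerate linear form $f$. Let $(Q_G,\theta_G)$ be a bound quiver of $\Lambda(G)$, let $\nu$ be a graded Nakayama automorphism of $kQ_G/(\theta_G)$ inducing the permutation $\nu$ of the vertices, and let $\widetilde\sigma$ be the automorphism with $\widetilde\sigma(\alpha)=(-1)^s\alpha$ for all arrows $\alpha$. Then the following data define a bound quiver $(Q_{\widetilde G},\theta_{\widetilde G})$ of $\Lambda(\widetilde G)$, the basic algebra of $\wedge V'*\widetilde G$: 1. The vertex set is $Q_{\widetilde G,0}=Q_{G,0}\times\mathbb Z/m\mathbb Z$. 2. The arrows are, for $t\in\mathbb Z/m\mathbb Z$, the copies $(\alpha,t):(i,t)\to(j,t)$ of the arrows $\alpha:i\to j$ of $Q_G$ and the connecting arrows $(\beta_i,t):(i,t)\to(\nu i,t+1)$, $i\in Q_{G,0}$. 3. The relations are, for $t\in\mathbb Z/m\mathbb Z$: the copies $(\varrho,t)$ of the $\varrho\in\theta_G$, obtained by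 replacing each path $\alpha_l\cdots\alpha_1$ by $(\alpha_l,t)\cdots(\alpha_1,t)$; the products $(\beta_{\nu i},t+1)(\beta_i,t)$, $i\in Q_{G,0}$; and $(\alpha,t)(\beta_{\nu^{-1}i},t-1)-(\beta_{\nu^{-1}j},t-1)(\nu^{-1}\widetilde\sigma\alpha,t-1)$ for the arrows $\alpha:i\to j$ of $Q_G$, where $\nu^{-1}\widetilde\sigma\alpha$ is written as a linear combination of arrows. 4. The Nakayama translation of $\Lambda(\widetilde G)$ is $(i,t)\mapsto(i,t-1)$: this permutation $\tilde\nu$ is induced by a graded Nakayama automorphism of $kQ_{\widetilde G}/(\theta_{\widetilde G})$; moreover, all maximal paths that are nonzero in this algebra have length $s+1$, for each vertex $x$ there is such a maximal path from $\tilde\nu(x)$ to $x$, every path of length $s+1$ from $\tilde\nu(x)$ to a vertex $y\ne x$ is zero in this algebra, and any two maximal nonzero paths with the same source are linearly dependent in it. -/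

import Mathlib

noncomputable section

universe u v w

/-! ### The path algebra of a quiver -/

/-- All paths of a quiver, with their source and target. -/
structure TotalPath (Q : Type u) [Quiver.{v} Q] where
  /-- the source of the path -/
  src : Q
  /-- the target of the path -/
  tgt : Q
  /-- the path itself -/
  path : Quiver.Path src tgt

/-- The underlying space of the path algebra `kQ`: the vector space with basis all paths of `Q`,
including the trivial path at each vertex. -/
def PathAlgebra (k : Type w) [Field k] (Q : Type u) [Quiver.{v} Q] :=
  TotalPath Q →₀ k

namespace PathAlgebra

variable {k : Type w} [Field k] {Q : Type u} [Quiver.{v} Q]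

instance : AddCommGroup (PathAlgebra k Q) := inferInstanceAs (AddCommGroup (TotalPath Q →₀ k))

instance : Module k (PathAlgebra k Q) := inferInstanceAs (Module k (TotalPath Q →₀ k))

variable (k) in
/-- A path as an element of the path algebra. -/
def ofPath {i j : Q} (p : Quiver.Path i j) : PathAlgebra k Q :=
  Finsupp.single (⟨i, j, p⟩ : TotalPath Q) (1 : k)

variable (k) in
/-- The trivial path at the vertex `i`. -/
def vertex (i : Q) : PathAlgebra k Q := ofPath k (Quiver.Path.nil : Quiver.Path i i)

variable (k) in
/-- An arrow as an element of the path algebra. -/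
def arrow {i j : Q} (a : i ⟶ j) : PathAlgebra k Q := ofPath k a.toPath

open Classical in
variable (k) in
/-- The product `p q` of two paths: first `q`, then `p` if the target of `q` is the source of `p`,
and `0` otherwise. -/
def pathMul (p q : TotalPath Q) : PathAlgebra k Q :=
  if h : q.tgt = p.src then ofPath k (q.path.comp (p.path.cast h.symm rfl)) else 0

variable (k Q) in
/-- The bilinear extension of the product of paths. -/
def mulLin : PathAlgebra k Q →ₗ[k] PathAlgebra k Q →ₗ[k] PathAlgebra k Q :=
  Finsupp.linearCombination k (fun p : TotalPath Q =>
    (Finsupp.linearCombination k (fun q : TotalPath Q => pathMul k p q) :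
      (TotalPath Q →₀ k) →ₗ[k] PathAlgebra k Q))

instance : Mul (PathAlgebra k Q) := ⟨fun a b => mulLin k Q a b⟩

theorem mul_eq (a b : PathAlgebra k Q) : a * b = mulLin k Q a b := rfl

theorem ofPath_mul {i j j' l : Q} (p : Quiver.Path j' l) (q : Quiver.Path i j) :
    ofPath k p * ofPath k q = pathMul k ⟨j', l, p⟩ ⟨i, j, q⟩ := by
  rw [mul_eq]
  unfold mulLin ofPath
  erw [Finsupp.linearCombination_single, one_smul, Finsupp.linearCombination_single, one_smul]

theorem ofPath_mul_ofPath {i j l : Q} (p : Quiver.Path j l) (q : Quiver.Path i j) :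
    ofPath k p * ofPath k q = ofPath k (q.comp p) := by
  rw [ofPath_mul]
  simp [pathMul]

theorem ofPath_mul_of_ne {i j j' l : Q} (p : Quiver.Path j' l) (q : Quiver.Path i j)
    (h : j ≠ j') : ofPath k p * ofPath k q = 0 := by
  rw [ofPath_mul]
  simp [pathMul, h]

/-- The paths span the path algebra. -/
theorem induction_ofPath {P : PathAlgebra k Q → Prop} (a : PathAlgebra k Q) (h0 : P 0)
    (hadd : ∀ x y, P x → P y → P (x + y))
    (hsmul : ∀ (c : k) (i j : Q) (p : Quiver.Path i j), P (c • ofPath k p)) : P a := by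
  refine Finsupp.induction_linear (motive := fun x : TotalPath Q →₀ k => P x) a h0 hadd ?_
  intro p c
  have : (Finsupp.single p c : TotalPath Q →₀ k) = c • Finsupp.single p (1 : k) := by simp
  rw [this]
  exact hsmul c p.src p.tgt p.path

instance : NonUnitalNonAssocRing (PathAlgebra k Q) :=
  { (inferInstance : AddCommGroup (PathAlgebra k Q)) with
    left_distrib := fun a b c => by simp only [mul_eq, map_add]
    right_distrib := fun a b c => by simp only [mul_eq, map_add, LinearMap.add_apply]
    zero_mul := fun a => by simp only [mul_eq, map_zero, LinearMap.zero_apply]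
    mul_zero := fun a => by simp only [mul_eq, map_zero] }

theorem smul_mul' (c : k) (a b : PathAlgebra k Q) : (c • a) * b = c • (a * b) := by
  simp only [mul_eq, map_smul, LinearMap.smul_apply]

theorem mul_smul' (c : k) (a b : PathAlgebra k Q) : a * (c • b) = c • (a * b) := by
  simp only [mul_eq, map_smul]

theorem ofPath_assoc {i j i' j' i'' j'' : Q} (p : Quiver.Path i j) (q : Quiver.Path i' j')
    (r : Quiver.Path i'' j'') :
    ofPath k p * ofPath k q * ofPath k r = ofPath k p * (ofPath k q * ofPath k r) := by
  by_cases h1 : j' = i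
  · subst h1
    rw [ofPath_mul_ofPath]
    by_cases h2 : j'' = i'
    · subst h2
      rw [ofPath_mul_ofPath, ofPath_mul_ofPath, ofPath_mul_ofPath, Quiver.Path.comp_assoc]
    · rw [ofPath_mul_of_ne _ _ h2, ofPath_mul_of_ne _ _ h2, mul_zero]
  · rw [ofPath_mul_of_ne _ _ h1, zero_mul]
    by_cases h2 : j'' = i'
    · subst h2
      rw [ofPath_mul_ofPath, ofPath_mul_of_ne _ _ h1]
    · rw [ofPath_mul_of_ne _ _ h2, mul_zero]

theorem assoc (a b c : PathAlgebra k Q) : a * b * c = a * (b * c) := by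
  induction a using induction_ofPath with
  | h0 => simp
  | hadd x y hx hy => simp only [add_mul, hx, hy]
  | hsmul s i j p =>
    induction b using induction_ofPath with
    | h0 => simp
    | hadd x y hx hy => simp only [add_mul, mul_add, hx, hy]
    | hsmul s' i' j' q =>
      induction c using induction_ofPath with
      | h0 => simp
      | hadd x y hx hy => simp only [mul_add, hx, hy]
      | hsmul s'' i'' j'' r =>
        simp only [smul_mul', mul_smul', ofPath_assoc]

variable [Fintype Q]

instance : One (PathAlgebra k Q) := ⟨∑ i : Q, vertex k i⟩

theorem one_eq : (1 : PathAlgebra k Q) = ∑ i : Q, vertex k i := rfl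

theorem one_mul' (a : PathAlgebra k Q) : 1 * a = a := by
  induction a using induction_ofPath with
  | h0 => simp
  | hadd x y hx hy => simp only [mul_add, hx, hy]
  | hsmul c i j p =>
    rw [mul_smul', one_eq, Finset.sum_mul, Finset.sum_eq_single j]
    · rw [vertex, ofPath_mul_ofPath, Quiver.Path.comp_nil]
    · intro l _ hl
      exact ofPath_mul_of_ne _ _ hl.symm
    · simp

theorem mul_one' (a : PathAlgebra k Q) : a * 1 = a := by
  induction a using induction_ofPath with
  | h0 => simp
  | hadd x y hx hy => simp only [add_mul, hx, hy]
  | hsmul c i j p =>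
    rw [smul_mul', one_eq, Finset.mul_sum, Finset.sum_eq_single i]
    · rw [vertex, ofPath_mul_ofPath, Quiver.Path.nil_comp]
    · intro l _ hl
      exact ofPath_mul_of_ne _ _ hl
    · simp

instance : Ring (PathAlgebra k Q) :=
  { (inferInstance : NonUnitalNonAssocRing (PathAlgebra k Q)) with
    mul_assoc := assoc
    one_mul := one_mul'
    mul_one := mul_one' }

instance : Algebra k (PathAlgebra k Q) := Algebra.ofModule smul_mul' mul_smul'

end PathAlgebra

/-! ### Bound quivers -/

section BoundQuiver

open PathAlgebra

variable {k : Type w} [Field k] {Q : Type u} [Quiver.{v} Q]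

variable (k Q) in
/-- The space `kQ₁` spanned by the arrows. -/
def arrowSpan : Submodule k (PathAlgebra k Q) :=
  Submodule.span k {x | ∃ (i j : Q) (a : i ⟶ j), x = arrow k a}

/-- A quadratic relation: a linear combination of paths of length two with a common source and a
common target. -/
def IsQuadraticRelation (r : PathAlgebra k Q) : Prop :=
  ∃ i j : Q, r ∈ Submodule.span k
    {x : PathAlgebra k Q | ∃ p : Quiver.Path i j, p.length = 2 ∧ x = ofPath k p}

variable [Fintype Q]

/-- The algebra `kQ/(θ)`, the quotient of the path algebra by the two-sided ideal generated
by `θ`. -/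
abbrev BoundAlgebra (θ : Set (PathAlgebra k Q)) : Type (max u v w) :=
  RingQuot (fun a b : PathAlgebra k Q => a ∈ θ ∧ b = 0)

/-- The canonical projection `kQ → kQ/(θ)`. -/
abbrev toBound (θ : Set (PathAlgebra k Q)) : PathAlgebra k Q →ₐ[k] BoundAlgebra θ :=
  RingQuot.mkAlgHom k (fun a b : PathAlgebra k Q => a ∈ θ ∧ b = 0)

end BoundQuiver

/-- A primitive idempotent: nonzero, and not the sum of two nonzero orthogonal idempotents. -/
def IsPrimitiveIdempotent {A : Type*} [Ring A] (f : A) : Prop :=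
  IsIdempotentElem f ∧ f ≠ 0 ∧
    ∀ x y : A, IsIdempotentElem x → IsIdempotentElem y → x * y = 0 → y * x = 0 → f = x + y →
      x = 0 ∨ y = 0

/-- Pairwise orthogonal primitive idempotents `e i` such that the left modules `A (e i)` represent
each isomorphism class of indecomposable projective modules `A f` exactly once. The
algebra `e A e`, `e = ∑ i, e i`, is then the basic algebra of `A`. -/
structure IsBasicFamily {A : Type*} [Ring A] {ι : Type*} (e : ι → A) : Prop where
  orthogonal : OrthogonalIdempotents e
  primitive : ∀ i, IsPrimitiveIdempotent (e i)
  not_iso : ∀ i j, i ≠ j → IsEmpty (Ideal.span {e i} ≃ₗ[A] Ideal.span {e j})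
  exists_iso : ∀ f : A, IsPrimitiveIdempotent f →
    ∃ i, Nonempty (Ideal.span {f} ≃ₗ[A] Ideal.span {e i})

/-- `(Q, θ)` is a bound quiver of the basic algebra of the graded algebra `A = ⨁ 𝒜 d`: the
relations are quadratic, long paths vanish in `kQ/(θ)`, and `φ` identifies `kQ/(θ)` with the
basic algebra `e A e`, the trivial paths with the homogeneous primitive idempotents `e i`, and
the arrows with elements of degree one. -/
structure IsBoundQuiverOfBasic {k : Type*} [Field k] {Q : Type u} [Quiver.{v} Q] [Fintype Q]
    {A : Type*} [Ring A] [Algebra k A] (𝒜 : ℕ → Submodule k A) (θ : Set (PathAlgebra k Q)) :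
    Prop where
  quadratic : ∀ r ∈ θ, IsQuadraticRelation r
  nilpotent : ∃ N : ℕ, ∀ (i j : Q) (p : Quiver.Path i j), N ≤ p.length →
    toBound θ (PathAlgebra.ofPath k p) = 0
  exists_iso : ∃ e : Q → A, IsBasicFamily e ∧ (∀ i, e i ∈ 𝒜 0) ∧
    ∃ φ : BoundAlgebra θ →ₙₐ[k] A, Function.Injective φ ∧
      Set.range φ = {x | ∃ a : A, x = (∑ i, e i) * a * (∑ i, e i)} ∧
      (∀ i, φ (toBound θ (PathAlgebra.vertex k i)) = e i) ∧
      ∀ (i j : Q) (a : i ⟶ j), φ (toBound θ (PathAlgebra.arrow k a)) ∈ 𝒜 1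

/-! ### Nakayama automorphism and Nakayama translation -/

section Nakayama

open PathAlgebra

variable {k : Type w} [Field k] {Q : Type u} [Quiver.{v} Q] [Fintype Q]

/-- `N` is a graded Nakayama automorphism of `kQ/(θ)` that induces the permutation `ν` of the
vertices: there is a nondegenerate linear form `f` with `f (a b) = f (b N(a))`, and `N` maps the
trivial path at `i` to the one at `ν i` and arrows to linear combinations of arrows. -/
structure IsNakayamaAutomorphism (θ : Set (PathAlgebra k Q)) (ν : Equiv.Perm Q)
    (N : BoundAlgebra θ ≃ₐ[k] BoundAlgebra θ) : Prop where
  frobenius : ∃ f : BoundAlgebra θ →ₗ[k] k,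
    (∀ a, (∀ b, f (a * b) = 0) → a = 0) ∧ (∀ b, (∀ a, f (a * b) = 0) → b = 0) ∧
      ∀ a b, f (a * b) = f (b * N a)
  map_vertex : ∀ i, N (toBound θ (vertex k i)) = toBound θ (vertex k (ν i))
  map_arrow : ∀ (i j : Q) (a : i ⟶ j), ∃ x ∈ arrowSpan k Q,
    N (toBound θ (arrow k a)) = toBound θ x

/-- A maximal bound path: nonzero in `kQ/(θ)`, while every prolongation by an arrow is zero. -/
def IsMaximalBoundPath (θ : Set (PathAlgebra k Q)) {i j : Q} (p : Quiver.Path i j) : Prop :=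
  toBound θ (ofPath k p) ≠ 0 ∧
    (∀ (l : Q) (a : j ⟶ l), toBound θ (ofPath k (p.cons a)) = 0) ∧
    ∀ (h : Q) (a : h ⟶ i), toBound θ (ofPath k (a.toPath.comp p)) = 0

/-- `(Q, θ)` is a stable translation quiver of Loewy length `l + 1` with Nakayama
translation `ν`. -/
structure IsStableTranslationQuiver (θ : Set (PathAlgebra k Q)) (ν : Equiv.Perm Q) (l : ℕ) :
    Prop where
  length_eq : ∀ (i j : Q) (p : Quiver.Path i j), IsMaximalBoundPath θ p → p.length = l
  exists_path : ∀ i : Q, ∃ p : Quiver.Path (ν i) i, IsMaximalBoundPath θ p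
  no_path : ∀ i j : Q, j ≠ i → ∀ p : Quiver.Path (ν i) j, p.length = l →
    toBound θ (ofPath k p) = 0
  dependent : ∀ (i j j' : Q) (p : Quiver.Path i j) (q : Quiver.Path i j'),
    IsMaximalBoundPath θ p → IsMaximalBoundPath θ q →
      ¬ LinearIndependent k ![toBound θ (ofPath k p), toBound θ (ofPath k q)]

end Nakayama

/-! ### The quiver of the cyclic extension -/

section CyclicQuiver

open PathAlgebra

/-- The vertex set `Q₀ × ℤ/m`, with elements `⟨i, t⟩`; the permutation `ν` enters its arrows. -/
@[ext]
structure CyclicVertex {Q : Type u} (ν : Equiv.Perm Q) (m : ℕ) : Type u where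
  /-- the vertex of the original quiver -/
  vert : Q
  /-- the index of the copy -/
  index : ZMod m

/-- The identification of the vertex set with `Q₀ × ℤ/m`. -/
def cyclicVertexEquiv {Q : Type u} (ν : Equiv.Perm Q) (m : ℕ) :
    CyclicVertex ν m ≃ Q × ZMod m where
  toFun x := (x.vert, x.index)
  invFun x := ⟨x.1, x.2⟩

instance {Q : Type u} [Fintype Q] (ν : Equiv.Perm Q) (m : ℕ) [NeZero m] :
    Fintype (CyclicVertex ν m) := Fintype.ofEquiv (Q × ZMod m) (cyclicVertexEquiv ν m).symm

variable {Q : Type u} [Quiver.{v} Q]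

/-- The arrows: `(α, t) : (i, t) → (j, t)` for each arrow `α : i → j`, and
`(β_i, t) : (i, t) → (ν i, t + 1)` for each vertex `i`. -/
inductive CyclicArrow (ν : Equiv.Perm Q) (m : ℕ) :
    CyclicVertex ν m → CyclicVertex ν m → Type (max u v)
  | copy {i j : Q} (a : i ⟶ j) (t : ZMod m) : CyclicArrow ν m ⟨i, t⟩ ⟨j, t⟩
  | conn (i : Q) (t : ZMod m) : CyclicArrow ν m ⟨i, t⟩ ⟨ν i, t + 1⟩

instance (ν : Equiv.Perm Q) (m : ℕ) : Quiver.{max u v} (CyclicVertex ν m) where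
  Hom := CyclicArrow ν m

/-- The embedding of `Q` as the copy with index `t`. -/
def copyPrefunctor (ν : Equiv.Perm Q) (m : ℕ) (t : ZMod m) : Q ⥤q CyclicVertex ν m where
  obj i := ⟨i, t⟩
  map a := CyclicArrow.copy a t

/-- The linear map `r ↦ (r, t)`, sending a path `α_l ⋯ α_1` to `(α_l, t) ⋯ (α_1, t)`. -/
def copyMap (k : Type w) [Field k] (ν : Equiv.Perm Q) (m : ℕ) (t : ZMod m) :
    PathAlgebra k Q →ₗ[k] PathAlgebra k (CyclicVertex ν m) :=
  Finsupp.linearCombination k (fun p : TotalPath Q =>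
    ofPath k ((copyPrefunctor ν m t).mapPath p.path))

/-- The connecting arrow `(β_i, t)` as an element of the path algebra. -/
def connArrow (k : Type w) [Field k] (ν : Equiv.Perm Q) (m : ℕ) (i : Q) (t : ZMod m) :
    PathAlgebra k (CyclicVertex ν m) :=
  arrow (Q := CyclicVertex ν m) k (CyclicArrow.conn i t)

/-- The relations of the cyclic extension, for `kQ/(θ)` with Nakayama automorphism `N`. In
`commute`, `x` is the linear combination of arrows that represents `ν⁻¹ (σ̃ α)`, where `σ̃` is the
automorphism multiplying every arrow by `(-1) ^ s`. -/
inductive CyclicRelation {k : Type w} [Field k] [Fintype Q] (θ : Set (PathAlgebra k Q))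
    (ν : Equiv.Perm Q) (N : BoundAlgebra θ ≃ₐ[k] BoundAlgebra θ) (s m : ℕ) [NeZero m] :
    PathAlgebra k (CyclicVertex ν m) → Prop
  | copy (r : PathAlgebra k Q) (hr : r ∈ θ) (t : ZMod m) :
      CyclicRelation θ ν N s m (copyMap k ν m t r)
  | square (i : Q) (t : ZMod m) :
      CyclicRelation θ ν N s m (connArrow k ν m (ν i) (t + 1) * connArrow k ν m i t)
  | commute {i j : Q} (a : i ⟶ j) (t : ZMod m) (x : PathAlgebra k Q) (hx : x ∈ arrowSpan k Q)
      (hN : toBound θ x = N.symm (toBound θ ((-1 : k) ^ s • arrow k a))) :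
      CyclicRelation θ ν N s m
        (copyMap k ν m t (arrow k a) * connArrow k ν m (ν.symm i) (t - 1) -
          connArrow k ν m (ν.symm j) (t - 1) * copyMap k ν m (t - 1) x)

/-- The relation set of the cyclic extension. -/
def cyclicRelations {k : Type w} [Field k] [Fintype Q] (θ : Set (PathAlgebra k Q))
    (ν : Equiv.Perm Q) (N : BoundAlgebra θ ≃ₐ[k] BoundAlgebra θ) (s m : ℕ) [NeZero m] :
    Set (PathAlgebra k (CyclicVertex ν m)) :=
  {r | CyclicRelation θ ν N s m r}

/-- The permutation `(i, t) ↦ (i, t - 1)`. -/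
def cyclicShift {Q : Type u} (ν : Equiv.Perm Q) (m : ℕ) : Equiv.Perm (CyclicVertex ν m) where
  toFun x := ⟨x.vert, x.index - 1⟩
  invFun x := ⟨x.vert, x.index + 1⟩
  left_inv x := by simp
  right_inv x := by simp

end CyclicQuiver

/-! ### Skew group algebras of exterior algebras -/

section SkewGroup

variable {k : Type w} [Field k] {V : Type u} [AddCommGroup V] [Module k V]

/-- `GL(V)` acts on the exterior algebra by algebra automorphisms. -/
instance exteriorAction : MulSemiringAction (V ≃ₗ[k] V) (ExteriorAlgebra k V) where
  smul g x := ExteriorAlgebra.map (g : V →ₗ[k] V) x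
  one_smul x := by
    change ExteriorAlgebra.map (LinearMap.id : V →ₗ[k] V) x = x
    rw [ExteriorAlgebra.map_id]; rfl
  mul_smul g h x := by
    change ExteriorAlgebra.map ((g : V →ₗ[k] V) ∘ₗ (h : V →ₗ[k] V)) x = _
    rw [← ExteriorAlgebra.map_comp_map]; rfl
  smul_zero g := map_zero (ExteriorAlgebra.map (g : V →ₗ[k] V))
  smul_add g := map_add (ExteriorAlgebra.map (g : V →ₗ[k] V))
  smul_one g := map_one (ExteriorAlgebra.map (g : V →ₗ[k] V))
  smul_mul g := map_mul (ExteriorAlgebra.map (g : V →ₗ[k] V))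

instance exteriorAction_comm : SMulCommClass (V ≃ₗ[k] V) k (ExteriorAlgebra k V) where
  smul_comm g c x := map_smul (ExteriorAlgebra.map (g : V →ₗ[k] V)) c x

/-- The skew group algebra `⋀V * G`, with product `(a g) (b h) = a g(b) gh`. -/
abbrev ExteriorSkew (G : Subgroup (V ≃ₗ[k] V)) : Type (max u w) :=
  SkewMonoidAlgebra (ExteriorAlgebra k V) G

/-- The part of degree `d` of `⋀V * G`, spanned by the `x g` with `x ∈ ⋀^d V` and `g ∈ G`. -/
def exteriorSkewDegree (G : Subgroup (V ≃ₗ[k] V)) (d : ℕ) : Submodule k (ExteriorSkew G) :=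
  Submodule.span k
    {y | ∃ x ∈ ⋀[k]^d V, ∃ g : G, y = SkewMonoidAlgebra.single g x}

/-- The embedding `GL(V) → SL(V ⊕ k)`, `g ↦ diag(g, det(g)⁻¹)`. -/
def detEmbedding : (V ≃ₗ[k] V) →* ((V × k) ≃ₗ[k] (V × k)) where
  toFun g := LinearEquiv.prodCongr g (LinearEquiv.smulOfUnit (LinearEquiv.det g)⁻¹)
  map_one' := by
    ext x <;> simp [LinearEquiv.smulOfUnit, DistribMulAction.toLinearEquiv]
  map_mul' g h := by
    ext x <;> simp [LinearEquiv.smulOfUnit, mul_comm, mul_left_comm, Units.smul_def]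

/-- The transformation `diag(1, …, 1, ξ)` of `V ⊕ k`. -/
def lastScaling (V : Type u) [AddCommGroup V] [Module k V] (ξ : kˣ) :
    (V × k) ≃ₗ[k] (V × k) :=
  LinearEquiv.prodCongr (LinearEquiv.refl k V) (LinearEquiv.smulOfUnit ξ)

/-- The group `G̃ = G' C_m` generated by the image `G'` of `G` in `SL(V ⊕ k)` and by
`diag(1, …, 1, ξ)`. -/
def cyclicExtension (G : Subgroup (V ≃ₗ[k] V)) (ξ : kˣ) : Subgroup ((V × k) ≃ₗ[k] (V × k)) :=
  G.map detEmbedding ⊔ Subgroup.zpowers (lastScaling V ξ)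

end SkewGroup

end

/-! Write `A = ⋀V * G`, `R = ⋀V' * G̃`, `s = dim V`, `E = ∑ e_i`, so that `kQ/(θ)` is the corner `E
A E`. The generator `c = diag(1,…,1,ξ)` commutes with the copy of `A` in `R`, and the last basis
vector `y` satisfies `y² = 0`, `c y = ξ y c` and `y a = τ(a) y`, where `τ(x g) = (-1)^d det(g) x g`
for `x` of degree `d`. Decomposing by the eigenvalues of `c` gives idempotents `ε_t` with `y ε_t =
ε_{t+1} y`, and `R` is the direct sum of the `A ε_t` and `A y ε_t` by a spanning argument and a
dimension count (`isCyclicExtension`).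

On `A` the form `∑ x_h h ↦ top(x_1)` is nondegenerate, with Nakayama automorphism `ρ(x g) =
(-1)^{d(s+1)} det(g) x g` (`isGradedFrobenius_skewForm`). Thus `τ` and `ρ` agree in degree zero and
differ by `(-1)^s` in degree one: this is the origin of the sign `σ̃`. The given automorphism `N` of
the corner is an arbitrary graded Nakayama automorphism, and `ρ` need not preserve `E`. The
discrepancy is absorbed by an element `u` of degree zero that freely generates `E A ρ(E)` over the
corner and intertwines `N` with `ρ` (`exists_intertwiner`). The connecting arrow `(β_i, t)` is
realized by `u y e_i ε_t`, and the stated relations hold.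

No further relations are needed. Modulo the listed ones every element is a sum of terms `x` and `β
x`, with `x` inside one copy of `Q` and `β` the sum of the connecting arrows leaving it
(`exists_normalForm`). Directness of the decomposition of `R` and freeness of `u` make the images of
these normal forms independent and show that they fill the corner of `R` (`exists_cyclic`).

Being a basic algebra is transported through fullness of the idempotent, `1 ∈ A E A`. Fullness
passes at once from `A` to `R`, and together with the presentation by a graded quiver it forces the
`e_i` to be a basic family (`isBasicFamily`). For the last claim the Nakayama automorphism of `R` is
used: `det` is trivial on `G'` and equals `ξ` on `c`, so `e_i ε_t` goes to `e_i ε_{t-1}`. The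
statements on maximal paths hold for every realization whose ambient algebra has a graded Frobenius
form with Nakayama automorphism permuting the idempotents (`isStableTranslationQuiver`). -/

noncomputable section

universe u v w

namespace PathAlgebra

/-! ### Homomorphisms out of a path algebra -/

section Eval

variable {k : Type w} [Field k] {Q : Type u} [Quiver.{v} Q]
variable {C : Type*} [Ring C] [Algebra k C]

/-- The product of elements attached to the arrows of a path, starting with the element attached
to its source. -/
def evalPath (e : Q → C) (c : ∀ {i j : Q}, (i ⟶ j) → C) {i : Q} :
    ∀ {j : Q}, Quiver.Path i j → C
  | _, .nil => e i
  | _, .cons p a => c a * evalPath e c p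

variable {e : Q → C} {c : ∀ {i j : Q}, (i ⟶ j) → C}

theorem mul_evalPath (he : OrthogonalIdempotents e)
    (hl : ∀ {i j : Q} (a : i ⟶ j), e j * c a = c a) {i j : Q} (p : Quiver.Path i j) :
    e j * evalPath e c p = evalPath e c p := by
  cases p with
  | nil => exact he.idem i
  | cons p a => rw [evalPath, ← mul_assoc, hl]

theorem evalPath_mul (he : OrthogonalIdempotents e) {i j : Q} (p : Quiver.Path i j) :
    evalPath e c p * e i = evalPath e c p := by
  induction p with
  | nil => exact he.idem i
  | cons p a ih => rw [evalPath, mul_assoc, ih]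

theorem evalPath_comp (he : OrthogonalIdempotents e)
    (hl : ∀ {i j : Q} (a : i ⟶ j), e j * c a = c a) {i j l : Q} (p : Quiver.Path i j)
    (q : Quiver.Path j l) :
    evalPath e c (p.comp q) = evalPath e c q * evalPath e c p := by
  induction q with
  | nil => rw [Quiver.Path.comp_nil, evalPath, mul_evalPath he hl]
  | cons q a ih => rw [Quiver.Path.comp_cons, evalPath, evalPath, ih, mul_assoc]

variable (k e c) in
/-- The linear extension of `evalPath` to the path algebra. -/
def evalLin : PathAlgebra k Q →ₗ[k] C :=
  Finsupp.linearCombination k (fun p : TotalPath Q => evalPath e c p.path)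

theorem evalLin_ofPath {i j : Q} (p : Quiver.Path i j) :
    evalLin k e c (ofPath k p) = evalPath e c p := by
  unfold evalLin ofPath
  erw [Finsupp.linearCombination_single, one_smul]

/-- Non-composable paths have product zero because two orthogonal idempotents meet between their
values. Compatibility of the arrows with their targets is enough, since the initial factor `e i` in
`evalPath` supplies the idempotent at the source. -/
theorem evalLin_mul (he : OrthogonalIdempotents e)
    (hl : ∀ {i j : Q} (a : i ⟶ j), e j * c a = c a) (x y : PathAlgebra k Q) :
    evalLin k e c (x * y) = evalLin k e c x * evalLin k e c y := by
  induction x using induction_ofPath with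
  | h0 => simp
  | hadd x y hx hy => simp only [add_mul, map_add, hx, hy]
  | hsmul s i j p =>
    induction y using induction_ofPath with
    | h0 => simp
    | hadd x y hx hy => simp only [mul_add, map_add, hx, hy]
    | hsmul s' i' j' q =>
      simp only [smul_mul', mul_smul', map_smul, smul_mul_assoc, mul_smul_comm, evalLin_ofPath]
      congr 2
      by_cases h : j' = i
      · subst h
        rw [ofPath_mul_ofPath, evalLin_ofPath, evalPath_comp he hl]
      · rw [ofPath_mul_of_ne _ _ h, map_zero, ← evalPath_mul he p, ← mul_evalPath he hl q,
          mul_assoc, ← mul_assoc (e i), he.ortho (fun h' => h h'.symm), zero_mul, mul_zero]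

variable (k) in
/-- The homomorphism from the path algebra determined by orthogonal idempotents attached to the
vertices and compatible elements attached to the arrows. -/
def liftNonUnital (he : OrthogonalIdempotents e)
    (hl : ∀ {i j : Q} (a : i ⟶ j), e j * c a = c a) : PathAlgebra k Q →ₙₐ[k] C :=
  { evalLin k e c with
    map_zero' := map_zero (evalLin k e c)
    map_mul' := evalLin_mul he hl }

theorem liftNonUnital_ofPath (he : OrthogonalIdempotents e)
    (hl : ∀ {i j : Q} (a : i ⟶ j), e j * c a = c a) {i j : Q} (p : Quiver.Path i j) :
    liftNonUnital k he hl (ofPath k p) = evalPath e c p :=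
  evalLin_ofPath (k := k) p

theorem liftNonUnital_vertex (he : OrthogonalIdempotents e)
    (hl : ∀ {i j : Q} (a : i ⟶ j), e j * c a = c a) (i : Q) :
    liftNonUnital k he hl (vertex k i) = e i :=
  liftNonUnital_ofPath he hl _

theorem liftNonUnital_arrow (he : OrthogonalIdempotents e)
    (hl : ∀ {i j : Q} (a : i ⟶ j), e j * c a = c a)
    (hr : ∀ {i j : Q} (a : i ⟶ j), c a * e i = c a) {i j : Q} (a : i ⟶ j) :
    liftNonUnital k he hl (arrow k a) = c a :=
  (liftNonUnital_ofPath he hl _).trans (hr a)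

end Eval

/-! ### Generation by arrows and the length grading -/

section Generation

variable {k : Type w} [Field k] {Q : Type u} [Quiver.{v} Q]

theorem arrow_mul_ofPath {i j l : Q} (a : j ⟶ l) (p : Quiver.Path i j) :
    arrow k a * ofPath k p = ofPath k (p.cons a) := by
  rw [arrow, ofPath_mul_ofPath]; rfl

theorem vertex_mul_ofPath {i j : Q} (p : Quiver.Path i j) :
    vertex k j * ofPath k p = ofPath k p := by
  rw [vertex, ofPath_mul_ofPath, Quiver.Path.comp_nil]

theorem ofPath_mul_vertex {i j : Q} (p : Quiver.Path i j) :
    ofPath k p * vertex k i = ofPath k p := by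
  rw [vertex, ofPath_mul_ofPath, Quiver.Path.nil_comp]

theorem vertex_mul_ofPath_of_ne {i j l : Q} (p : Quiver.Path i j) (h : j ≠ l) :
    vertex k l * ofPath k p = 0 := ofPath_mul_of_ne _ _ h

theorem ofPath_mul_vertex_of_ne {i j l : Q} (p : Quiver.Path i j) (h : l ≠ i) :
    ofPath k p * vertex k l = 0 := ofPath_mul_of_ne _ _ h

/-- A subspace that contains the trivial paths and is stable under left multiplication by arrows
is the whole path algebra. -/
theorem mem_of_left_stable (S : Submodule k (PathAlgebra k Q)) (hv : ∀ i, vertex k i ∈ S)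
    (ha : ∀ {i j : Q} (a : i ⟶ j) (x), x ∈ S → arrow k a * x ∈ S) (x : PathAlgebra k Q) :
    x ∈ S := by
  induction x using induction_ofPath with
  | h0 => exact S.zero_mem
  | hadd x y hx hy => exact S.add_mem hx hy
  | hsmul s i j p =>
    refine S.smul_mem _ ?_
    induction p with
    | nil => exact hv i
    | cons p a ih => rw [← arrow_mul_ofPath]; exact ha a _ ih

theorem vertex_orthogonal [Fintype Q] : OrthogonalIdempotents (fun i : Q => vertex k i) where
  idem _ := vertex_mul_ofPath _
  ortho _ _ h := ofPath_mul_of_ne _ _ (Ne.symm h)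

variable (k Q) in
/-- The component spanned by the paths of length `d`. -/
def lengthPart (d : ℕ) : PathAlgebra k Q →ₗ[k] PathAlgebra k Q :=
  Finsupp.linearCombination k
    (fun p : TotalPath Q => if p.path.length = d then ofPath k p.path else 0)

theorem lengthPart_ofPath (d : ℕ) {i j : Q} (p : Quiver.Path i j) :
    lengthPart k Q d (ofPath k p) = if p.length = d then ofPath k p else 0 := by
  unfold lengthPart ofPath
  erw [Finsupp.linearCombination_single, one_smul]

theorem lengthPart_zero_mem [Fintype Q] (x : PathAlgebra k Q) :
    ∃ c : Q → k, lengthPart k Q 0 x = ∑ i, c i • vertex k i := by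
  classical
  induction x using induction_ofPath with
  | h0 => exact ⟨0, by simp⟩
  | hadd x y hx hy =>
    obtain ⟨c, hc⟩ := hx
    obtain ⟨d, hd⟩ := hy
    exact ⟨c + d, by simp [hc, hd, add_smul, Finset.sum_add_distrib]⟩
  | hsmul s i j p =>
    rw [map_smul, lengthPart_ofPath]
    split_ifs with h
    · cases p with
      | nil =>
        refine ⟨Pi.single i s, ?_⟩
        rw [Finset.sum_eq_single i]
        · simp [vertex]
        · intro j _ hj; simp [hj]
        · simp
      | cons p a => simp at h
    · exact ⟨0, by simp⟩

theorem lengthPart_one_mem (x : PathAlgebra k Q) : lengthPart k Q 1 x ∈ arrowSpan k Q := by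
  induction x using induction_ofPath with
  | h0 => simp
  | hadd x y hx hy => rw [map_add]; exact add_mem hx hy
  | hsmul s i j p =>
    rw [map_smul, lengthPart_ofPath]
    refine Submodule.smul_mem _ _ ?_
    split_ifs with h
    · cases p with
      | nil => simp at h
      | cons p a =>
        cases p with
        | nil => exact Submodule.subset_span ⟨_, _, a, rfl⟩
        | cons p b => simp at h
    · exact zero_mem _

theorem lengthPart_of_mem_arrowSpan {x : PathAlgebra k Q} (hx : x ∈ arrowSpan k Q) :
    lengthPart k Q 1 x = x := by
  induction hx using Submodule.span_induction with
  | mem x hx =>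
    obtain ⟨i, j, a, rfl⟩ := hx
    rw [arrow, lengthPart_ofPath, if_pos (by simp)]
  | zero => simp
  | add x y _ _ hx hy => rw [map_add, hx, hy]
  | smul c x _ hx => rw [map_smul, hx]

variable (k Q) in
/-- The span of the paths of length at least two. -/
def longPaths : Submodule k (PathAlgebra k Q) :=
  Submodule.span k {x | ∃ (i j : Q) (p : Quiver.Path i j), 2 ≤ p.length ∧ x = ofPath k p}

theorem lengthPart_one_longPaths {x : PathAlgebra k Q} (hx : x ∈ longPaths k Q) :
    lengthPart k Q 1 x = 0 := by
  induction hx using Submodule.span_induction with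
  | mem x hx =>
    obtain ⟨i, j, p, hp, rfl⟩ := hx
    rw [lengthPart_ofPath, if_neg (by omega)]
  | zero => simp
  | add x y _ _ hx hy => rw [map_add, hx, hy, add_zero]
  | smul c x _ hx => rw [map_smul, hx, smul_zero]

theorem mul_mem_longPaths (a : PathAlgebra k Q) {x : PathAlgebra k Q} (hx : x ∈ longPaths k Q) :
    a * x ∈ longPaths k Q := by
  induction hx using Submodule.span_induction with
  | mem x hx =>
    obtain ⟨i, j, p, hp, rfl⟩ := hx
    induction a using induction_ofPath with
    | h0 => simp
    | hadd x y hx hy => rw [add_mul]; exact add_mem hx hy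
    | hsmul s i' j' q =>
      rw [smul_mul']
      refine Submodule.smul_mem _ _ ?_
      by_cases h : j = i'
      · subst h
        rw [ofPath_mul_ofPath]
        exact Submodule.subset_span ⟨_, _, _, by rw [Quiver.Path.length_comp]; omega, rfl⟩
      · rw [ofPath_mul_of_ne _ _ h]; exact zero_mem _
  | zero => simp
  | add x y _ _ hx hy => rw [mul_add]; exact add_mem hx hy
  | smul c x _ hx => rw [mul_smul']; exact Submodule.smul_mem _ _ hx

theorem longPaths_mul_mem (a : PathAlgebra k Q) {x : PathAlgebra k Q} (hx : x ∈ longPaths k Q) :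
    x * a ∈ longPaths k Q := by
  induction hx using Submodule.span_induction with
  | mem x hx =>
    obtain ⟨i, j, p, hp, rfl⟩ := hx
    induction a using induction_ofPath with
    | h0 => simp
    | hadd x y hx hy => rw [mul_add]; exact add_mem hx hy
    | hsmul s i' j' q =>
      rw [mul_smul']
      refine Submodule.smul_mem _ _ ?_
      by_cases h : j' = i
      · subst h
        rw [ofPath_mul_ofPath]
        exact Submodule.subset_span ⟨_, _, _, by rw [Quiver.Path.length_comp]; omega, rfl⟩
      · rw [ofPath_mul_of_ne _ _ h]; exact zero_mem _
  | zero => simp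
  | add x y _ _ hx hy => rw [add_mul]; exact add_mem hx hy
  | smul c x _ hx => rw [smul_mul']; exact Submodule.smul_mem _ _ hx

theorem mem_longPaths_of_quadratic {r : PathAlgebra k Q} (hr : IsQuadraticRelation r) :
    r ∈ longPaths k Q := by
  obtain ⟨i, j, h⟩ := hr
  refine Submodule.span_mono ?_ h
  rintro x ⟨p, hp, rfl⟩
  exact ⟨i, j, p, hp.ge, rfl⟩

end Generation

end PathAlgebra

/-! ### The ideal of relations and maps out of `kQ/(θ)` -/

section Bound

open PathAlgebra

variable {k : Type w} [Field k] {Q : Type u} [Quiver.{v} Q] [Fintype Q]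
variable {θ : Set (PathAlgebra k Q)}

theorem toBound_eq_zero_of_mem {r : PathAlgebra k Q} (hr : r ∈ θ) : toBound θ r = 0 := by
  rw [← map_zero (toBound θ)]
  exact RingQuot.mkAlgHom_rel k ⟨hr, rfl⟩

theorem toBound_surjective : Function.Surjective (toBound θ) := RingQuot.mkAlgHom_surjective k _

/-- The kernel of `kQ → kQ/(θ)` lies in every two-sided ideal that contains `θ`. -/
theorem mem_of_toBound_eq_zero (J : Submodule k (PathAlgebra k Q)) (hθ : ∀ r ∈ θ, r ∈ J)
    (hl : ∀ a x, x ∈ J → a * x ∈ J) (hr : ∀ a x, x ∈ J → x * a ∈ J) {x : PathAlgebra k Q}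
    (hx : toBound θ x = 0) : x ∈ J := by
  -- Congruence modulo `J`. It identifies every member of `θ` with zero, so the projection onto the
  -- quotient by `J` factors through `kQ/(θ)`.
  let c : RingCon (PathAlgebra k Q) :=
    { r := fun a b => a - b ∈ J
      iseqv :=
        { refl := fun a => by simp
          symm := fun {a b} h => by simpa using J.neg_mem h
          trans := fun {a b c} h h' => by simpa using J.add_mem h h' }
      add' := fun {a b c d} h h' => by
        have := J.add_mem h h'
        rwa [sub_add_sub_comm] at this
      mul' := fun {a b c d} h h' => by
        have := J.add_mem (hr c _ h) (hl b _ h')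
        rwa [sub_mul, mul_sub, sub_add_sub_cancel] at this }
  have hmk : ∀ ⦃a b : PathAlgebra k Q⦄, (a ∈ θ ∧ b = 0) → c.mk' a = c.mk' b := by
    rintro a b ⟨ha, rfl⟩
    refine (RingCon.eq c).2 ?_
    change a - 0 ∈ J
    rw [sub_zero]; exact hθ a ha
  have key := RingQuot.lift_mkRingHom_apply c.mk' hmk x
  have h0 : RingQuot.mkRingHom (fun a b : PathAlgebra k Q => a ∈ θ ∧ b = 0) x = 0 := by
    rw [← hx, toBound, ← RingQuot.mkAlgHom_coe k]; rfl
  rw [h0, map_zero, ← map_zero c.mk'] at key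
  have : (0 : PathAlgebra k Q) - x ∈ J := (RingCon.eq c).1 key
  simpa using this

/-- A homomorphism from the path algebra, possibly not unital, that kills `θ` factors through
`kQ/(θ)`. -/
theorem exists_boundAlgebra_lift {C : Type*} [Ring C] [Algebra k C]
    (ψ : PathAlgebra k Q →ₙₐ[k] C) (hψ : ∀ r ∈ θ, ψ r = 0) :
    ∃ Φ : BoundAlgebra θ →ₙₐ[k] C, ∀ x, Φ (toBound θ x) = ψ x := by
  have hker : ∀ x y, toBound θ x = toBound θ y → ψ x = ψ y := by
    intro x y h
    have h0 : toBound θ (x - y) = 0 := by rw [map_sub, h, sub_self]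
    have := mem_of_toBound_eq_zero (θ := θ) (LinearMap.ker (ψ : PathAlgebra k Q →ₗ[k] C))
      (fun r hr => hψ r hr)
      (fun a x hx => by
        have hx' : ψ x = 0 := hx
        change ψ (a * x) = 0
        rw [map_mul, hx', mul_zero])
      (fun a x hx => by
        have hx' : ψ x = 0 := hx
        change ψ (x * a) = 0
        rw [map_mul, hx', zero_mul]) h0
    have h1 : ψ (x - y) = 0 := this
    rwa [map_sub, sub_eq_zero] at h1
  -- `ψ` need not send `1` to `1`, so the factorization is built from chosen preimages; `hker` makes
  -- the choice immaterial.
  let g := Function.surjInv (toBound_surjective (θ := θ))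
  have hg : ∀ b, toBound θ (g b) = b := Function.surjInv_eq _
  refine ⟨{ toFun := fun b => ψ (g b), map_smul' := ?_, map_zero' := ?_, map_add' := ?_,
            map_mul' := ?_ }, fun x => hker _ _ (hg _)⟩
  · intro c b
    rw [MonoidHom.id_apply, ← map_smul]
    exact hker _ _ (by rw [hg, map_smul, hg])
  · rw [← map_zero ψ]
    exact hker _ _ (by rw [hg, map_zero])
  · intro a b
    rw [← map_add]
    exact hker _ _ (by rw [hg, map_add, hg, hg])
  · intro a b
    rw [← map_mul]
    exact hker _ _ (by rw [hg, map_mul, hg, hg])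

/-- If the relations are quadratic, linear combinations of arrows are determined by their
classes. -/
theorem arrowSpan_injOn (hθ : ∀ r ∈ θ, IsQuadraticRelation r) {x y : PathAlgebra k Q}
    (hx : x ∈ arrowSpan k Q) (hy : y ∈ arrowSpan k Q) (h : toBound θ x = toBound θ y) :
    x = y := by
  have h0 : toBound θ (x - y) = 0 := by rw [map_sub, h, sub_self]
  -- Quadratic relations generate an ideal inside the span of the paths of length at least two,
  -- which has no component of length one.
  have h1 := mem_of_toBound_eq_zero (longPaths k Q)
    (fun r hr => mem_longPaths_of_quadratic (hθ r hr))
    (fun a x hx => mul_mem_longPaths a hx) (fun a x hx => longPaths_mul_mem a hx) h0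
  have h2 := lengthPart_one_longPaths h1
  rw [lengthPart_of_mem_arrowSpan (sub_mem hx hy)] at h2
  exact sub_eq_zero.1 h2

end Bound

/-! ### Graded algebras with finitely many components -/

section Graded

variable {k : Type*} [Field k] {A : Type*} [Ring A] [Algebra k A]
variable (𝒜 : ℕ → Submodule k A) [GradedAlgebra 𝒜]

theorem gradedProj_mem (d : ℕ) (a : A) : GradedAlgebra.proj 𝒜 d a ∈ 𝒜 d := by
  rw [GradedAlgebra.proj_apply]; exact SetLike.coe_mem _

variable {𝒜} in
theorem gradedProj_of_mem {d : ℕ} {a : A} (h : a ∈ 𝒜 d) : GradedAlgebra.proj 𝒜 d a = a := by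
  rw [GradedAlgebra.proj_apply, DirectSum.decompose_of_mem_same 𝒜 h]

variable {𝒜} in
theorem gradedProj_of_mem_ne {d d' : ℕ} {a : A} (h : a ∈ 𝒜 d) (hd : d ≠ d') :
    GradedAlgebra.proj 𝒜 d' a = 0 := by
  rw [GradedAlgebra.proj_apply, DirectSum.decompose_of_mem_ne 𝒜 h hd]

theorem gradedProj_zero_mul (a b : A) :
    GradedAlgebra.proj 𝒜 0 (a * b) = GradedAlgebra.proj 𝒜 0 a * GradedAlgebra.proj 𝒜 0 b :=
  map_mul (GradedRing.projZeroRingHom 𝒜) a b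

theorem gradedProj_zero_one : GradedAlgebra.proj 𝒜 0 (1 : A) = 1 :=
  map_one (GradedRing.projZeroRingHom 𝒜)

theorem gradedProj_left {d : ℕ} {a : A} (h : a ∈ 𝒜 d) (j : ℕ) (b : A) :
    GradedAlgebra.proj 𝒜 (d + j) (a * b) = a * GradedAlgebra.proj 𝒜 j b := by
  simp only [GradedAlgebra.proj_apply]
  exact DirectSum.coe_decompose_mul_add_of_left_mem 𝒜 h

theorem gradedProj_right {d : ℕ} {b : A} (h : b ∈ 𝒜 d) (j : ℕ) (a : A) :
    GradedAlgebra.proj 𝒜 (j + d) (a * b) = GradedAlgebra.proj 𝒜 j a * b := by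
  simp only [GradedAlgebra.proj_apply]
  exact DirectSum.coe_decompose_mul_add_of_right_mem 𝒜 h

theorem exists_sum_gradedProj (a : A) :
    ∃ s : Finset ℕ, a = ∑ d ∈ s, GradedAlgebra.proj 𝒜 d a := by
  classical
  refine ⟨(DirectSum.decompose 𝒜 a).support, ?_⟩
  simp only [GradedAlgebra.proj_apply]
  exact (DirectSum.sum_support_decompose 𝒜 a).symm

theorem eq_zero_of_gradedProj {a : A} (h : ∀ d, GradedAlgebra.proj 𝒜 d a = 0) : a = 0 := by
  obtain ⟨s, hs⟩ := exists_sum_gradedProj 𝒜 a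
  rw [hs]; exact Finset.sum_eq_zero fun d _ => h d

/-- Orders of vanishing add: `a` starts in degree at least one and `b` in degree at least `j`. -/
theorem gradedProj_mul_eq_zero {a b : A} {j : ℕ} (ha : GradedAlgebra.proj 𝒜 0 a = 0)
    (hb : ∀ d < j, GradedAlgebra.proj 𝒜 d b = 0) :
    ∀ d < j + 1, GradedAlgebra.proj 𝒜 d (a * b) = 0 := by
  intro d hd
  obtain ⟨s, hs⟩ := exists_sum_gradedProj 𝒜 a
  obtain ⟨t, ht⟩ := exists_sum_gradedProj 𝒜 b
  rw [hs, ht, Finset.sum_mul_sum, map_sum]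
  refine Finset.sum_eq_zero fun x _ => ?_
  rw [map_sum]
  refine Finset.sum_eq_zero fun y _ => ?_
  by_cases hx : x = 0
  · rw [hx, ha, zero_mul, map_zero]
  by_cases hy : y < j
  · rw [hb y hy, mul_zero, map_zero]
  · exact gradedProj_of_mem_ne
      (SetLike.GradedMul.mul_mem (gradedProj_mem 𝒜 x a) (gradedProj_mem 𝒜 y b)) (by omega)

/-- In a graded algebra with finitely many nonzero components, elements without component of
degree zero are nilpotent. -/
theorem isNilpotent_of_gradedProj_zero {n : ℕ} (hn : ∀ d, n < d → 𝒜 d = ⊥) {a : A}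
    (ha : GradedAlgebra.proj 𝒜 0 a = 0) : IsNilpotent a := by
  have key : ∀ j, ∀ d < j, GradedAlgebra.proj 𝒜 d (a ^ j) = 0 := by
    intro j
    induction j with
    | zero => intro d hd; omega
    | succ j ih => rw [pow_succ']; exact gradedProj_mul_eq_zero 𝒜 ha ih
  refine ⟨n + 1, eq_zero_of_gradedProj 𝒜 fun d => ?_⟩
  by_cases hd : d < n + 1
  · exact key _ _ hd
  · have := gradedProj_mem 𝒜 d (a ^ (n + 1))
    rw [hn d (by omega)] at this
    exact this

/-- A nilpotent idempotent is zero. Through this lemma idempotents are detected by their components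
of degree zero. -/
theorem eq_zero_of_isIdempotentElem_of_gradedProj {n : ℕ} (hn : ∀ d, n < d → 𝒜 d = ⊥) {a : A}
    (hi : IsIdempotentElem a) (ha : GradedAlgebra.proj 𝒜 0 a = 0) : a = 0 := by
  obtain ⟨j, hj⟩ := isNilpotent_of_gradedProj_zero 𝒜 hn ha
  cases j with
  | zero => rw [pow_zero] at hj; rw [← mul_one a, hj, mul_zero]
  | succ j => rwa [hi.pow_succ_eq] at hj

end Graded

/-! ### Left ideals generated by idempotents -/

section Idempotents

variable {A : Type*} [Ring A]

/-- Mutually inverse elements between two idempotents give an isomorphism of the left ideals they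
generate. -/
def spanSingletonEquiv {f g p q : A} (hf : q * p = f) (hg : p * q = g) (hp : p * f = p)
    (hq : q * g = q) : Ideal.span {f} ≃ₗ[A] Ideal.span {g} where
  toFun x := ⟨x.1 * q, by
    rw [← hq, ← mul_assoc]; exact Ideal.mul_mem_left _ _ (Ideal.mem_span_singleton_self g)⟩
  invFun x := ⟨x.1 * p, by
    rw [← hp, ← mul_assoc]; exact Ideal.mul_mem_left _ _ (Ideal.mem_span_singleton_self f)⟩
  map_add' x y := by ext; simp [add_mul]
  map_smul' c x := by ext; simp [mul_assoc]
  left_inv x := by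
    obtain ⟨x, hx⟩ := x
    obtain ⟨a, rfl⟩ := Ideal.mem_span_singleton'.1 hx
    ext
    simp only [mul_assoc, hf]
    rw [← hf]; simp only [mul_assoc]; rw [hf, hp, hf]
  right_inv x := by
    obtain ⟨x, hx⟩ := x
    obtain ⟨a, rfl⟩ := Ideal.mem_span_singleton'.1 hx
    ext
    simp only [mul_assoc, hg]
    rw [← hg]; simp only [mul_assoc]; rw [hg, hq, hg]

/-- Homomorphisms `A f → A g` of left modules are right multiplications by elements of `f A g`; here
`b = ψ(f)` and `c = ψ⁻¹(g)`. -/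
theorem exists_mul_of_spanSingletonEquiv {f g : A} (hf : IsIdempotentElem f)
    (hg : IsIdempotentElem g) (ψ : Ideal.span {f} ≃ₗ[A] Ideal.span {g}) :
    ∃ b c : A, f = b * c ∧ f * b = b ∧ b * g = b ∧ g * c = c := by
  let F : Ideal.span {f} := ⟨f, Ideal.mem_span_singleton_self f⟩
  let K : Ideal.span {g} := ⟨g, Ideal.mem_span_singleton_self g⟩
  have hF : f • F = F := Subtype.ext hf
  have hK : g • K = K := Subtype.ext hg
  have hb : ((ψ F : Ideal.span {g}) : A) * g = ψ F := by
    obtain ⟨a, ha⟩ := Ideal.mem_span_singleton'.1 (ψ F).2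
    rw [← ha, mul_assoc, hg.eq]
  refine ⟨ψ F, ψ.symm K, ?_, ?_, hb, ?_⟩
  · have h1 : ((ψ F : Ideal.span {g}) : A) • K = ψ F := Subtype.ext hb
    have h2 : ((ψ F : Ideal.span {g}) : A) • ψ.symm K = F := by
      rw [← map_smul, h1, ψ.symm_apply_apply]
    exact (congrArg Subtype.val h2).symm
  · have := congrArg Subtype.val (map_smul ψ f F)
    rw [hF] at this
    exact this.symm
  · have := congrArg Subtype.val (map_smul ψ.symm g K)
    rw [hK] at this
    exact this.symm

/-- In a finite-dimensional algebra, a basic family generates the unit ideal. -/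
theorem IsBasicFamily.one_mem_span {k : Type*} [Field k] [Algebra k A] [FiniteDimensional k A]
    {ι : Type*} [Fintype ι] {e : ι → A} (he : IsBasicFamily e) :
    (1 : A) ∈ Submodule.span k {x | ∃ a b, x = a * (∑ i, e i) * b} := by
  classical
  let d : A → ℕ := fun f => Module.finrank k ((Ideal.span {f}).restrictScalars k)
  have hlt : ∀ f x y : A, f = x + y → IsIdempotentElem x → IsIdempotentElem y → x * y = 0 →
      y * x = 0 → y ≠ 0 → d x < d f := by
    intro f x y hf hx hy hxy hyx hy0
    refine Submodule.finrank_lt_finrank_of_lt (lt_of_le_of_ne ?_ ?_)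
    · intro z hz
      obtain ⟨a, rfl⟩ := Ideal.mem_span_singleton'.1 hz
      refine Ideal.mem_span_singleton'.2 ⟨a * x, ?_⟩
      rw [hf, mul_add, mul_assoc, hx.eq, mul_assoc, hxy, mul_zero, add_zero]
    · intro h
      have : y ∈ (Ideal.span {x}).restrictScalars k := by
        rw [h]
        refine Ideal.mem_span_singleton'.2 ⟨y, ?_⟩
        rw [hf, mul_add, hyx, hy.eq, zero_add]
      obtain ⟨a, ha⟩ := Ideal.mem_span_singleton'.1 this
      apply hy0
      rw [← hy.eq]
      nth_rw 1 [← ha]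
      rw [mul_assoc, hxy, mul_zero]
  -- Induction on `dim A f`: an idempotent that is not primitive splits into two summands that
  -- generate strictly smaller left ideals. The claim is the case `f = 1`.
  have key : ∀ N : ℕ, ∀ f : A, IsIdempotentElem f → d f ≤ N →
      f ∈ Submodule.span k {x | ∃ a b, x = a * (∑ i, e i) * b} := by
    intro N
    induction N using Nat.strong_induction_on with
    | _ N ih =>
      intro f hf hN
      by_cases h0 : f = 0
      · rw [h0]; exact zero_mem _
      by_cases hp : IsPrimitiveIdempotent f
      · obtain ⟨i, ⟨ψ⟩⟩ := he.exists_iso f hp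
        obtain ⟨b, c, h, -, hb, -⟩ :=
          exists_mul_of_spanSingletonEquiv hf (he.orthogonal.idem i) ψ
        -- Since `e_i E = e_i` and `b e_i = b`, the product `(b e_i) E c` equals `b c = f`.
        refine Submodule.subset_span ⟨b * e i, c, ?_⟩
        rw [mul_assoc b, Finset.mul_sum, Finset.sum_eq_single i, he.orthogonal.idem i, hb, h]
        · intro j _ hj; exact he.orthogonal.ortho hj.symm
        · simp
      · have : ∃ x y : A, IsIdempotentElem x ∧ IsIdempotentElem y ∧ x * y = 0 ∧ y * x = 0 ∧
            f = x + y ∧ x ≠ 0 ∧ y ≠ 0 := by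
          by_contra hcon
          refine hp ⟨hf, h0, fun x y hx hy hxy hyx hfxy => ?_⟩
          by_contra hne
          rw [not_or] at hne
          exact hcon ⟨x, y, hx, hy, hxy, hyx, hfxy, hne.1, hne.2⟩
        obtain ⟨x, y, hx, hy, hxy, hyx, hfxy, hx0, hy0⟩ := this
        have h1 := hlt f x y hfxy hx hy hxy hyx hy0
        have h2 := hlt f y x (by rw [hfxy, add_comm]) hy hx hyx hxy hx0
        rw [hfxy]
        exact add_mem (ih (d x) (by omega) x hx le_rfl) (ih (d y) (by omega) y hy le_rfl)
  exact key _ 1 IsIdempotentElem.one le_rfl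

end Idempotents

/-! ### Realizing `kQ/(θ)` as a full corner of a graded algebra -/

section Realization

open PathAlgebra

/-- `kQ/(θ)` is realized by `φ` as the corner of the graded algebra `A = ⨁ 𝒜 d` at the full
idempotent `∑ i, e i`. -/
structure IsRealization {k : Type*} [Field k] {Q : Type u} [Quiver.{v} Q] [Fintype Q]
    {A : Type*} [Ring A] [Algebra k A] (𝒜 : ℕ → Submodule k A) (θ : Set (PathAlgebra k Q))
    (e : Q → A) (φ : BoundAlgebra θ →ₙₐ[k] A) : Prop where
  quadratic : ∀ r ∈ θ, IsQuadraticRelation r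
  orthogonal : OrthogonalIdempotents e
  ne_zero : ∀ i, e i ≠ 0
  degree_zero : ∀ i, e i ∈ 𝒜 0
  full : (1 : A) ∈ Submodule.span k {x | ∃ a b, x = a * (∑ i, e i) * b}
  injective : Function.Injective φ
  range_eq : Set.range φ = {x | ∃ a : A, x = (∑ i, e i) * a * (∑ i, e i)}
  map_vertex : ∀ i, φ (toBound θ (vertex k i)) = e i
  map_arrow : ∀ (i j : Q) (a : i ⟶ j), φ (toBound θ (arrow k a)) ∈ 𝒜 1

namespace IsRealization

variable {k : Type*} [Field k] {Q : Type u} [Quiver.{v} Q] [Fintype Q]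
  {A : Type*} [Ring A] [Algebra k A] {𝒜 : ℕ → Submodule k A}
  {θ : Set (PathAlgebra k Q)} {e : Q → A} {φ : BoundAlgebra θ →ₙₐ[k] A}

theorem mul_sum (h : IsRealization 𝒜 θ e φ) (i : Q) : e i * ∑ j, e j = e i := by
  rw [Finset.mul_sum, Finset.sum_eq_single i, h.orthogonal.idem i]
  · intro j _ hj; exact h.orthogonal.ortho hj.symm
  · simp

theorem sum_mul (h : IsRealization 𝒜 θ e φ) (i : Q) : (∑ j, e j) * e i = e i := by
  rw [Finset.sum_mul, Finset.sum_eq_single i, h.orthogonal.idem i]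
  · intro j _ hj; exact h.orthogonal.ortho hj
  · simp

theorem sum_idem (h : IsRealization 𝒜 θ e φ) : (∑ j, e j) * ∑ j, e j = ∑ j, e j := by
  rw [Finset.sum_mul]
  exact Finset.sum_congr rfl fun i _ => h.mul_sum i

theorem sum_mem_zero (h : IsRealization 𝒜 θ e φ) : ∑ j, e j ∈ 𝒜 0 :=
  Submodule.sum_mem _ fun i _ => h.degree_zero i

theorem map_one (h : IsRealization 𝒜 θ e φ) : φ 1 = ∑ j, e j := by
  rw [← _root_.map_one (toBound θ), one_eq, map_sum, map_sum]
  exact Finset.sum_congr rfl fun i _ => h.map_vertex i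

theorem sum_mul_map (h : IsRealization 𝒜 θ e φ) (b : BoundAlgebra θ) :
    (∑ j, e j) * φ b = φ b := by
  rw [← h.map_one, ← map_mul, one_mul]

theorem map_mul_sum (h : IsRealization 𝒜 θ e φ) (b : BoundAlgebra θ) :
    φ b * (∑ j, e j) = φ b := by
  rw [← h.map_one, ← map_mul, mul_one]

theorem exists_eq (h : IsRealization 𝒜 θ e φ) (a : A) :
    ∃ b, φ b = (∑ i, e i) * a * (∑ i, e i) := by
  have : (∑ i, e i) * a * (∑ i, e i) ∈ Set.range φ := by rw [h.range_eq]; exact ⟨a, rfl⟩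
  exact this

theorem map_ofPath_mem [GradedAlgebra 𝒜] (h : IsRealization 𝒜 θ e φ) {i j : Q}
    (p : Quiver.Path i j) : φ (toBound θ (ofPath k p)) ∈ 𝒜 p.length := by
  induction p with
  | nil =>
    have := h.map_vertex i
    rw [vertex] at this
    rw [this]; exact h.degree_zero i
  | cons p a ih =>
    rw [← arrow_mul_ofPath, map_mul, map_mul, Quiver.Path.length_cons, add_comm]
    exact SetLike.GradedMul.mul_mem (h.map_arrow _ _ a) ih

/-- Path length corresponds to degree under `φ`. Together with injectivity of `φ` this replaces a
grading on `kQ/(θ)` itself. -/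
theorem gradedProj_map [GradedAlgebra 𝒜] (h : IsRealization 𝒜 θ e φ) (d : ℕ)
    (x : PathAlgebra k Q) :
    GradedAlgebra.proj 𝒜 d (φ (toBound θ x)) = φ (toBound θ (lengthPart k Q d x)) := by
  induction x using induction_ofPath with
  | h0 => simp
  | hadd x y hx hy => simp only [map_add, hx, hy]
  | hsmul s i j p =>
    simp only [map_smul, lengthPart_ofPath]
    congr 1
    split_ifs with hp
    · rw [← hp]; exact gradedProj_of_mem (h.map_ofPath_mem p)
    · rw [map_zero, map_zero]; exact gradedProj_of_mem_ne (h.map_ofPath_mem p) hp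

theorem exists_gradedProj_zero [GradedAlgebra 𝒜] (h : IsRealization 𝒜 θ e φ)
    (b : BoundAlgebra θ) : ∃ c : Q → k, GradedAlgebra.proj 𝒜 0 (φ b) = ∑ i, c i • e i := by
  obtain ⟨x, rfl⟩ := toBound_surjective b
  obtain ⟨c, hc⟩ := lengthPart_zero_mem x
  refine ⟨c, ?_⟩
  rw [h.gradedProj_map, hc, map_sum, map_sum]
  exact Finset.sum_congr rfl fun i _ => by rw [map_smul, map_smul, h.map_vertex]

theorem exists_mem_arrowSpan [GradedAlgebra 𝒜] (h : IsRealization 𝒜 θ e φ)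
    {b : BoundAlgebra θ} (hb : φ b ∈ 𝒜 1) : ∃ x ∈ arrowSpan k Q, b = toBound θ x := by
  obtain ⟨x, rfl⟩ := toBound_surjective b
  refine ⟨lengthPart k Q 1 x, lengthPart_one_mem x, h.injective ?_⟩
  rw [← h.gradedProj_map, gradedProj_of_mem hb]

theorem map_mem_of_mem_arrowSpan (h : IsRealization 𝒜 θ e φ) {x : PathAlgebra k Q}
    (hx : x ∈ arrowSpan k Q) : φ (toBound θ x) ∈ 𝒜 1 := by
  induction hx using Submodule.span_induction with
  | mem x hx =>
    obtain ⟨i, j, a, rfl⟩ := hx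
    exact h.map_arrow _ _ a
  | zero => simp
  | add x y _ _ hx hy => rw [map_add, map_add]; exact add_mem hx hy
  | smul c x _ hx => rw [map_smul, map_smul]; exact Submodule.smul_mem _ _ hx

/-- Only trivial paths have degree zero, so the degree-zero part of `E A E = φ(kQ/(θ))` is spanned
by the `e_l`. -/
theorem exists_corner [GradedAlgebra 𝒜] (h : IsRealization 𝒜 θ e φ) (a : A) :
    ∃ c : Q → k, ∀ i j, e i * GradedAlgebra.proj 𝒜 0 a * e j = e i * (∑ l, c l • e l) * e j := by
  obtain ⟨b, hb⟩ := h.exists_eq a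
  obtain ⟨c, hc⟩ := h.exists_gradedProj_zero b
  refine ⟨c, fun i j => ?_⟩
  rw [← hc, hb, gradedProj_zero_mul, gradedProj_zero_mul, gradedProj_of_mem h.sum_mem_zero,
    ← mul_assoc, ← mul_assoc, h.mul_sum, mul_assoc _ (∑ l, e l) (e j), h.sum_mul]

theorem corner_ne [GradedAlgebra 𝒜] (h : IsRealization 𝒜 θ e φ) (a : A) {i j : Q}
    (hij : i ≠ j) : e i * GradedAlgebra.proj 𝒜 0 a * e j = 0 := by
  obtain ⟨c, hc⟩ := h.exists_corner a
  rw [hc, Finset.mul_sum, Finset.sum_mul]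
  refine Finset.sum_eq_zero fun l _ => ?_
  by_cases hl : l = i
  · rw [hl, mul_smul_comm, smul_mul_assoc, mul_assoc, h.orthogonal.ortho hij, mul_zero, smul_zero]
  · rw [mul_smul_comm, h.orthogonal.ortho (Ne.symm hl), smul_zero, zero_mul]

theorem corner_self [GradedAlgebra 𝒜] (h : IsRealization 𝒜 θ e φ) (a : A) (i : Q) :
    ∃ c : k, e i * GradedAlgebra.proj 𝒜 0 a * e i = c • e i := by
  obtain ⟨c, hc⟩ := h.exists_corner a
  refine ⟨c i, ?_⟩
  rw [hc, Finset.mul_sum, Finset.sum_mul, Finset.sum_eq_single i]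
  · rw [mul_smul_comm, smul_mul_assoc, h.orthogonal.idem i, h.orthogonal.idem i]
  · intro l _ hl
    rw [mul_smul_comm, h.orthogonal.ortho (Ne.symm hl), smul_zero, zero_mul]
  · simp

/-- The degree-zero part of `e_i A e_i` is `k e_i`. If `e_i = x + y`, the component of `x` in degree
zero is therefore `0` or `e_i`; accordingly `x` or `y` has no component in degree zero and vanishes.
-/
theorem primitive [GradedAlgebra 𝒜] {n : ℕ} (hn : ∀ d, n < d → 𝒜 d = ⊥)
    (h : IsRealization 𝒜 θ e φ) (i : Q) : IsPrimitiveIdempotent (e i) := by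
  refine ⟨h.orthogonal.idem i, h.ne_zero i, fun x y hx hy hxy hyx hi => ?_⟩
  have hxi : e i * x * e i = x := by
    rw [hi, add_mul, hx.eq, hyx, add_zero, mul_add, hx.eq, hxy, add_zero]
  obtain ⟨c, hc⟩ := h.corner_self x i
  have hx0 : GradedAlgebra.proj 𝒜 0 x = c • e i := by
    rw [← hc]
    nth_rw 1 [← hxi]
    rw [gradedProj_zero_mul, gradedProj_zero_mul, gradedProj_of_mem (h.degree_zero i)]
  have hcc : c * c = c := by
    have h1 : GradedAlgebra.proj 𝒜 0 x * GradedAlgebra.proj 𝒜 0 x = GradedAlgebra.proj 𝒜 0 x := by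
      rw [← gradedProj_zero_mul, hx.eq]
    rw [hx0, smul_mul_smul_comm, h.orthogonal.idem i] at h1
    exact smul_left_injective k (h.ne_zero i) h1
  rcases IsIdempotentElem.iff_eq_zero_or_one.1 hcc with rfl | rfl
  · left
    exact eq_zero_of_isIdempotentElem_of_gradedProj 𝒜 hn hx (by rw [hx0, zero_smul])
  · right
    refine eq_zero_of_isIdempotentElem_of_gradedProj 𝒜 hn hy ?_
    have hy' : y = e i - x := by rw [hi]; abel
    rw [hy', map_sub, hx0, one_smul, gradedProj_of_mem (h.degree_zero i), sub_self]

/-- The difference `e_i - c⁻¹ z` has no component in degree zero, hence is nilpotent. So `v = 1 -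
(e_i - c⁻¹ z)` is a unit with `v e_i = c⁻¹ z`, and `w = c⁻¹ v⁻¹`. -/
theorem exists_left_inverse [GradedAlgebra 𝒜] {n : ℕ} (hn : ∀ d, n < d → 𝒜 d = ⊥)
    (h : IsRealization 𝒜 θ e φ) {i : Q} {z : A} {c : k} (hc : c ≠ 0) (hz : z * e i = z)
    (hz0 : GradedAlgebra.proj 𝒜 0 z = c • e i) : ∃ w, w * z = e i := by
  have hnil : IsNilpotent (e i - c⁻¹ • z) := by
    refine isNilpotent_of_gradedProj_zero 𝒜 hn ?_
    rw [map_sub, gradedProj_of_mem (h.degree_zero i), map_smul, hz0, smul_smul,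
      inv_mul_cancel₀ hc, one_smul, sub_self]
  obtain ⟨v, hv⟩ := hnil.isUnit_one_sub
  have h1 : (v : A) * e i = c⁻¹ • z := by
    rw [hv, sub_mul, sub_mul, one_mul, h.orthogonal.idem i, smul_mul_assoc, hz]; abel
  refine ⟨((v⁻¹ : Aˣ) : A) * (algebraMap k A c⁻¹), ?_⟩
  rw [mul_assoc, ← Algebra.smul_def, ← h1, ← mul_assoc, Units.inv_mul, one_mul]

/-- By fullness both units in `f = 1 f 1` expand into terms `a E b`, which reduces the claim to
corners `e_i (p f q)_0 e_j`; those with `i ≠ j` vanish anyway. -/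
theorem gradedProj_zero_eq_zero [GradedAlgebra 𝒜] (h : IsRealization 𝒜 θ e φ) {f : A}
    (hf : ∀ i p q, e i * GradedAlgebra.proj 𝒜 0 (p * f * q) * e i = 0) :
    GradedAlgebra.proj 𝒜 0 f = 0 := by
  have hE : ∀ p q, (∑ i, e i) * GradedAlgebra.proj 𝒜 0 (p * f * q) * (∑ i, e i) = 0 := by
    intro p q
    rw [Finset.sum_mul, Finset.sum_mul]
    refine Finset.sum_eq_zero fun i _ => ?_
    rw [Finset.mul_sum]
    refine Finset.sum_eq_zero fun j _ => ?_
    by_cases hij : i = j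
    · rw [← hij]; exact hf i p q
    · exact h.corner_ne _ hij
  have key : ∀ x ∈ Submodule.span k {x | ∃ a b, x = a * (∑ i, e i) * b},
      ∀ y ∈ Submodule.span k {x | ∃ a b, x = a * (∑ i, e i) * b},
      GradedAlgebra.proj 𝒜 0 (x * f * y) = 0 := by
    intro x hx y hy
    induction hx using Submodule.span_induction with
    | zero => simp
    | add x x' _ _ hx hx' => simp only [add_mul, map_add, hx, hx', add_zero]
    | smul c x _ hx => simp only [smul_mul_assoc, map_smul, hx, smul_zero]
    | mem x hx =>
      obtain ⟨a, b, rfl⟩ := hx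
      induction hy using Submodule.span_induction with
      | zero => simp
      | add x x' _ _ hx hx' => simp only [mul_add, map_add, hx, hx', add_zero]
      | smul c x _ hx => simp only [mul_smul_comm, map_smul, hx, smul_zero]
      | mem y hy =>
        obtain ⟨a', b', rfl⟩ := hy
        have : a * (∑ i, e i) * b * f * (a' * (∑ i, e i) * b') =
            a * ((∑ i, e i) * (b * f * a') * (∑ i, e i)) * b' := by simp only [mul_assoc]
        rw [this, gradedProj_zero_mul, gradedProj_zero_mul, gradedProj_zero_mul 𝒜 _ (∑ i, e i),
          gradedProj_zero_mul 𝒜 (∑ i, e i), gradedProj_of_mem h.sum_mem_zero, hE, mul_zero,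
          zero_mul]
  simpa using key 1 h.full 1 h.full

theorem isBasicFamily [GradedAlgebra 𝒜] {n : ℕ} (hn : ∀ d, n < d → 𝒜 d = ⊥)
    (h : IsRealization 𝒜 θ e φ) : IsBasicFamily e where
  orthogonal := h.orthogonal
  primitive := h.primitive hn
  not_iso i j hij := by
    refine ⟨fun ψ => h.ne_zero i ?_⟩
    obtain ⟨b, c, hbc, hb, hb', -⟩ := exists_mul_of_spanSingletonEquiv
      (h.orthogonal.idem i) (h.orthogonal.idem j) ψ
    -- Distinct vertices have no degree-zero maps between them, while `e_i = b c` needs one.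
    have hb0 : GradedAlgebra.proj 𝒜 0 b = 0 := by
      rw [← hb', ← hb, gradedProj_zero_mul, gradedProj_zero_mul,
        gradedProj_of_mem (h.degree_zero i), gradedProj_of_mem (h.degree_zero j)]
      exact h.corner_ne b hij
    rw [← gradedProj_of_mem (h.degree_zero i), hbc, gradedProj_zero_mul, hb0, zero_mul]
  exists_iso f hf := by
    -- Otherwise `f` has no component in degree zero, and such an idempotent is zero.
    have hex : ∃ i p q, e i * GradedAlgebra.proj 𝒜 0 (p * f * q) * e i ≠ 0 := by
      by_contra hcon
      push Not at hcon
      exact hf.2.1 (eq_zero_of_isIdempotentElem_of_gradedProj 𝒜 hn hf.1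
        (h.gradedProj_zero_eq_zero hcon))
    obtain ⟨i, p, q, hne⟩ := hex
    obtain ⟨c, hc⟩ := h.corner_self (p * f * q) i
    have hc0 : c ≠ 0 := by rintro rfl; rw [hc, zero_smul] at hne; exact hne rfl
    obtain ⟨w, hw⟩ := h.exists_left_inverse hn (z := e i * (p * f * q) * e i) hc0
      (by rw [mul_assoc, h.orthogonal.idem i])
      (by rw [gradedProj_zero_mul, gradedProj_zero_mul, gradedProj_of_mem (h.degree_zero i), hc])
    have hff := hf.1.eq
    -- Right multiplications by `R` and `P` are to be the inverse isomorphisms between `A f` and `A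
    -- e_i`. The factor `f = f f` of `e_i p f q e_i` is shared between `P` and `R`, and `w` is a
    -- left inverse of the whole product.
    obtain ⟨P, hP⟩ : ∃ P, P = e i * w * e i * p * f := ⟨_, rfl⟩
    obtain ⟨R, hR⟩ : ∃ R, R = f * q * e i := ⟨_, rfl⟩
    have hPR : P * R = e i := by
      have : P * R = e i * (w * (e i * (p * (f * f) * q) * e i)) := by
        rw [hP, hR]; simp only [mul_assoc]
      rw [this, hff, hw, h.orthogonal.idem i]
    have hPf : P * f = P := by rw [hP, mul_assoc, hff]
    have hfR : f * R = R := by rw [hR, ← mul_assoc, ← mul_assoc, hff]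
    have hRe : R * e i = R := by rw [hR, mul_assoc, h.orthogonal.idem i]
    have hg : IsIdempotentElem (R * P) := by
      change R * P * (R * P) = R * P
      rw [mul_assoc, ← mul_assoc P, hPR, ← mul_assoc, hRe]
    have hfg : f * (R * P) = R * P := by rw [← mul_assoc, hfR]
    have hgf : R * P * f = R * P := by rw [mul_assoc, hPf]
    -- `R P` is an idempotent of `f A f`. Primitivity of `f` leaves `R P = f` or `R P = 0`, and the
    -- latter is excluded by `e_i = P (R P) R`.
    have hRP : R * P = f := by
      rcases hf.2.2 (R * P) (f - R * P) hg
        (by change _ * _ = _; rw [sub_mul, mul_sub, mul_sub, hff, hfg, hgf, hg.eq]; abel)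
        (by rw [mul_sub, hgf, hg.eq, sub_self]) (by rw [sub_mul, hfg, hg.eq, sub_self])
        (by abel) with h0 | h0
      · exfalso
        apply h.ne_zero i
        have : e i = P * (R * P) * R := by
          rw [← mul_assoc, hPR, mul_assoc, hPR, h.orthogonal.idem i]
        rw [this, h0, mul_zero, zero_mul]
      · exact (sub_eq_zero.1 h0).symm
    exact ⟨i, ⟨spanSingletonEquiv hRP hPR hPf hRe⟩⟩

theorem toBound_ofPath_eq_zero [GradedAlgebra 𝒜] {n : ℕ} (hn : ∀ d, n < d → 𝒜 d = ⊥)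
    (h : IsRealization 𝒜 θ e φ) {i j : Q} (p : Quiver.Path i j) (hp : n < p.length) :
    toBound θ (ofPath k p) = 0 := by
  have := h.map_ofPath_mem p
  rw [hn _ hp] at this
  exact h.injective ((Submodule.mem_bot k).1 this |>.trans (map_zero φ).symm)

theorem isBoundQuiverOfBasic [GradedAlgebra 𝒜] {n : ℕ} (hn : ∀ d, n < d → 𝒜 d = ⊥)
    (h : IsRealization 𝒜 θ e φ) : IsBoundQuiverOfBasic 𝒜 θ where
  quadratic := h.quadratic
  nilpotent := ⟨n + 1, fun _ _ p hp => h.toBound_ofPath_eq_zero hn p hp⟩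
  exists_iso := ⟨e, h.isBasicFamily hn, h.degree_zero, φ, h.injective, h.range_eq, h.map_vertex,
    h.map_arrow⟩

end IsRealization

/-- Of the basic family only orthogonality, nonvanishing and fullness are kept; `isBasicFamily`
recovers the rest. -/
theorem IsBoundQuiverOfBasic.exists_isRealization {k : Type*} [Field k] {Q : Type u}
    [Quiver.{v} Q] [Fintype Q] {A : Type*} [Ring A] [Algebra k A] [FiniteDimensional k A]
    {𝒜 : ℕ → Submodule k A} {θ : Set (PathAlgebra k Q)} (h : IsBoundQuiverOfBasic 𝒜 θ) :
    ∃ e φ, IsRealization 𝒜 θ e φ := by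
  obtain ⟨e, he, he0, φ, hinj, hrange, hv, ha⟩ := h.exists_iso
  exact ⟨e, φ, h.quadratic, he.orthogonal, fun i => (he.primitive i).2.1, he0, he.one_mem_span,
    hinj, hrange, hv, ha⟩

/-- A nondegenerate linear form on the graded algebra `A = ⨁ 𝒜 d` that is concentrated in
degree `n`, with Nakayama automorphism `ρ`. -/
structure IsGradedFrobenius {k : Type*} [Field k] {A : Type*} [Ring A] [Algebra k A]
    (𝒜 : ℕ → Submodule k A) (n : ℕ) (F : A →ₗ[k] k) (ρ : A ≃ₐ[k] A) : Prop where
  nondegenerate : ∀ a, (∀ b, F (b * a) = 0) → a = 0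
  nakayama : ∀ a b, F (a * b) = F (b * ρ a)
  eq_zero : ∀ d, d ≠ n → ∀ a ∈ 𝒜 d, F a = 0
  map_mem : ∀ d, ∀ a ∈ 𝒜 d, ρ a ∈ 𝒜 d

theorem IsGradedFrobenius.nondegenerate_right {k : Type*} [Field k] {A : Type*} [Ring A]
    [Algebra k A] {𝒜 : ℕ → Submodule k A} {n : ℕ} {F : A →ₗ[k] k} {ρ : A ≃ₐ[k] A}
    (hF : IsGradedFrobenius 𝒜 n F ρ) {a : A} (ha : ∀ b, F (a * b) = 0) : a = 0 := by
  have : ρ a = 0 := hF.nondegenerate _ fun b => by rw [← hF.nakayama, ha]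
  exact (map_eq_zero_iff ρ ρ.injective).1 this

/-! ### Frobenius forms, maximal paths and the Nakayama translation -/

namespace IsRealization

variable {k : Type*} [Field k] {Q : Type u} [Quiver.{v} Q] [Fintype Q]
  {A : Type*} [Ring A] [Algebra k A] {𝒜 : ℕ → Submodule k A}
  {θ : Set (PathAlgebra k Q)} {e : Q → A} {φ : BoundAlgebra θ →ₙₐ[k] A}
  {n : ℕ} {F : A →ₗ[k] k} {ρ : A ≃ₐ[k] A} {ν : Equiv.Perm Q}

theorem vertex_mul_map_ofPath (h : IsRealization 𝒜 θ e φ) {i j : Q} (p : Quiver.Path i j) :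
    e j * φ (toBound θ (ofPath k p)) = φ (toBound θ (ofPath k p)) := by
  rw [← h.map_vertex, ← map_mul, ← map_mul, vertex_mul_ofPath]

theorem map_ofPath_mul_vertex (h : IsRealization 𝒜 θ e φ) {i j : Q} (p : Quiver.Path i j) :
    φ (toBound θ (ofPath k p)) * e i = φ (toBound θ (ofPath k p)) := by
  rw [← h.map_vertex, ← map_mul, ← map_mul, ofPath_mul_vertex]

theorem map_sum_eq {Q : Type u} [Fintype Q] {ν : Equiv.Perm Q} {e : Q → A}
    (hν : ∀ i, ρ (e i) = e (ν i)) : ρ (∑ i, e i) = ∑ i, e i := by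
  rw [map_sum, ← Equiv.sum_comp ν e]
  exact Finset.sum_congr rfl fun i _ => hν i

/-- `F(c) = F(e_j c) = F(c e_{ν j})`, and `c` ends in `e_i` on the right. -/
theorem form_eq_zero (h : IsRealization 𝒜 θ e φ) (hF : IsGradedFrobenius 𝒜 n F ρ)
    (hν : ∀ i, ρ (e i) = e (ν i)) {i j : Q} {c : A} (hj : e j * c = c) (hi : c * e i = c)
    (hij : ν j ≠ i) : F c = 0 := by
  rw [← hj, hF.nakayama, hν, ← hi, mul_assoc, h.orthogonal.ortho hij.symm, mul_zero, map_zero]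

/-- As `n` is the top degree, `F(x c)` depends only on the component `x_0`. The Nakayama property
replaces `x_0` by a corner `e_{ν⁻¹ i} x_0 e_j`, which is zero or a multiple of `e_j`; hence `F(x c)`
is a multiple of `F(c)`. -/
theorem eq_zero_of_form [GradedAlgebra 𝒜] (hn : ∀ d, n < d → 𝒜 d = ⊥)
    (h : IsRealization 𝒜 θ e φ) (hF : IsGradedFrobenius 𝒜 n F ρ) (hν : ∀ i, ρ (e i) = e (ν i))
    {i j : Q} {c : A} (hc : c ∈ 𝒜 n) (hj : e j * c = c) (hi : c * e i = c) (h0 : F c = 0) :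
    c = 0 := by
  refine hF.nondegenerate c fun x => ?_
  obtain ⟨s, hs⟩ := exists_sum_gradedProj 𝒜 x
  rw [hs, Finset.sum_mul, map_sum]
  refine Finset.sum_eq_zero fun d _ => ?_
  by_cases hd : d = 0
  · subst hd
    have hρ : ρ (e (ν.symm i)) = e i := by rw [hν, Equiv.apply_symm_apply]
    have h1 : F (GradedAlgebra.proj 𝒜 0 x * c) =
        F (e (ν.symm i) * GradedAlgebra.proj 𝒜 0 x * e j * c) := by
      conv_rhs => rw [mul_assoc, mul_assoc, hF.nakayama, hρ, hj, mul_assoc, hi]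
    rw [h1]
    by_cases hij : ν.symm i = j
    · obtain ⟨r, hr⟩ := h.corner_self x j
      rw [hij, hr, smul_mul_assoc, hj, map_smul, h0, smul_zero]
    · rw [h.corner_ne x hij, zero_mul, map_zero]
  · have hm : GradedAlgebra.proj 𝒜 d x * c ∈ 𝒜 (d + n) :=
      SetLike.GradedMul.mul_mem (gradedProj_mem 𝒜 d x) hc
    rw [hn _ (by omega)] at hm
    rw [(Submodule.mem_bot k).1 hm, map_zero]

/-- Arrows annihilate `c = φ(p)` from the left, hence so do all elements without component in degree
zero. Thus `F(x c) = F(x_0 c)`, where `x_0 c` has degree `p.length`; if this is not `n`,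
nondegeneracy gives `c = 0`. Only prolongations at the target of `p` are used. -/
theorem length_eq_of_isMaximalBoundPath [GradedAlgebra 𝒜] (h : IsRealization 𝒜 θ e φ)
    (hF : IsGradedFrobenius 𝒜 n F ρ) {i j : Q}
    {p : Quiver.Path i j} (hp : IsMaximalBoundPath θ p) : p.length = n := by
  by_contra hne
  refine hp.1 (h.injective ?_)
  rw [map_zero]
  set c := φ (toBound θ (ofPath k p)) with hcdef
  have harrow : ∀ b : BoundAlgebra θ, GradedAlgebra.proj 𝒜 0 (φ b) = 0 → φ b * c = 0 := by
    have hlen : ∀ x : PathAlgebra k Q, φ (toBound θ x) * c =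
        φ (toBound θ (lengthPart k Q 0 x)) * c := by
      intro x
      induction x using induction_ofPath with
      | h0 => simp
      | hadd x y hx hy => simp only [map_add, add_mul, hx, hy]
      | hsmul s i' j' q =>
        simp only [map_smul, smul_mul_assoc, lengthPart_ofPath]
        congr 1
        split_ifs with hq
        · rfl
        · rw [map_zero, map_zero, zero_mul]
          have key : ∀ {l : Q} (q : Quiver.Path i' l), q.length ≠ 0 →
              φ (toBound θ (ofPath k q)) * c = 0 := by
            intro l q
            induction q with
            | nil => intro hq; exact absurd rfl hq
            | @cons b d q a ih =>
              intro _
              rw [← arrow_mul_ofPath, map_mul, map_mul, mul_assoc]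
              by_cases hq0 : q.length = 0
              · cases q with
                | nil =>
                  rw [hcdef, ← map_mul, ← map_mul, ← map_mul, ← map_mul]
                  by_cases hj : j = i'
                  · subst hj
                    have := hp.2.1 _ a
                    rw [← arrow_mul_ofPath] at this
                    have hv : (ofPath k (Quiver.Path.nil : Quiver.Path j j)) * ofPath k p =
                      ofPath k p := vertex_mul_ofPath p
                    rw [hv, this, map_zero]
                  · rw [ofPath_mul_of_ne _ _ hj, mul_zero, map_zero, map_zero]
                | cons q b => simp at hq0
              · rw [ih hq0, mul_zero]
          exact key q hq
    intro b hb
    obtain ⟨x, rfl⟩ := toBound_surjective b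
    rw [hlen, ← h.gradedProj_map, hb, zero_mul]
  -- Fullness carries the annihilation from the corner to `A`: `a E b y c = a (E b y E) c`, and `E b
  -- y E` again has no component in degree zero.
  have hpos : ∀ y : A, GradedAlgebra.proj 𝒜 0 y = 0 → y * c = 0 := by
    intro y hy
    have key : ∀ x ∈ Submodule.span k {x | ∃ a b, x = a * (∑ i, e i) * b}, x * (y * c) = 0 := by
      intro x hx
      induction hx using Submodule.span_induction with
      | zero => simp
      | add x x' _ _ hx hx' => rw [add_mul, hx, hx', add_zero]
      | smul r x _ hx => rw [smul_mul_assoc, hx, smul_zero]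
      | mem x hx =>
        obtain ⟨a, b, rfl⟩ := hx
        obtain ⟨z, hz⟩ := h.exists_eq (b * y)
        have h1 : a * (∑ i, e i) * b * (y * c) =
            a * ((∑ i, e i) * (b * y) * (∑ i, e i) * c) := by
          rw [mul_assoc _ _ c, hcdef, h.sum_mul_map]; simp only [mul_assoc]
        rw [h1, ← hz, harrow, mul_zero]
        rw [hz, gradedProj_zero_mul, gradedProj_zero_mul, gradedProj_zero_mul, hy, mul_zero,
          mul_zero, zero_mul]
    simpa using key 1 h.full
  refine hF.nondegenerate c fun x => ?_
  have h1 : x * c = GradedAlgebra.proj 𝒜 0 x * c := by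
    rw [← sub_eq_zero, ← sub_mul]
    exact hpos _ (by rw [map_sub, gradedProj_of_mem (gradedProj_mem 𝒜 0 x), sub_self])
  rw [h1]
  have hm : GradedAlgebra.proj 𝒜 0 x * c ∈ 𝒜 (0 + p.length) :=
    SetLike.GradedMul.mul_mem (gradedProj_mem 𝒜 0 x) (h.map_ofPath_mem p)
  exact hF.eq_zero _ (by omega) _ hm

theorem isMaximalBoundPath_of_length [GradedAlgebra 𝒜] (hn : ∀ d, n < d → 𝒜 d = ⊥)
    (h : IsRealization 𝒜 θ e φ) {i j : Q} {p : Quiver.Path i j} (hp : p.length = n)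
    (h0 : toBound θ (ofPath k p) ≠ 0) : IsMaximalBoundPath θ p := by
  refine ⟨h0, fun l a => h.toBound_ofPath_eq_zero hn _ ?_,
    fun l a => h.toBound_ofPath_eq_zero hn _ ?_⟩
  · rw [Quiver.Path.length_cons]; omega
  · rw [Quiver.Path.length_comp, Quiver.Hom.toPath, Quiver.Path.length_cons]; omega

/-- A path `p : i → j` of top length is nonzero exactly if `F` does not vanish on it, and this
forces `i = ν j`. Nondegeneracy at `e_i` provides such paths, and the single value of `F` determines
them up to scalars. -/
theorem isStableTranslationQuiver [GradedAlgebra 𝒜] (hn : ∀ d, n < d → 𝒜 d = ⊥)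
    (h : IsRealization 𝒜 θ e φ) (hF : IsGradedFrobenius 𝒜 n F ρ)
    (hν : ∀ i, ρ (e i) = e (ν i)) : IsStableTranslationQuiver θ ν n where
  length_eq i j p hp := h.length_eq_of_isMaximalBoundPath hF hp
  exists_path i := by
    by_contra hcon
    push Not at hcon
    refine h.ne_zero i (hF.nondegenerate_right fun b => ?_)
    -- `F(e_i b) = F(e_i e_i b) = F(e_i b e_{ν i})`, so `b` may be replaced by its corner, a
    -- combination of paths; only those from `ν i` to `i` contribute.
    have h1 : F (e i * b) = F (e i * ((∑ j, e j) * b * (∑ j, e j)) * e (ν i)) := by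
      rw [mul_assoc, mul_assoc _ _ (e (ν i)), h.sum_mul, ← mul_assoc, ← mul_assoc,
        h.mul_sum, ← hν, ← hF.nakayama, ← mul_assoc, h.orthogonal.idem i]
    obtain ⟨z, hz⟩ := h.exists_eq b
    obtain ⟨x, rfl⟩ := toBound_surjective z
    rw [h1, ← hz]
    clear hz
    induction x using induction_ofPath with
    | h0 => simp
    | hadd x y hx hy => simp only [map_add, add_mul, mul_add, hx, hy, add_zero]
    | hsmul s i' j' q =>
      simp only [map_smul, smul_mul_assoc, mul_smul_comm]
      rw [smul_eq_zero]; right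
      by_cases hi : i' = ν i
      · subst hi
        rw [mul_assoc, h.map_ofPath_mul_vertex]
        by_cases hj : j' = i
        · subst hj
          rw [h.vertex_mul_map_ofPath]
          by_cases hq : q.length = n
          · have : toBound θ (ofPath k q) = 0 := by
              by_contra h0
              exact hcon q (h.isMaximalBoundPath_of_length hn hq h0)
            rw [this, map_zero, map_zero]
          · exact hF.eq_zero _ hq _ (h.map_ofPath_mem q)
        · rw [← h.vertex_mul_map_ofPath q, ← mul_assoc, h.orthogonal.ortho (Ne.symm hj), zero_mul,
            map_zero]
      · rw [← h.map_ofPath_mul_vertex q, mul_assoc, mul_assoc, h.orthogonal.ortho hi, mul_zero,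
          mul_zero, map_zero]
  no_path i j hij p hp := by
    refine h.injective ?_
    rw [map_zero]
    have hm := h.map_ofPath_mem p
    rw [hp] at hm
    exact h.eq_zero_of_form hn hF hν hm (h.vertex_mul_map_ofPath p) (h.map_ofPath_mul_vertex p)
      (h.form_eq_zero hF hν (h.vertex_mul_map_ofPath p) (h.map_ofPath_mul_vertex p)
        (fun h' => hij (ν.injective h')))
  dependent i j j' p q hp hq := by
    have key : ∀ {j : Q} {p : Quiver.Path i j}, IsMaximalBoundPath θ p →
        φ (toBound θ (ofPath k p)) ∈ 𝒜 n ∧ F (φ (toBound θ (ofPath k p))) ≠ 0 := by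
      intro j p hp
      have hm := h.map_ofPath_mem p
      rw [h.length_eq_of_isMaximalBoundPath hF hp] at hm
      refine ⟨hm, fun h0 => hp.1 (h.injective ?_)⟩
      rw [map_zero]
      exact h.eq_zero_of_form hn hF hν hm (h.vertex_mul_map_ofPath p)
        (h.map_ofPath_mul_vertex p) h0
    have htgt : ∀ {j : Q} {p : Quiver.Path i j}, IsMaximalBoundPath θ p → ν j = i := by
      intro j p hp
      by_contra hne
      exact (key hp).2 (h.form_eq_zero hF hν (h.vertex_mul_map_ofPath p)
        (h.map_ofPath_mul_vertex p) hne)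
    obtain rfl : j = j' := ν.injective ((htgt hp).trans (htgt hq).symm)
    rw [LinearIndependent.pair_iff]
    intro hli
    -- The coefficients make `F` vanish on the combination, which is then zero by `eq_zero_of_form`.
    have := hli (F (φ (toBound θ (ofPath k q)))) (-F (φ (toBound θ (ofPath k p)))) ?_
    · exact (key hq).2 this.1
    refine h.injective ?_
    rw [map_zero]
    refine h.eq_zero_of_form hn hF hν (i := i) (j := j) ?_ ?_ ?_ ?_
    · rw [map_add, map_smul, map_smul]
      exact add_mem (Submodule.smul_mem _ _ (key hp).1) (Submodule.smul_mem _ _ (key hq).1)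
    · rw [map_add, map_smul, map_smul, mul_add, mul_smul_comm, mul_smul_comm,
        h.vertex_mul_map_ofPath, h.vertex_mul_map_ofPath]
    · rw [map_add, map_smul, map_smul, add_mul, smul_mul_assoc, smul_mul_assoc,
        h.map_ofPath_mul_vertex, h.map_ofPath_mul_vertex]
    · rw [map_add, map_smul, map_smul, map_add, map_smul, map_smul, smul_eq_mul, smul_eq_mul]
      ring

/-- When `ρ` permutes the `e_i` it fixes `E`, so both `ρ` and the form `F` restrict to the corner.
-/
theorem exists_isNakayamaAutomorphism [GradedAlgebra 𝒜] (h : IsRealization 𝒜 θ e φ)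
    (hF : IsGradedFrobenius 𝒜 n F ρ) (hν : ∀ i, ρ (e i) = e (ν i)) :
    ∃ N : BoundAlgebra θ ≃ₐ[k] BoundAlgebra θ, IsNakayamaAutomorphism θ ν N := by
  have hE : ρ (∑ i, e i) = ∑ i, e i := map_sum_eq hν
  have hE' : ρ.symm (∑ i, e i) = ∑ i, e i := by rw [← hE, ρ.symm_apply_apply, hE]
  have h1 : ∀ b, ∃ b', φ b' = ρ (φ b) := fun b => by
    obtain ⟨b', hb'⟩ := h.exists_eq (ρ (φ b))
    refine ⟨b', hb'.trans ?_⟩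
    nth_rw 1 [← hE]
    nth_rw 2 [← hE]
    rw [← map_mul, ← map_mul, h.sum_mul_map, h.map_mul_sum]
  have h2 : ∀ b, ∃ b', φ b' = ρ.symm (φ b) := fun b => by
    obtain ⟨b', hb'⟩ := h.exists_eq (ρ.symm (φ b))
    refine ⟨b', hb'.trans ?_⟩
    nth_rw 1 [← hE']
    nth_rw 2 [← hE']
    rw [← map_mul, ← map_mul, h.sum_mul_map, h.map_mul_sum]
  choose N1 hN1 using h1
  choose N2 hN2 using h2
  let N : BoundAlgebra θ ≃ₐ[k] BoundAlgebra θ :=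
    { toFun := N1
      invFun := N2
      left_inv := fun b => h.injective (by rw [hN2, hN1, ρ.symm_apply_apply])
      right_inv := fun b => h.injective (by rw [hN1, hN2, ρ.apply_symm_apply])
      map_mul' := fun a b => h.injective (by rw [hN1, map_mul, map_mul, map_mul, hN1, hN1])
      map_add' := fun a b => h.injective (by rw [hN1, map_add, map_add, map_add, hN1, hN1])
      commutes' := fun c => h.injective (by
        rw [hN1, Algebra.algebraMap_eq_smul_one, map_smul, map_smul, h.map_one, hE]) }
  have hN : ∀ b, φ (N b) = ρ (φ b) := hN1
  refine ⟨N, ⟨F ∘ₗ (φ : BoundAlgebra θ →ₗ[k] A), ?_, ?_, ?_⟩, ?_, ?_⟩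
  · intro a ha
    refine h.injective ?_
    rw [map_zero]
    refine hF.nondegenerate_right fun x => ?_
    obtain ⟨b, hb⟩ := h.exists_eq x
    have h3 : F (φ (a * b)) = 0 := ha b
    rw [map_mul, hb, ← mul_assoc, ← mul_assoc, h.map_mul_sum] at h3
    rw [← hE] at h3
    rwa [← hF.nakayama, ← mul_assoc, h.sum_mul_map] at h3
  · intro b hb
    refine h.injective ?_
    rw [map_zero]
    refine hF.nondegenerate _ fun x => ?_
    obtain ⟨a, ha⟩ := h.exists_eq x
    have h3 : F (φ (a * b)) = 0 := hb a
    rw [map_mul, ha, mul_assoc, h.sum_mul_map, mul_assoc, hF.nakayama, hE, mul_assoc,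
      h.map_mul_sum] at h3
    exact h3
  · intro a b
    change F (φ (a * b)) = F (φ (b * N a))
    rw [map_mul φ, map_mul φ, hN, hF.nakayama]
  · intro i
    refine h.injective ?_
    rw [hN, h.map_vertex, h.map_vertex, hν]
  · intro i j a
    exact h.exists_mem_arrowSpan (by rw [hN]; exact hF.map_mem _ _ (h.map_arrow _ _ a))

/-- A Nakayama automorphism of `kQ/(θ)` is intertwined with the Nakayama automorphism of `A` by an
element of degree zero that generates `E A ρ(E)` freely, where `E = ∑ i, e i`. -/
theorem exists_intertwiner [GradedAlgebra 𝒜] [FiniteDimensional k A]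
    (hn : ∀ d, n < d → 𝒜 d = ⊥) (h : IsRealization 𝒜 θ e φ) (hF : IsGradedFrobenius 𝒜 n F ρ)
    {N : BoundAlgebra θ ≃ₐ[k] BoundAlgebra θ} (hN : IsNakayamaAutomorphism θ ν N) :
    ∃ u ∈ 𝒜 0, (∑ i, e i) * u = u ∧ u * ρ (∑ i, e i) = u ∧ (∀ i, e (ν i) * u = u * ρ (e i)) ∧
      (∀ (i j : Q) (a : i ⟶ j),
        φ (N (toBound θ (arrow k a))) * u = u * ρ (φ (toBound θ (arrow k a)))) ∧
      (∀ b, φ b * u = 0 → b = 0) ∧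
      ∀ z, ∃ b, (∑ i, e i) * z * ρ (∑ i, e i) = φ b * u := by
  obtain ⟨f, hf1, hf2, hf3⟩ := hN.frobenius
  set E := ∑ i, e i with hEdef
  -- `r` is the compression `x ↦ E x E`, read in `kQ/(θ)`; it extends the form `f` of the corner to
  -- the form `f ∘ r` on `A`.
  choose r0 hr0 using h.exists_eq
  let r : A →ₗ[k] BoundAlgebra θ :=
    { toFun := r0
      map_add' := fun x y => h.injective (by
        rw [map_add, hr0, hr0, hr0, mul_add, add_mul])
      map_smul' := fun c x => h.injective (by
        rw [RingHom.id_apply, map_smul, hr0, hr0, mul_smul_comm, smul_mul_assoc]) }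
  have hr : ∀ x, φ (r x) = E * x * E := hr0
  have hrφ : ∀ b, r (φ b) = b := fun b => h.injective (by
    rw [hr, h.sum_mul_map, h.map_mul_sum])
  have hEE : E * E = E := h.sum_idem
  let pairA : A →ₗ[k] Module.Dual k A :=
    LinearMap.flip ((LinearMap.compr₂ (LinearMap.mul k A) F))
  have hpairA : ∀ z x, pairA z x = F (x * z) := fun z x => rfl
  have hsurjA : Function.Surjective pairA := by
    refine (LinearMap.injective_iff_surjective_of_finrank_eq_finrank
      (Subspace.dual_finrank_eq).symm).1 ((injective_iff_map_eq_zero _).2 fun z hz => ?_)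
    exact hF.nondegenerate z fun b => by rw [← hpairA, hz]; rfl
  -- `u` represents `f ∘ r` with respect to `F`, that is, `F(x u) = f(r x)`. All its properties
  -- follow by testing against `F(x · )`.
  obtain ⟨u, hu⟩ := hsurjA (f ∘ₗ r)
  have hu' : ∀ x, F (x * u) = f (r x) := fun x => by rw [← hpairA, hu]; rfl
  have hext : ∀ y z : A, (∀ x, F (x * y) = F (x * z)) → y = z := fun y z hyz => by
    rw [← sub_eq_zero]
    exact hF.nondegenerate _ fun x => by rw [mul_sub, map_sub, hyz, sub_self]
  have hEu : E * u = u := hext _ _ fun x => by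
    rw [← mul_assoc, hu', hu']
    congr 1
    exact h.injective (by rw [hr, hr, mul_assoc, mul_assoc x, hEE, mul_assoc])
  have huE : u * ρ E = u := hext _ _ fun x => by
    rw [← mul_assoc, ← hF.nakayama, ← mul_assoc, hu', hu']
    congr 1
    exact h.injective (by rw [hr, hr, ← mul_assoc, hEE])
  -- `F(x φ(N b) u) = f(r(x) N b) = f(b r(x)) = F(φ(b) x u) = F(x u ρ(φ b))`.
  have hcomm : ∀ b, φ (N b) * u = u * ρ (φ b) := fun b => hext _ _ fun x => by
    rw [← mul_assoc, ← mul_assoc, ← hF.nakayama, ← mul_assoc, hu', hu']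
    have e1 : r (x * φ (N b)) = r x * N b := h.injective (by
      rw [map_mul φ, hr, hr, mul_assoc, mul_assoc x, h.map_mul_sum, mul_assoc _ E, h.sum_mul_map,
        mul_assoc])
    have e2 : r (φ b * x) = b * r x := h.injective (by
      rw [map_mul φ, hr, hr, ← mul_assoc, h.sum_mul_map, ← mul_assoc, ← mul_assoc, h.map_mul_sum])
    rw [e1, e2, ← hf3]
  have hinj : ∀ b, φ b * u = 0 → b = 0 := fun b hb => hf2 b fun a => by
    have := hu' (φ a * φ b)
    rw [mul_assoc, hb, mul_zero, map_zero, ← map_mul, hrφ] at this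
    exact this.symm
  have : FiniteDimensional k (BoundAlgebra θ) :=
    FiniteDimensional.of_injective (φ : BoundAlgebra θ →ₗ[k] A) h.injective
  let pairB : BoundAlgebra θ →ₗ[k] Module.Dual k (BoundAlgebra θ) :=
    LinearMap.flip ((LinearMap.compr₂ (LinearMap.mul k (BoundAlgebra θ)) f))
  have hpairB : ∀ z x, pairB z x = f (x * z) := fun z x => rfl
  have hsurjB : Function.Surjective pairB := by
    refine (LinearMap.injective_iff_surjective_of_finrank_eq_finrank
      (Subspace.dual_finrank_eq).symm).1 ((injective_iff_map_eq_zero _).2 fun z hz => ?_)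
    exact hf2 z fun b => by rw [← hpairB, hz]; rfl
  -- The functional `F(φ( · ) E z ρ(E))` on the corner is represented by some `b` with respect to
  -- `f`.
  have hsurj : ∀ z, ∃ b, E * z * ρ E = φ b * u := by
    intro z
    obtain ⟨b, hb⟩ := hsurjB ((pairA (E * z * ρ E)) ∘ₗ (φ : BoundAlgebra θ →ₗ[k] A))
    have hb' : ∀ c, f (c * b) = F (φ c * (E * z * ρ E)) := fun c => by rw [← hpairB, hb]; rfl
    refine ⟨b, hext _ _ fun x => ?_⟩
    have e1 : r (x * φ b) = r x * b := h.injective (by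
      rw [map_mul φ, hr, hr, mul_assoc, mul_assoc x, h.map_mul_sum, mul_assoc _ E, h.sum_mul_map,
        mul_assoc])
    rw [← mul_assoc x (φ b), hu', e1, hb', hr]
    conv_rhs => rw [mul_assoc, mul_assoc, hF.nakayama]
    have e2 : E * (E * z * ρ E) = E * z * ρ E := by rw [← mul_assoc, ← mul_assoc, hEE]
    have e3 : E * z * ρ E * ρ E = E * z * ρ E := by rw [mul_assoc, ← map_mul, hEE]
    rw [e2, mul_assoc x _ (ρ E), e3]
  have hρE : ρ E ∈ 𝒜 0 := hF.map_mem _ _ h.sum_mem_zero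
  -- The form `f` is not assumed homogeneous, so `u` need not be. Its component `u0` satisfies the
  -- same commutation rules, because `N` and `ρ` preserve degrees on vertices and arrows; that `u0`
  -- still generates freely follows below from `u0 = φ(1 - s) u` with `s` nilpotent.
  set u0 := GradedAlgebra.proj 𝒜 0 u with hu0
  have hEu0 : E * u0 = u0 := by
    rw [hu0]
    nth_rw 2 [← hEu]
    rw [gradedProj_zero_mul, gradedProj_of_mem h.sum_mem_zero]
  have hu0E : u0 * ρ E = u0 := by
    rw [hu0]
    nth_rw 2 [← huE]
    rw [gradedProj_zero_mul, gradedProj_of_mem hρE]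
  have hproj : ∀ b, GradedAlgebra.proj 𝒜 0 (φ b * u) = GradedAlgebra.proj 𝒜 0 (φ b) * u0 :=
    fun b => gradedProj_zero_mul 𝒜 _ _
  -- If `e_i u0 = 0`, comparing degree-zero parts in `E A ρ(E) = φ(kQ/(θ)) u` gives `e_i A_0 ρ(E) =
  -- 0`; as `ρ(E)` is full too, `e_i = 0` follows.
  have hne : ∀ i, e i * u0 ≠ 0 := by
    intro i hi
    have hz : ∀ z, e i * GradedAlgebra.proj 𝒜 0 z * ρ E = 0 := by
      intro z
      obtain ⟨b, hb⟩ := hsurj (e i * GradedAlgebra.proj 𝒜 0 z)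
      obtain ⟨c, hc⟩ := h.exists_gradedProj_zero b
      have h1 := congrArg (GradedAlgebra.proj 𝒜 0) hb
      rw [hproj, hc, gradedProj_zero_mul, gradedProj_zero_mul, gradedProj_zero_mul,
        gradedProj_of_mem h.sum_mem_zero, gradedProj_of_mem hρE,
        gradedProj_of_mem (h.degree_zero i), gradedProj_of_mem (gradedProj_mem 𝒜 0 z),
        ← mul_assoc, h.sum_mul] at h1
      have h2 : e i * (e i * GradedAlgebra.proj 𝒜 0 z * ρ E) =
          e i * GradedAlgebra.proj 𝒜 0 z * ρ E := by
        rw [← mul_assoc, ← mul_assoc, h.orthogonal.idem i]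
      rw [← h2, h1, ← mul_assoc, Finset.mul_sum, Finset.sum_mul]
      refine Finset.sum_eq_zero fun l _ => ?_
      rw [mul_smul_comm, smul_mul_assoc]
      by_cases hl : l = i
      · rw [hl, h.orthogonal.idem i, hi, smul_zero]
      · rw [h.orthogonal.ortho (Ne.symm hl), zero_mul, smul_zero]
    have key : ∀ x ∈ Submodule.span k {x | ∃ a b, x = a * E * b},
        e i * GradedAlgebra.proj 𝒜 0 (ρ x) = 0 := by
      intro x hx
      induction hx using Submodule.span_induction with
      | zero => simp
      | add x x' _ _ hx hx' => rw [map_add, map_add, mul_add, hx, hx', add_zero]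
      | smul s x _ hx => rw [map_smul, map_smul, mul_smul_comm, hx, smul_zero]
      | mem x hx =>
        obtain ⟨a, b, rfl⟩ := hx
        rw [map_mul ρ, map_mul ρ, gradedProj_zero_mul, gradedProj_zero_mul, gradedProj_of_mem hρE,
          ← mul_assoc, ← mul_assoc, hz, zero_mul]
    have := key 1 h.full
    rw [_root_.map_one, gradedProj_zero_one, mul_one] at this
    exact h.ne_zero i this
  obtain ⟨s, hs⟩ := hsurj (u - u0)
  have hs' : u - u0 = φ s * u := by
    rw [← hs, mul_sub, hEu, hEu0, sub_mul, huE, hu0E]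
  -- The degree-zero part of `u - u0 = φ(s) u` reads `0 = ∑ c_i e_i u0`, and each `e_i u0` is
  -- nonzero.
  have hs0 : GradedAlgebra.proj 𝒜 0 (φ s) = 0 := by
    obtain ⟨c, hc⟩ := h.exists_gradedProj_zero s
    have h1 := congrArg (GradedAlgebra.proj 𝒜 0) hs'
    rw [map_sub, ← hu0, hu0, gradedProj_of_mem (gradedProj_mem 𝒜 0 u), sub_self, hproj, hc] at h1
    rw [hc]
    refine Finset.sum_eq_zero fun i _ => ?_
    have h2 := congrArg (fun x => e i * x) h1
    simp only [mul_zero] at h2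
    rw [← mul_assoc, Finset.mul_sum, Finset.sum_eq_single i, mul_smul_comm, h.orthogonal.idem i,
      smul_mul_assoc] at h2
    · rcases smul_eq_zero.1 h2.symm with h3 | h3
      · rw [h3, zero_smul]
      · exact absurd h3 (hne i)
    · intro l _ hl
      rw [mul_smul_comm, h.orthogonal.ortho (Ne.symm hl), smul_zero]
    · simp
  have hnil : IsNilpotent s := by
    obtain ⟨j, hj⟩ := isNilpotent_of_gradedProj_zero 𝒜 hn hs0
    refine ⟨j + 1, h.injective ?_⟩
    have hpow : ∀ j : ℕ, φ (s ^ (j + 1)) = φ s ^ (j + 1) := by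
      intro j
      induction j with
      | zero => rw [zero_add, pow_one, pow_one]
      | succ j ih => rw [pow_succ, map_mul, ih, ← pow_succ]
    rw [hpow, pow_succ, hj, zero_mul, map_zero]
  obtain ⟨w, hw⟩ := hnil.isUnit_one_sub
  have hu0w : φ (w : BoundAlgebra θ) * u = u0 := by
    rw [hw, map_sub, h.map_one, sub_mul, ← hs', hEu, sub_sub_cancel]
  refine ⟨u0, gradedProj_mem 𝒜 0 u, hEu0, hu0E, ?_, ?_, ?_, ?_⟩
  · intro i
    have h1 := congrArg (GradedAlgebra.proj 𝒜 0) (hcomm (toBound θ (vertex k i)))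
    rw [hN.map_vertex, h.map_vertex, h.map_vertex, gradedProj_zero_mul, gradedProj_zero_mul,
      gradedProj_of_mem (h.degree_zero _),
      gradedProj_of_mem (hF.map_mem _ _ (h.degree_zero i))] at h1
    exact h1
  · intro i j a
    obtain ⟨x, hx, hxa⟩ := hN.map_arrow i j a
    have h1 := congrArg (GradedAlgebra.proj 𝒜 (1 + 0)) (hcomm (toBound θ (arrow k a)))
    rw [gradedProj_left 𝒜 (by rw [hxa]; exact h.map_mem_of_mem_arrowSpan hx), add_comm,
      gradedProj_right 𝒜 (hF.map_mem _ _ (h.map_arrow _ _ a))] at h1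
    exact h1
  · intro b hb
    rw [← hu0w, ← mul_assoc, ← map_mul] at hb
    have := hinj _ hb
    rwa [Units.mul_left_eq_zero] at this
  · intro z
    obtain ⟨b, hb⟩ := hsurj z
    refine ⟨b * (w⁻¹ : (BoundAlgebra θ)ˣ), ?_⟩
    rw [hb, ← hu0w, ← mul_assoc, ← map_mul, mul_assoc, Units.inv_mul, mul_one]

end IsRealization

/-! ### The copies of `Q` and the connecting arrows -/

section CopyMap

variable {k : Type w} [Field k] {Q : Type u} [Quiver.{v} Q] {ν : Equiv.Perm Q} {m : ℕ}

theorem copyMap_ofPath (t : ZMod m) {i j : Q} (p : Quiver.Path i j) :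
    copyMap k ν m t (ofPath k p) = ofPath k ((copyPrefunctor ν m t).mapPath p) := by
  unfold copyMap
  nth_rw 1 [ofPath]
  erw [Finsupp.linearCombination_single, one_smul]

theorem copyMap_vertex (t : ZMod m) (i : Q) :
    copyMap k ν m t (vertex k i) = vertex k (⟨i, t⟩ : CyclicVertex ν m) := copyMap_ofPath t _

theorem copyMap_arrow (t : ZMod m) {i j : Q} (a : i ⟶ j) :
    copyMap k ν m t (arrow k a) = arrow (Q := CyclicVertex ν m) k (CyclicArrow.copy a t) :=
  copyMap_ofPath t _

theorem copyMap_mul (t : ZMod m) (x y : PathAlgebra k Q) :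
    copyMap k ν m t (x * y) = copyMap k ν m t x * copyMap k ν m t y := by
  induction x using induction_ofPath with
  | h0 => simp
  | hadd x y hx hy => simp only [add_mul, map_add, hx, hy]
  | hsmul s i j p =>
    induction y using induction_ofPath with
    | h0 => simp
    | hadd x y hx hy => simp only [mul_add, map_add, hx, hy]
    | hsmul s' i' j' q =>
      simp only [PathAlgebra.smul_mul', PathAlgebra.mul_smul', map_smul]
      congr 2
      by_cases h : j' = i
      · subst h
        rw [ofPath_mul_ofPath, copyMap_ofPath, copyMap_ofPath, copyMap_ofPath, ofPath_mul_ofPath,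
          Prefunctor.mapPath_comp]
      · rw [ofPath_mul_of_ne _ _ h, map_zero, copyMap_ofPath, copyMap_ofPath, ofPath_mul_of_ne]
        exact fun h' => h (congrArg CyclicVertex.vert h')

theorem copyMap_mul_copyMap_of_ne {t t' : ZMod m} (h : t ≠ t') (x y : PathAlgebra k Q) :
    copyMap k ν m t x * copyMap k ν m t' y = 0 := by
  induction x using induction_ofPath with
  | h0 => simp
  | hadd x y hx hy => simp only [add_mul, map_add, hx, hy, add_zero]
  | hsmul s i j p =>
    induction y using induction_ofPath with
    | h0 => simp
    | hadd x y hx hy => simp only [mul_add, map_add, hx, hy, add_zero]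
    | hsmul s' i' j' q =>
      simp only [PathAlgebra.smul_mul', PathAlgebra.mul_smul', map_smul]
      rw [copyMap_ofPath, copyMap_ofPath, ofPath_mul_of_ne, smul_zero, smul_zero]
      exact fun h' => h (congrArg CyclicVertex.index h').symm

variable (k ν m) in
/-- The sum of the connecting arrows that start at the copy with index `t`. -/
def connSum [Fintype Q] (t : ZMod m) : PathAlgebra k (CyclicVertex ν m) :=
  ∑ i, connArrow k ν m i t

theorem connArrow_mul_vertex_of_ne {i j : Q} (t : ZMod m) (h : i ≠ j) :
    connArrow k ν m i t * vertex k (⟨j, t⟩ : CyclicVertex ν m) = 0 :=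
  ofPath_mul_of_ne _ _ fun h' => h (congrArg CyclicVertex.vert h').symm

theorem connArrow_mul_vertex (i : Q) (t : ZMod m) :
    connArrow k ν m i t * vertex k (⟨i, t⟩ : CyclicVertex ν m) = connArrow k ν m i t :=
  ofPath_mul_vertex _

/-- The vertex `i` selects `β_i` out of the sum of all connecting arrows of its copy, so normal
forms can be stated with `connSum` alone. -/
theorem connArrow_mul_copyMap [Fintype Q] (i : Q) (t : ZMod m) (x : PathAlgebra k Q) :
    connArrow k ν m i t * copyMap k ν m t x =
      connSum k ν m t * copyMap k ν m t (vertex k i * x) := by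
  rw [copyMap_mul, ← PathAlgebra.assoc, copyMap_vertex, connSum, Finset.sum_mul,
    Finset.sum_eq_single i, connArrow_mul_vertex]
  · intro j _ hj; exact connArrow_mul_vertex_of_ne t hj
  · simp

/-- The arrows need not be composable, as the product is zero otherwise, and the target may be
rewritten along `hz`. Both freedoms serve the endpoints `ν (ν⁻¹ i)` and `t - 1 + 1`, which equal `i`
and `t` only propositionally. -/
theorem arrow_mul_arrow_mem {P : Type*} [Quiver P] {x y y' z z' : P} (b : y' ⟶ z) (a : x ⟶ y)
    (hz : z = z') : arrow k b * arrow k a ∈ Submodule.span k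
      {r : PathAlgebra k P | ∃ p : Quiver.Path x z', p.length = 2 ∧ r = ofPath k p} := by
  subst hz
  by_cases h : y = y'
  · subst h
    exact Submodule.subset_span ⟨a.toPath.cons b, rfl, arrow_mul_ofPath b a.toPath⟩
  · rw [arrow, arrow, ofPath_mul_of_ne _ _ h]; exact zero_mem _

theorem vertex_mul_arrowSpan_mul_vertex_mem {x : PathAlgebra k Q} (hx : x ∈ arrowSpan k Q)
    (i j : Q) : vertex k j * x * vertex k i ∈
      Submodule.span k {y : PathAlgebra k Q | ∃ a : i ⟶ j, y = arrow k a} := by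
  induction hx using Submodule.span_induction with
  | mem x hx =>
    obtain ⟨i', j', a, rfl⟩ := hx
    by_cases hj : j' = j
    · subst hj
      by_cases hi : i = i'
      · subst hi
        rw [arrow, vertex_mul_ofPath, ofPath_mul_vertex]
        exact Submodule.subset_span ⟨a, rfl⟩
      · rw [arrow, vertex_mul_ofPath, ofPath_mul_vertex_of_ne _ hi]
        exact zero_mem _
    · rw [arrow, vertex_mul_ofPath_of_ne _ hj, zero_mul]
      exact zero_mem _
  | zero => simp
  | add x y _ _ hx hy => rw [mul_add, add_mul]; exact add_mem hx hy
  | smul c x _ hx =>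
    rw [PathAlgebra.mul_smul', PathAlgebra.smul_mul']; exact Submodule.smul_mem _ _ hx

end CopyMap

/-! ### The relations of the cyclic quiver are quadratic -/

section Nakayama

variable {k : Type w} [Field k] {Q : Type u} [Quiver.{v} Q] [Fintype Q]
  {θ : Set (PathAlgebra k Q)} {ν : Equiv.Perm Q} {N : BoundAlgebra θ ≃ₐ[k] BoundAlgebra θ}

theorem IsNakayamaAutomorphism.symm_vertex (hN : IsNakayamaAutomorphism θ ν N) (i : Q) :
    N.symm (toBound θ (vertex k i)) = toBound θ (vertex k (ν.symm i)) := by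
  rw [AlgEquiv.symm_apply_eq, hN.map_vertex, Equiv.apply_symm_apply]

theorem IsNakayamaAutomorphism.map_arrowSpan_le (hN : IsNakayamaAutomorphism θ ν N) :
    ((arrowSpan k Q).map (toBound θ).toLinearMap).map N.toLinearMap ≤
      (arrowSpan k Q).map (toBound θ).toLinearMap := by
  rw [arrowSpan, Submodule.map_span, Submodule.map_span, Submodule.span_le]
  rintro _ ⟨_, ⟨_, ⟨i, j, a, rfl⟩, rfl⟩, rfl⟩
  obtain ⟨x, hx, hxa⟩ := hN.map_arrow i j a
  rw [← Submodule.map_span]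
  exact ⟨x, hx, hxa.symm⟩

/-- `N` maps the image of the arrow span injectively into itself, hence onto itself by finite
dimension. So `ν⁻¹ σ̃ α` is a combination of arrows and each arrow does have a commutation relation.
-/
theorem IsNakayamaAutomorphism.exists_symm_arrow [FiniteDimensional k (BoundAlgebra θ)]
    (hN : IsNakayamaAutomorphism θ ν N) {i j : Q} (a : i ⟶ j) (c : k) :
    ∃ x ∈ arrowSpan k Q, toBound θ x = N.symm (toBound θ (c • arrow k a)) := by
  have heq : ((arrowSpan k Q).map (toBound θ).toLinearMap).map N.toLinearMap =
      (arrowSpan k Q).map (toBound θ).toLinearMap :=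
    Submodule.eq_of_le_of_finrank_eq hN.map_arrowSpan_le
      (LinearEquiv.finrank_map_eq N.toLinearEquiv _)
  have hmem : toBound θ (c • arrow k a) ∈ (arrowSpan k Q).map (toBound θ).toLinearMap :=
    ⟨c • arrow k a, Submodule.smul_mem _ _ (Submodule.subset_span ⟨i, j, a, rfl⟩), rfl⟩
  rw [← heq] at hmem
  obtain ⟨_, ⟨x, hx, rfl⟩, hxa⟩ := hmem
  refine ⟨x, hx, ?_⟩
  rw [← hxa]
  exact (N.symm_apply_apply _).symm

/-- `N⁻¹` moves the end vertices of `α` by `ν⁻¹`; since combinations of arrows are determined by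
their classes, `x` itself involves only arrows from `ν⁻¹ i` to `ν⁻¹ j`. -/
theorem IsNakayamaAutomorphism.vertex_mul_mul_vertex (hN : IsNakayamaAutomorphism θ ν N)
    (hθ : ∀ r ∈ θ, IsQuadraticRelation r) {i j : Q} (a : i ⟶ j) (c : k) {x : PathAlgebra k Q}
    (hx : x ∈ arrowSpan k Q) (hxa : toBound θ x = N.symm (toBound θ (c • arrow k a))) :
    vertex k (ν.symm j) * x * vertex k (ν.symm i) = x := by
  have hmem : vertex k (ν.symm j) * x * vertex k (ν.symm i) ∈ arrowSpan k Q := by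
    refine Submodule.span_mono ?_
      (vertex_mul_arrowSpan_mul_vertex_mem hx (ν.symm i) (ν.symm j))
    rintro _ ⟨a, rfl⟩
    exact ⟨_, _, a, rfl⟩
  refine arrowSpan_injOn hθ hmem hx ?_
  rw [map_mul, map_mul, hxa, ← hN.symm_vertex, ← hN.symm_vertex, ← map_mul, ← map_mul, ← map_mul,
    ← map_mul, PathAlgebra.mul_smul', PathAlgebra.smul_mul', arrow, vertex_mul_ofPath,
    ofPath_mul_vertex]

variable {m : ℕ} [NeZero m]

theorem isQuadraticRelation_of_cyclicRelation (hN : IsNakayamaAutomorphism θ ν N)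
    (hθ : ∀ r ∈ θ, IsQuadraticRelation r) {s : ℕ} {r : PathAlgebra k (CyclicVertex ν m)}
    (hr : CyclicRelation θ ν N s m r) : IsQuadraticRelation r := by
  cases hr with
  | copy r hr t =>
    obtain ⟨i, j, h⟩ := hθ r hr
    refine ⟨⟨i, t⟩, ⟨j, t⟩, ?_⟩
    clear hr
    induction h using Submodule.span_induction with
    | mem x hx =>
      obtain ⟨p, hp, rfl⟩ := hx
      rw [copyMap_ofPath]
      refine Submodule.subset_span ⟨_, ?_, rfl⟩
      rw [← hp]
      clear hp
      induction p with
      | nil => rfl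
      | cons p a ih => rw [Prefunctor.mapPath_cons]; exact congrArg (· + 1) ih
    | zero => rw [map_zero]; exact zero_mem _
    | add x y _ _ hx hy => rw [map_add]; exact add_mem hx hy
    | smul c x _ hx => rw [map_smul]; exact Submodule.smul_mem _ _ hx
  | square i t => exact ⟨_, _, arrow_mul_arrow_mem _ _ rfl⟩
  | commute a t x hx hxa =>
    rename_i i j
    refine ⟨⟨ν.symm i, t - 1⟩, ⟨j, t⟩, sub_mem ?_ ?_⟩
    · rw [copyMap_arrow]
      exact arrow_mul_arrow_mem _ _ rfl
    · have hmem := vertex_mul_arrowSpan_mul_vertex_mem hx (ν.symm i) (ν.symm j)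
      rw [hN.vertex_mul_mul_vertex hθ a _ hx hxa] at hmem
      clear hxa hx
      induction hmem using Submodule.span_induction with
      | mem x hx =>
        obtain ⟨b, rfl⟩ := hx
        rw [copyMap_arrow]
        exact arrow_mul_arrow_mem _ _ (by simp)
      | zero => rw [map_zero, mul_zero]; exact zero_mem _
      | add x y _ _ hx hy => rw [map_add, mul_add]; exact add_mem hx hy
      | smul c x _ hx =>
        rw [map_smul, PathAlgebra.mul_smul']; exact Submodule.smul_mem _ _ hx

end Nakayama

/-! ### Normal forms modulo the relations of the cyclic quiver -/

section NormalForm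

variable {k : Type w} [Field k] {Q : Type u} [Quiver.{v} Q] [Fintype Q]
  {θ : Set (PathAlgebra k Q)} {ν : Equiv.Perm Q} {N : BoundAlgebra θ ≃ₐ[k] BoundAlgebra θ}
  {s m : ℕ} [NeZero m]

/-- The elements whose copy vanishes form a two-sided ideal that contains `θ`. -/
theorem toBound_copyMap_eq_zero {x : PathAlgebra k Q} (hx : toBound θ x = 0) (t : ZMod m) :
    toBound (cyclicRelations θ ν N s m) (copyMap k ν m t x) = 0 := by
  refine mem_of_toBound_eq_zero (θ := θ)
    (LinearMap.ker ((toBound (cyclicRelations θ ν N s m)).toLinearMap ∘ₗ copyMap k ν m t))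
    (fun r hr => toBound_eq_zero_of_mem (CyclicRelation.copy r hr t)) ?_ ?_ hx
  · intro a y hy
    have hy' : toBound (cyclicRelations θ ν N s m) (copyMap k ν m t y) = 0 := hy
    change toBound (cyclicRelations θ ν N s m) (copyMap k ν m t (a * y)) = 0
    rw [copyMap_mul, map_mul, hy', mul_zero]
  · intro a y hy
    have hy' : toBound (cyclicRelations θ ν N s m) (copyMap k ν m t y) = 0 := hy
    change toBound (cyclicRelations θ ν N s m) (copyMap k ν m t (y * a)) = 0
    rw [copyMap_mul, map_mul, hy', zero_mul]

variable (θ ν N s m) in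
/-- The span of the classes of the products of at most one connecting arrow with paths inside one
copy of `Q`. -/
def normalForms : Submodule k (BoundAlgebra (cyclicRelations θ ν N s m)) :=
  Submodule.span k {b | ∃ t x, b = toBound (cyclicRelations θ ν N s m) (copyMap k ν m t x) ∨
    b = toBound (cyclicRelations θ ν N s m) (connSum k ν m t * copyMap k ν m t x)}

theorem copyMap_mem_normalForms (t : ZMod m) (x : PathAlgebra k Q) :
    toBound (cyclicRelations θ ν N s m) (copyMap k ν m t x) ∈ normalForms θ ν N s m :=
  Submodule.subset_span ⟨t, x, Or.inl rfl⟩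

theorem connSum_mul_mem_normalForms (t : ZMod m) (x : PathAlgebra k Q) :
    toBound (cyclicRelations θ ν N s m) (connSum k ν m t * copyMap k ν m t x) ∈
      normalForms θ ν N s m :=
  Submodule.subset_span ⟨t, x, Or.inr rfl⟩

theorem connArrow_mul_copyMap_mem (i : Q) (t t' : ZMod m) (x : PathAlgebra k Q) :
    toBound (cyclicRelations θ ν N s m) (connArrow k ν m i t * copyMap k ν m t' x) ∈
      normalForms θ ν N s m := by
  by_cases h : t = t'
  · subst h
    rw [connArrow_mul_copyMap]
    exact connSum_mul_mem_normalForms t _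
  · rw [← connArrow_mul_vertex, ← copyMap_vertex, PathAlgebra.assoc,
      copyMap_mul_copyMap_of_ne h, mul_zero, map_zero]
    exact zero_mem _

theorem connArrow_mul_connSum (i : Q) (t t' : ZMod m) :
    toBound (cyclicRelations θ ν N s m) (connArrow k ν m i t * connSum k ν m t') = 0 := by
  rw [connSum, Finset.mul_sum, map_sum]
  refine Finset.sum_eq_zero fun l _ => ?_
  by_cases h : (⟨ν l, t' + 1⟩ : CyclicVertex ν m) = ⟨i, t⟩
  · obtain rfl : ν l = i := congrArg CyclicVertex.vert h
    obtain rfl : t' + 1 = t := congrArg CyclicVertex.index h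
    exact toBound_eq_zero_of_mem (CyclicRelation.square l t')
  · have h0 : connArrow k ν m i t * connArrow k ν m l t' = 0 := ofPath_mul_of_ne _ _ h
    rw [h0, map_zero]

/-- The rewriting step: the commutation relation moves the connecting arrow to the left of `α` and
leaves `ν⁻¹ σ̃ α` inside the preceding copy. -/
theorem copyMap_mul_connSum_mem [FiniteDimensional k (BoundAlgebra θ)]
    (hN : IsNakayamaAutomorphism θ ν N) {i j : Q} (a : i ⟶ j) (t t' : ZMod m)
    (x : PathAlgebra k Q) :
    toBound (cyclicRelations θ ν N s m)
      (copyMap k ν m t (arrow k a) * (connSum k ν m t' * copyMap k ν m t' x)) ∈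
      normalForms θ ν N s m := by
  have hne : ∀ l, (⟨ν l, t' + 1⟩ : CyclicVertex ν m) ≠ ⟨i, t⟩ →
      copyMap k ν m t (arrow k a) * connArrow k ν m l t' = 0 := by
    intro l h
    rw [copyMap_arrow]
    exact ofPath_mul_of_ne _ _ h
  rw [← mul_assoc, connSum, Finset.mul_sum]
  by_cases ht : t' = t - 1
  · subst ht
    rw [Finset.sum_eq_single (ν.symm i)]
    · obtain ⟨y, hy, hya⟩ := hN.exists_symm_arrow a ((-1 : k) ^ s)
      have hrel := toBound_eq_zero_of_mem (θ := cyclicRelations θ ν N s m)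
        (CyclicRelation.commute (m := m) a t y hy hya)
      rw [map_sub, sub_eq_zero] at hrel
      rw [map_mul, hrel, ← map_mul, mul_assoc, ← copyMap_mul]
      exact connArrow_mul_copyMap_mem _ _ _ _
    · intro l _ hl
      refine hne l fun h => hl ?_
      exact (ν.eq_symm_apply).2 (congrArg CyclicVertex.vert h)
    · simp
  · rw [Finset.sum_eq_zero, zero_mul, map_zero]
    · exact zero_mem _
    · intro l _
      refine hne l fun h => ht ?_
      exact eq_sub_of_add_eq (congrArg CyclicVertex.index h)

/-- Normal forms contain the vertices and are stable under left multiplication by arrows: an arrow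
of a copy is moved past a connecting arrow, and two connecting arrows in a row give zero. -/
theorem mem_normalForms [FiniteDimensional k (BoundAlgebra θ)]
    (hN : IsNakayamaAutomorphism θ ν N) (b : BoundAlgebra (cyclicRelations θ ν N s m)) :
    b ∈ normalForms θ ν N s m := by
  obtain ⟨z, rfl⟩ := toBound_surjective b
  refine mem_of_left_stable
    ((normalForms θ ν N s m).comap (toBound (cyclicRelations θ ν N s m)).toLinearMap) ?_ ?_ z
  · rintro ⟨i, t⟩
    change toBound (cyclicRelations θ ν N s m) (vertex k (⟨i, t⟩ : CyclicVertex ν m)) ∈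
      normalForms θ ν N s m
    rw [← copyMap_vertex]
    exact copyMap_mem_normalForms t _
  · intro p q a x hx
    change toBound (cyclicRelations θ ν N s m) (arrow k a * x) ∈ normalForms θ ν N s m
    have hx' : toBound (cyclicRelations θ ν N s m) x ∈ normalForms θ ν N s m := hx
    rw [map_mul]
    generalize toBound (cyclicRelations θ ν N s m) x = b at hx'
    induction hx' using Submodule.span_induction with
    | zero => rw [mul_zero]; exact zero_mem _
    | add x y _ _ hx hy => rw [mul_add]; exact add_mem hx hy
    | smul c x _ hx => rw [mul_smul_comm]; exact Submodule.smul_mem _ _ hx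
    | mem b hb =>
      obtain ⟨t', x, rfl | rfl⟩ := hb
      all_goals change CyclicArrow ν m p q at a
      · cases a with
        | @copy i j a t =>
          change toBound (cyclicRelations θ ν N s m)
            (arrow (Q := CyclicVertex ν m) k (CyclicArrow.copy a t)) * _ ∈ _
          rw [← copyMap_arrow, ← map_mul]
          by_cases h : t = t'
          · subst h
            rw [← copyMap_mul]
            exact copyMap_mem_normalForms t _
          · rw [copyMap_mul_copyMap_of_ne h, map_zero]; exact zero_mem _
        | conn i t =>
          change toBound (cyclicRelations θ ν N s m) (connArrow k ν m i t) * _ ∈ _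
          rw [← map_mul]
          exact connArrow_mul_copyMap_mem _ _ _ _
      · cases a with
        | @copy i j a t =>
          change toBound (cyclicRelations θ ν N s m)
            (arrow (Q := CyclicVertex ν m) k (CyclicArrow.copy a t)) * _ ∈ _
          rw [← copyMap_arrow, ← map_mul]
          exact copyMap_mul_connSum_mem hN a t t' x
        | conn i t =>
          change toBound (cyclicRelations θ ν N s m) (connArrow k ν m i t) * _ ∈ _
          rw [← map_mul, ← mul_assoc, map_mul, connArrow_mul_connSum, zero_mul]
          exact zero_mem _

theorem exists_normalForm [FiniteDimensional k (BoundAlgebra θ)]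
    (hN : IsNakayamaAutomorphism θ ν N) (b : BoundAlgebra (cyclicRelations θ ν N s m)) :
    ∃ x y : ZMod m → PathAlgebra k Q, b = ∑ t,
      (toBound (cyclicRelations θ ν N s m) (copyMap k ν m t (x t)) +
        toBound (cyclicRelations θ ν N s m) (connSum k ν m t * copyMap k ν m t (y t))) := by
  classical
  induction mem_normalForms hN b using Submodule.span_induction with
  | zero => exact ⟨0, 0, by simp⟩
  | add b c _ _ hb hc =>
    obtain ⟨x, y, rfl⟩ := hb
    obtain ⟨x', y', rfl⟩ := hc
    refine ⟨x + x', y + y', ?_⟩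
    rw [← Finset.sum_add_distrib]
    refine Finset.sum_congr rfl fun t _ => ?_
    simp only [Pi.add_apply, map_add, mul_add]
    abel
  | smul r b _ hb =>
    obtain ⟨x, y, rfl⟩ := hb
    refine ⟨r • x, r • y, ?_⟩
    rw [Finset.smul_sum]
    refine Finset.sum_congr rfl fun t _ => ?_
    simp only [Pi.smul_apply, map_smul, PathAlgebra.mul_smul', smul_add]
  | mem b hb =>
    obtain ⟨t, x, rfl | rfl⟩ := hb
    · refine ⟨Pi.single t x, 0, ?_⟩
      rw [Finset.sum_eq_single t]
      · simp
      · intro l _ hl; simp [hl]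
      · simp
    · refine ⟨0, Pi.single t x, ?_⟩
      rw [Finset.sum_eq_single t]
      · simp
      · intro l _ hl; simp [hl]
      · simp

end NormalForm

/-- `R` is the extension of `A` by a complete family of orthogonal idempotents `ε t`, `t ∈ ℤ/m`,
commuting with `A` and an element `y` of degree one and square zero that shifts the `ε t` and
commutes with `A` up to the automorphism `τ`. -/
structure IsCyclicExtension {k : Type*} [Field k] {A : Type*} [Ring A] [Algebra k A]
    {R : Type*} [Ring R] [Algebra k R] (𝒜 : ℕ → Submodule k A) (ℛ : ℕ → Submodule k R)
    {m : ℕ} [NeZero m] (ι : A →ₐ[k] R) (τ : A ≃ₐ[k] A) (ε : ZMod m → R) (y : R) : Prop where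
  complete : CompleteOrthogonalIdempotents ε
  commute : ∀ t a, ε t * ι a = ι a * ε t
  mul_map : ∀ a, y * ι a = ι (τ a) * y
  mul_self : y * y = 0
  shift : ∀ t, y * ε t = ε (t + 1) * y
  map_mem : ∀ d, ∀ a ∈ 𝒜 d, ι a ∈ ℛ d
  idem_mem : ∀ t, ε t ∈ ℛ 0
  mem : y ∈ ℛ 1
  exists_eq_sum : ∀ r, ∃ a b : ZMod m → A, r = ∑ t, (ι (a t) * ε t + ι (b t) * y * ε t)
  eq_zero : ∀ a b : ZMod m → A, ∑ t, (ι (a t) * ε t + ι (b t) * y * ε t) = 0 → a = 0 ∧ b = 0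

/-! ### The intertwiner and the sign automorphism -/

namespace IsRealization

variable {k : Type*} [Field k] {Q : Type u} [Quiver.{v} Q] [Fintype Q]
  {A : Type*} [Ring A] [Algebra k A] {𝒜 : ℕ → Submodule k A}
  {θ : Set (PathAlgebra k Q)} {e : Q → A} {φ : BoundAlgebra θ →ₙₐ[k] A}
  {ν : Equiv.Perm Q} {N : BoundAlgebra θ ≃ₐ[k] BoundAlgebra θ} {τ : A ≃ₐ[k] A} {s : ℕ} {u : A}

/-- `u` intertwines the Nakayama automorphism of `kQ/(θ)`, twisted by the sign `(-1) ^ s` on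
arrows, with `τ`, and generates `E A τ(E)` freely, where `E = ∑ i, e i`. -/
structure IsIntertwiner (e : Q → A) (φ : BoundAlgebra θ →ₙₐ[k] A) (ν : Equiv.Perm Q)
    (N : BoundAlgebra θ ≃ₐ[k] BoundAlgebra θ) (τ : A ≃ₐ[k] A) (s : ℕ) (u : A) : Prop where
  vertex : ∀ i, u * τ (e i) = e (ν i) * u
  arrow : ∀ (i j : Q) (a : i ⟶ j), u * τ (φ (toBound θ (arrow k a))) =
    (-1 : k) ^ s • (φ (N (toBound θ (arrow k a))) * u)
  eq_zero : ∀ b, φ b * u = 0 → b = 0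
  exists_eq : ∀ z, ∃ b, (∑ i, e i) * z * τ (∑ i, e i) = φ b * u

theorem intertwiner_path (h : IsRealization 𝒜 θ e φ) (hN : IsNakayamaAutomorphism θ ν N)
    (hu : IsIntertwiner e φ ν N τ s u) {i j : Q} (p : Quiver.Path i j) :
    u * τ (φ (toBound θ (ofPath k p))) =
      ((-1 : k) ^ s) ^ p.length • (φ (N (toBound θ (ofPath k p))) * u) := by
  induction p with
  | nil =>
    have h1 : u * τ (φ (toBound θ (PathAlgebra.vertex k i))) =
        φ (N (toBound θ (PathAlgebra.vertex k i))) * u := by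
      rw [hN.map_vertex, h.map_vertex, h.map_vertex, hu.vertex]
    rw [Quiver.Path.length_nil, pow_zero, one_smul]
    exact h1
  | cons p a ih =>
    rw [← arrow_mul_ofPath, map_mul, map_mul, map_mul, ← mul_assoc, hu.arrow, smul_mul_assoc,
      mul_assoc, ih, mul_smul_comm, smul_smul, ← mul_assoc, ← map_mul, ← map_mul, ← map_mul,
      Quiver.Path.length_cons, pow_succ']

/-- The automorphism of the path algebra that multiplies paths of length `d` by `c ^ d`. -/
def scalePaths {Q : Type u} [Quiver.{v} Q] (c : k) : PathAlgebra k Q →ₗ[k] PathAlgebra k Q :=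
  Finsupp.linearCombination k (fun p : TotalPath Q => c ^ p.path.length • ofPath k p.path)

theorem scalePaths_ofPath {Q : Type u} [Quiver.{v} Q] (c : k) {i j : Q} (p : Quiver.Path i j) :
    scalePaths c (ofPath k p) = c ^ p.length • ofPath k p := by
  unfold scalePaths
  nth_rw 1 [ofPath]
  erw [Finsupp.linearCombination_single, one_smul]

theorem lengthPart_scalePaths {Q : Type u} [Quiver.{v} Q] (c : k) (d : ℕ) (x : PathAlgebra k Q) :
    lengthPart k Q d (scalePaths c x) = c ^ d • lengthPart k Q d x := by
  induction x using induction_ofPath with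
  | h0 => simp
  | hadd x y hx hy => simp only [map_add, smul_add, hx, hy]
  | hsmul r i j p =>
    rw [map_smul, scalePaths_ofPath, map_smul, map_smul, map_smul, lengthPart_ofPath,
      smul_comm (c ^ d)]
    congr 1
    split_ifs with hp
    · rw [hp]
    · simp

theorem scalePaths_scalePaths {Q : Type u} [Quiver.{v} Q] {c d : k} (hcd : c * d = 1)
    (x : PathAlgebra k Q) : scalePaths c (scalePaths d x) = x := by
  induction x using induction_ofPath with
  | h0 => simp
  | hadd x y hx hy => rw [map_add, map_add, hx, hy]
  | hsmul r i j p =>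
    rw [map_smul, map_smul, scalePaths_ofPath, map_smul, scalePaths_ofPath, smul_smul (_ ^ _),
      ← mul_pow, mul_comm, hcd, one_pow, one_smul]

/-- The sign `(-1)^s` collected at each arrow cancels the scaling. The scaling takes place on paths,
so its compatibility with `θ` is not needed. -/
theorem intertwiner_scalePaths (h : IsRealization 𝒜 θ e φ) (hN : IsNakayamaAutomorphism θ ν N)
    (hu : IsIntertwiner e φ ν N τ s u) (x : PathAlgebra k Q) :
    u * τ (φ (toBound θ (scalePaths ((-1 : k) ^ s) x))) = φ (N (toBound θ x)) * u := by
  induction x using induction_ofPath with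
  | h0 => simp
  | hadd x y hx hy => simp only [map_add, mul_add, add_mul, hx, hy]
  | hsmul r i j p =>
    simp only [map_smul, mul_smul_comm, smul_mul_assoc, scalePaths_ofPath]
    rw [h.intertwiner_path hN hu, smul_smul (_ ^ _), ← mul_pow, ← mul_pow, neg_one_mul, neg_neg,
      one_pow, one_pow, one_smul]

/-- The form of generation needed for `u y`: coefficients to the right of `u`, twisted by `τ`,
instead of to its left. -/
theorem exists_eq_intertwiner (h : IsRealization 𝒜 θ e φ) (hN : IsNakayamaAutomorphism θ ν N)
    (hu : IsIntertwiner e φ ν N τ s u) (z : A) :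
    ∃ b, (∑ i, e i) * z * τ (∑ i, e i) = u * τ (φ b) := by
  obtain ⟨b, hb⟩ := hu.exists_eq z
  obtain ⟨x, hx⟩ := toBound_surjective (N.symm b)
  refine ⟨toBound θ (scalePaths ((-1 : k) ^ s) x), ?_⟩
  rw [hb, h.intertwiner_scalePaths hN hu, hx, N.apply_symm_apply]

/-- Freeness of `u` kills the class of the scaled `x`. Through the grading of `A` each length
component of its class vanishes, and scaling changes these only by nonzero factors. -/
theorem eq_zero_of_intertwiner [GradedAlgebra 𝒜] (h : IsRealization 𝒜 θ e φ)
    (hN : IsNakayamaAutomorphism θ ν N) (hu : IsIntertwiner e φ ν N τ s u) {b : BoundAlgebra θ}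
    (hb : u * τ (φ b) = 0) : b = 0 := by
  have hc : ((-1 : k) ^ s) * (-1) ^ s = 1 := by rw [← mul_pow, neg_one_mul, neg_neg, one_pow]
  obtain ⟨x, rfl⟩ := toBound_surjective b
  have hxx := scalePaths_scalePaths hc x
  rw [← hxx, h.intertwiner_scalePaths hN hu] at hb
  have h0 : toBound θ (scalePaths ((-1 : k) ^ s) x) = 0 :=
    (map_eq_zero_iff N N.injective).1 (hu.eq_zero _ hb)
  refine h.injective ?_
  rw [map_zero]
  refine eq_zero_of_gradedProj 𝒜 fun d => ?_
  have h1 := h.gradedProj_map d (scalePaths ((-1 : k) ^ s) x)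
  rw [h0, map_zero, map_zero, lengthPart_scalePaths, map_smul, map_smul,
    ← h.gradedProj_map] at h1
  exact (smul_eq_zero.1 h1.symm).resolve_left
    (pow_ne_zero _ (pow_ne_zero _ (neg_ne_zero.2 one_ne_zero)))

end IsRealization

/-! ### The cyclic quiver realized in a cyclic extension -/

namespace IsRealization

variable {k : Type*} [Field k] {Q : Type u} [Quiver.{v} Q] [Fintype Q]
  {A : Type*} [Ring A] [Algebra k A] {𝒜 : ℕ → Submodule k A}
  {R : Type*} [Ring R] [Algebra k R] {ℛ : ℕ → Submodule k R}
  {θ : Set (PathAlgebra k Q)} {e : Q → A} {φ : BoundAlgebra θ →ₙₐ[k] A}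
  {ν : Equiv.Perm Q} {N : BoundAlgebra θ ≃ₐ[k] BoundAlgebra θ} {τ : A ≃ₐ[k] A} {s : ℕ} {u : A}
  {m : ℕ} [NeZero m] {ι : A →ₐ[k] R} {ε : ZMod m → R} {y : R}

/-- The idempotents of the cyclic extension. -/
def cyclicIdempotent (ν : Equiv.Perm Q) (e : Q → A) (ι : A →ₐ[k] R) (ε : ZMod m → R)
    (x : CyclicVertex ν m) : R := ι (e x.vert) * ε x.index

/-- The elements of the cyclic extension attached to the arrows. -/
def cyclicElement (ν : Equiv.Perm Q) (e : Q → A) (φ : BoundAlgebra θ →ₙₐ[k] A) (ι : A →ₐ[k] R)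
    (ε : ZMod m → R) (η : R) : ∀ {x y : CyclicVertex ν m}, CyclicArrow ν m x y → R
  | _, _, .copy a t => ι (φ (toBound θ (arrow k a))) * ε t
  | _, _, .conn i t => η * ι (e i) * ε t

theorem sum_cyclicIdempotent {Q : Type u} [Fintype Q] {ν : Equiv.Perm Q} {e : Q → A}
    (hR : IsCyclicExtension 𝒜 ℛ ι τ ε y) :
    ∑ x, cyclicIdempotent ν e ι ε x = ι (∑ i, e i) := by
  rw [← Equiv.sum_comp (cyclicVertexEquiv ν m).symm, Fintype.sum_prod_type, map_sum]
  refine Finset.sum_congr rfl fun i _ => ?_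
  change ∑ t, ι (e i) * ε t = _
  rw [← Finset.mul_sum, hR.complete.complete, mul_one]

theorem orthogonal_cyclicIdempotent (h : IsRealization 𝒜 θ e φ)
    (hR : IsCyclicExtension 𝒜 ℛ ι τ ε y) :
    OrthogonalIdempotents (cyclicIdempotent ν e ι ε) := by
  have hmul : ∀ x x' : CyclicVertex ν m, cyclicIdempotent ν e ι ε x *
      cyclicIdempotent ν e ι ε x' = ι (e x.vert * e x'.vert) * (ε x.index * ε x'.index) := by
    intro x x'
    rw [cyclicIdempotent, cyclicIdempotent, mul_assoc, ← mul_assoc (ε _), hR.commute, map_mul]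
    simp only [mul_assoc]
  refine ⟨fun x => ?_, fun x x' hne => ?_⟩
  · change _ * _ = _
    rw [hmul, h.orthogonal.idem, hR.complete.idem, cyclicIdempotent]
  · change _ * _ = _
    rw [hmul]
    by_cases hv : x.vert = x'.vert
    · have hi : x.index ≠ x'.index := fun hi => hne (CyclicVertex.ext hv hi)
      rw [hR.complete.ortho hi, mul_zero]
    · rw [h.orthogonal.ortho hv, map_zero, zero_mul]

theorem mul_map_idem_mul (hR : IsCyclicExtension 𝒜 ℛ ι τ ε y) (r : R) (a b : A) (t : ZMod m) :
    r * ι a * ε t * (ι b * ε t) = r * ι (a * b) * ε t := by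
  rw [mul_assoc, ← mul_assoc (ε t), hR.commute, mul_assoc, mul_assoc, hR.complete.idem, map_mul]
  simp only [mul_assoc]

theorem conn_mul_map (hR : IsCyclicExtension 𝒜 ℛ ι τ ε y) (a : A) :
    ι u * y * ι a = ι (u * τ a) * y := by
  rw [mul_assoc, hR.mul_map, ← mul_assoc, map_mul]

theorem conn_mul_vertex (hR : IsCyclicExtension 𝒜 ℛ ι τ ε y)
    (hu : IsIntertwiner e φ ν N τ s u) (i : Q) :
    ι u * y * ι (e i) = ι (e (ν i)) * (ι u * y) := by
  rw [conn_mul_map hR, hu.vertex, map_mul, mul_assoc]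

theorem conn_mul_idem (hR : IsCyclicExtension 𝒜 ℛ ι τ ε y) (t : ZMod m) :
    ι u * y * ε t = ε (t + 1) * (ι u * y) := by
  rw [mul_assoc, hR.shift, ← mul_assoc, ← hR.commute, mul_assoc]

theorem conn_mul_conn (hR : IsCyclicExtension 𝒜 ℛ ι τ ε y) : ι u * y * (ι u * y) = 0 := by
  rw [← mul_assoc, conn_mul_map hR, mul_assoc, hR.mul_self, mul_zero]

theorem idem_mul_cyclicElement (h : IsRealization 𝒜 θ e φ)
    (hR : IsCyclicExtension 𝒜 ℛ ι τ ε y) (hu : IsIntertwiner e φ ν N τ s u)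
    {x x' : CyclicVertex ν m} (a : CyclicArrow ν m x x') :
    cyclicIdempotent ν e ι ε x' * cyclicElement ν e φ ι ε (ι u * y) a =
      cyclicElement ν e φ ι ε (ι u * y) a := by
  cases a with
  | copy a t =>
    rw [cyclicElement, cyclicIdempotent, mul_assoc, ← mul_assoc (ε _), hR.commute, mul_assoc,
      hR.complete.idem, ← mul_assoc, ← map_mul, arrow, h.vertex_mul_map_ofPath]
  | conn i t =>
    change ι (e (ν i)) * ε (t + 1) * (ι u * y * ι (e i) * ε t) = ι u * y * ι (e i) * ε t
    have h1 : ι u * y * ι (e i) * ε t = ε (t + 1) * (ι (e (ν i)) * (ι u * y)) := by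
      rw [mul_assoc, ← hR.commute, ← mul_assoc, conn_mul_idem hR, mul_assoc,
        conn_mul_vertex hR hu]
    rw [h1, mul_assoc, ← mul_assoc (ε _) (ε _), hR.complete.idem, ← mul_assoc, ← hR.commute,
      mul_assoc, ← mul_assoc (ι _) (ι _), ← map_mul, h.orthogonal.idem]

theorem cyclicElement_mul_idem (h : IsRealization 𝒜 θ e φ)
    (hR : IsCyclicExtension 𝒜 ℛ ι τ ε y)
    {x x' : CyclicVertex ν m} (a : CyclicArrow ν m x x') :
    cyclicElement ν e φ ι ε (ι u * y) a * cyclicIdempotent ν e ι ε x =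
      cyclicElement ν e φ ι ε (ι u * y) a := by
  cases a with
  | copy a t =>
    rw [cyclicElement, cyclicIdempotent, mul_assoc, ← mul_assoc (ε _), hR.commute, mul_assoc,
      hR.complete.idem, ← mul_assoc, ← map_mul, arrow, h.map_ofPath_mul_vertex]
  | conn i t =>
    change ι u * y * ι (e i) * ε t * (ι (e i) * ε t) = ι u * y * ι (e i) * ε t
    rw [mul_map_idem_mul hR, h.orthogonal.idem]

/-- The homomorphism from the path algebra of the cyclic quiver to the cyclic extension. -/
def cyclicHom (h : IsRealization 𝒜 θ e φ) (hR : IsCyclicExtension 𝒜 ℛ ι τ ε y)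
    (hu : IsIntertwiner e φ ν N τ s u) : PathAlgebra k (CyclicVertex ν m) →ₙₐ[k] R :=
  liftNonUnital k (e := cyclicIdempotent ν e ι ε)
    (c := fun {_ _} a => cyclicElement ν e φ ι ε (ι u * y) a)
    (h.orthogonal_cyclicIdempotent hR) (fun a => h.idem_mul_cyclicElement hR hu a)

theorem cyclicHom_vertex (h : IsRealization 𝒜 θ e φ) (hR : IsCyclicExtension 𝒜 ℛ ι τ ε y)
    (hu : IsIntertwiner e φ ν N τ s u) (x : CyclicVertex ν m) :
    h.cyclicHom hR hu (vertex k x) = cyclicIdempotent ν e ι ε x :=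
  liftNonUnital_vertex _ _ x

theorem cyclicHom_arrow (h : IsRealization 𝒜 θ e φ) (hR : IsCyclicExtension 𝒜 ℛ ι τ ε y)
    (hu : IsIntertwiner e φ ν N τ s u) {x x' : CyclicVertex ν m} (a : x ⟶ x') :
    h.cyclicHom hR hu (arrow k a) = cyclicElement ν e φ ι ε (ι u * y) a :=
  liftNonUnital_arrow (e := cyclicIdempotent ν e ι ε)
    (c := fun {_ _} a => cyclicElement ν e φ ι ε (ι u * y) a) _ _
    (fun a => h.cyclicElement_mul_idem hR a) a

theorem cyclicHom_connArrow (h : IsRealization 𝒜 θ e φ) (hR : IsCyclicExtension 𝒜 ℛ ι τ ε y)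
    (hu : IsIntertwiner e φ ν N τ s u) (i : Q) (t : ZMod m) :
    h.cyclicHom hR hu (connArrow k ν m i t) = ι u * y * ι (e i) * ε t :=
  h.cyclicHom_arrow hR hu _

theorem cyclicHom_copyMap (h : IsRealization 𝒜 θ e φ) (hR : IsCyclicExtension 𝒜 ℛ ι τ ε y)
    (hu : IsIntertwiner e φ ν N τ s u) (t : ZMod m) (x : PathAlgebra k Q) :
    h.cyclicHom hR hu (copyMap k ν m t x) = ι (φ (toBound θ x)) * ε t := by
  induction x using induction_ofPath with
  | h0 => simp
  | hadd x y hx hy => simp only [map_add, add_mul, hx, hy]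
  | hsmul r i j p =>
    simp only [map_smul, smul_mul_assoc]
    congr 1
    induction p with
    | nil =>
      have h1 := h.cyclicHom_vertex hR hu ⟨i, t⟩
      rw [← copyMap_vertex, cyclicIdempotent, ← h.map_vertex] at h1
      exact h1
    | cons p a ih =>
      rw [← arrow_mul_ofPath, copyMap_mul, map_mul, ih, copyMap_arrow, h.cyclicHom_arrow,
        cyclicElement, mul_assoc, ← mul_assoc (ε t), hR.commute, mul_assoc, hR.complete.idem,
        ← mul_assoc, ← map_mul, ← map_mul, ← map_mul]

theorem cyclicHom_connSum_mul (h : IsRealization 𝒜 θ e φ) (hR : IsCyclicExtension 𝒜 ℛ ι τ ε y)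
    (hu : IsIntertwiner e φ ν N τ s u) (t : ZMod m) (x : PathAlgebra k Q) :
    h.cyclicHom hR hu (connSum k ν m t * copyMap k ν m t x) =
      ι (u * τ (φ (toBound θ x))) * y * ε t := by
  have h1 : h.cyclicHom hR hu (connSum k ν m t) = ι u * y * ι (∑ i, e i) * ε t := by
    rw [connSum, map_sum, map_sum, Finset.mul_sum, Finset.sum_mul]
    exact Finset.sum_congr rfl fun i _ => h.cyclicHom_connArrow hR hu i t
  rw [map_mul, h1, cyclicHom_copyMap, mul_map_idem_mul hR, h.sum_mul_map, conn_mul_map hR]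

/-- The factor `(-1)^s` by which `u τ( · )` differs from `N( · ) u` on arrows cancels the one in
`ν⁻¹ σ̃ α`. -/
theorem conn_mul_arrow (hR : IsCyclicExtension 𝒜 ℛ ι τ ε y)
    (hu : IsIntertwiner e φ ν N τ s u) {i j : Q} (a : i ⟶ j)
    {x : PathAlgebra k Q} (hx : x ∈ arrowSpan k Q)
    (hxa : toBound θ x = N.symm (toBound θ ((-1 : k) ^ s • arrow k a))) :
    ι u * y * ι (φ (toBound θ x)) = ι (φ (toBound θ (arrow k a))) * (ι u * y) := by
  have hlin : u * τ (φ (toBound θ x)) = (-1 : k) ^ s • (φ (N (toBound θ x)) * u) := by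
    clear hxa
    induction hx using Submodule.span_induction with
    | mem x hx =>
      obtain ⟨i, j, a, rfl⟩ := hx
      exact hu.arrow i j a
    | zero => simp
    | add x y _ _ hx hy => simp only [map_add, mul_add, add_mul, smul_add, hx, hy]
    | smul c x _ hx =>
      simp only [map_smul, mul_smul_comm, smul_mul_assoc, hx]
      rw [smul_comm]
  rw [conn_mul_map hR, hlin, hxa, N.apply_symm_apply, map_smul (toBound θ), map_smul φ,
    smul_mul_assoc, smul_smul, ← mul_pow, neg_one_mul, neg_neg, one_pow, one_smul, map_mul, mul_assoc]

/-- The squares vanish because `y² = 0`; the commutation relation is `conn_mul_arrow` together with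
the shift of the `ε_t` by `y`. -/
theorem cyclicHom_relation (h : IsRealization 𝒜 θ e φ) (hR : IsCyclicExtension 𝒜 ℛ ι τ ε y)
    (hu : IsIntertwiner e φ ν N τ s u) (hN : IsNakayamaAutomorphism θ ν N)
    {r : PathAlgebra k (CyclicVertex ν m)} (hr : CyclicRelation θ ν N s m r) :
    h.cyclicHom hR hu r = 0 := by
  cases hr with
  | copy r hr t => rw [h.cyclicHom_copyMap, toBound_eq_zero_of_mem hr, map_zero, map_zero, zero_mul]
  | square i t =>
    rw [map_mul, cyclicHom_connArrow, cyclicHom_connArrow, conn_mul_vertex hR hu]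
    have h1 : ι u * y * ε (t + 1) * (ι u * y * ι (e i) * ε t) = 0 := by
      rw [conn_mul_idem hR, mul_assoc, ← mul_assoc (ι u * y), ← mul_assoc (ι u * y),
        conn_mul_conn hR, zero_mul, zero_mul, mul_zero]
    rw [mul_assoc, mul_assoc, ← mul_assoc (_ * _) (ε _), h1, mul_zero]
  | commute a t x hx hxa =>
    rename_i i j
    have hxv := hN.vertex_mul_mul_vertex h.quadratic a _ hx hxa
    have h1 : e (ν.symm j) * φ (toBound θ x) = φ (toBound θ x) := by
      rw [← h.map_vertex, ← map_mul, ← map_mul, ← hxv, mul_assoc, ← mul_assoc (vertex _ _),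
        vertex_orthogonal.idem]
    have ht : ε t * (ι u * y) = ι u * y * ε (t - 1) := by
      rw [conn_mul_idem hR, sub_add_cancel]
    rw [map_sub, map_mul, map_mul, cyclicHom_connArrow, cyclicHom_connArrow, cyclicHom_copyMap,
      cyclicHom_copyMap, mul_map_idem_mul hR, h1, conn_mul_arrow hR hu a hx hxa, sub_eq_zero,
      conn_mul_vertex hR hu, Equiv.apply_symm_apply, mul_assoc, ← mul_assoc (ε t),
      ← mul_assoc (ε t), hR.commute, mul_assoc (ι _) (ε t), ht, mul_assoc (ι (e i)),
      mul_assoc (_ * _) (ε _) (ε _), hR.complete.idem, ← mul_assoc, ← map_mul, arrow,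
      h.map_ofPath_mul_vertex, ← mul_assoc]

/-- A realization of `kQ/(θ)` in `A` extends to a realization of the algebra of the cyclic quiver
in a cyclic extension of `A`. -/
theorem exists_cyclic [GradedAlgebra 𝒜] [GradedAlgebra ℛ] [FiniteDimensional k A]
    (h : IsRealization 𝒜 θ e φ) (hR : IsCyclicExtension 𝒜 ℛ ι τ ε y) (hu0 : u ∈ 𝒜 0)
    (hu : IsIntertwiner e φ ν N τ s u) (hN : IsNakayamaAutomorphism θ ν N) :
    ∃ Φ, IsRealization ℛ (cyclicRelations θ ν N s m) (cyclicIdempotent ν e ι ε) Φ := by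
  classical
  have : FiniteDimensional k (BoundAlgebra θ) :=
    FiniteDimensional.of_injective (φ : BoundAlgebra θ →ₗ[k] A) h.injective
  obtain ⟨Φ, hΦ⟩ := exists_boundAlgebra_lift (h.cyclicHom hR hu)
    (fun r (hr : r ∈ cyclicRelations θ ν N s m) => h.cyclicHom_relation hR hu hN hr)
  have hΦ1 : Φ 1 = ∑ x, cyclicIdempotent ν e ι ε x := by
    rw [← _root_.map_one (toBound (cyclicRelations θ ν N s m)), one_eq, map_sum, map_sum]
    exact Finset.sum_congr rfl fun x _ => by rw [hΦ, cyclicHom_vertex]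
  refine ⟨Φ, fun r hr => isQuadraticRelation_of_cyclicRelation hN h.quadratic hr,
    h.orthogonal_cyclicIdempotent hR, ?_, ?_, ?_, ?_, ?_, ?_, ?_⟩
  · rintro ⟨i, t⟩ h0
    change ι (e i) * ε t = 0 at h0
    have h1 := (hR.eq_zero (Pi.single t (e i)) 0 ?_).1
    · have h2 := congrFun h1 t
      rw [Pi.single_eq_same] at h2
      exact h.ne_zero i h2
    · rw [Finset.sum_eq_single t]
      · simp [h0]
      · intro t' _ ht'; simp [ht']
      · simp
  · rintro ⟨i, t⟩
    have := SetLike.GradedMul.mul_mem (hR.map_mem 0 _ (h.degree_zero i)) (hR.idem_mem t)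
    exact this
  · rw [sum_cyclicIdempotent hR]
    -- As the `ε_t` sum to one, the idempotent of the cyclic quiver is `ι(E)`; its fullness is the
    -- image of `1 ∈ A E A` under `ι`.
    have key : ∀ x ∈ Submodule.span k {x | ∃ a b, x = a * (∑ i, e i) * b},
        ι x ∈ Submodule.span k {x | ∃ a b, x = a * ι (∑ i, e i) * b} := by
      intro x hx
      induction hx using Submodule.span_induction with
      | zero => rw [map_zero]; exact zero_mem _
      | add x x' _ _ hx hx' => rw [map_add]; exact add_mem hx hx'
      | smul c x _ hx => rw [map_smul]; exact Submodule.smul_mem _ _ hx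
      | mem x hx =>
        obtain ⟨a, b, rfl⟩ := hx
        exact Submodule.subset_span ⟨ι a, ι b, by rw [map_mul, map_mul]⟩
    have h1 := key 1 h.full
    rwa [_root_.map_one] at h1
  · rw [injective_iff_map_eq_zero]
    intro b hb
    -- The normal form becomes `∑ (φ(x_t) ε_t + u τ(φ(z_t)) y ε_t)`, whose coefficients in `A` are
    -- unique.
    obtain ⟨x, z, rfl⟩ := exists_normalForm hN b
    rw [map_sum] at hb
    simp only [map_add, hΦ, cyclicHom_copyMap, cyclicHom_connSum_mul] at hb
    obtain ⟨hx, hz⟩ := hR.eq_zero (fun t => φ (toBound θ (x t)))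
      (fun t => u * τ (φ (toBound θ (z t)))) hb
    refine Finset.sum_eq_zero fun t _ => ?_
    have hx0 : toBound θ (x t) = 0 := h.injective ((congrFun hx t).trans (map_zero φ).symm)
    have hz0 : toBound θ (z t) = 0 := h.eq_zero_of_intertwiner hN hu (congrFun hz t)
    rw [map_mul, toBound_copyMap_eq_zero hx0, toBound_copyMap_eq_zero hz0, mul_zero, add_zero]
  · ext r
    constructor
    · rintro ⟨b, rfl⟩
      exact ⟨Φ b, by rw [← hΦ1, ← map_mul, ← map_mul, one_mul, mul_one]⟩
    · rintro ⟨r, rfl⟩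
      obtain ⟨a, b, rfl⟩ := hR.exists_eq_sum r
      rw [sum_cyclicIdempotent hR]
      have ha : ∀ t, ∃ x, φ (toBound θ x) = (∑ i, e i) * a t * (∑ i, e i) := fun t => by
        obtain ⟨c, hc⟩ := h.exists_eq (a t)
        obtain ⟨x, rfl⟩ := toBound_surjective c
        exact ⟨x, hc⟩
      -- From `E b y E = E b τ(E) y` the coefficient of `y` in the corner is `E b τ(E)`, which has
      -- to be written as `u τ(φ( · ))`.
      have hb : ∀ t, ∃ x, u * τ (φ (toBound θ x)) = (∑ i, e i) * b t * τ (∑ i, e i) :=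
        fun t => by
          obtain ⟨c, hc⟩ := h.exists_eq_intertwiner hN hu (b t)
          obtain ⟨x, rfl⟩ := toBound_surjective c
          exact ⟨x, hc.symm⟩
      choose x hx using ha
      choose z hz using hb
      refine ⟨∑ t, (toBound (cyclicRelations θ ν N s m) (copyMap k ν m t (x t)) +
        toBound (cyclicRelations θ ν N s m) (connSum k ν m t * copyMap k ν m t (z t))), ?_⟩
      rw [map_sum, Finset.mul_sum, Finset.sum_mul]
      refine Finset.sum_congr rfl fun t _ => ?_
      rw [map_add, hΦ, hΦ, cyclicHom_copyMap, cyclicHom_connSum_mul, hx, hz, mul_add, add_mul]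
      congr 1
      · simp only [map_mul, mul_assoc, hR.commute]
      · simp only [map_mul, mul_assoc, hR.commute]
        rw [← mul_assoc y (ι _), hR.mul_map, mul_assoc]
  · intro x
    rw [hΦ, cyclicHom_vertex]
  · intro x x' a
    rw [hΦ, cyclicHom_arrow]
    change CyclicArrow ν m x x' at a
    cases a with
    | copy a t =>
      have := SetLike.GradedMul.mul_mem (hR.map_mem 1 _ (h.map_arrow _ _ a)) (hR.idem_mem t)
      exact this
    | conn i t =>
      have h1 := SetLike.GradedMul.mul_mem (SetLike.GradedMul.mul_mem
        (SetLike.GradedMul.mul_mem (hR.map_mem 0 _ hu0) hR.mem)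
        (hR.map_mem 0 _ (h.degree_zero i))) (hR.idem_mem t)
      exact h1

end IsRealization

end Realization

/-! ### The Frobenius form of the exterior algebra -/

section TopForm

variable {k : Type*} [Field k] {W : Type*} [AddCommGroup W] [Module k W] [FiniteDimensional k W]

variable (k W) in
/-- A linear form on the exterior algebra that is concentrated in the top degree. -/
def topForm : ExteriorAlgebra k W →ₗ[k] k :=
  ExteriorAlgebra.liftAlternating (Pi.single (Module.finrank k W) (Module.finBasis k W).det)

theorem topForm_ιMulti (v : Fin (Module.finrank k W) → W) :
    topForm k W (ExteriorAlgebra.ιMulti k _ v) = (Module.finBasis k W).det v := by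
  rw [topForm, ExteriorAlgebra.liftAlternating_apply_ιMulti, Pi.single_eq_same]

theorem topForm_ιMulti_of_ne {d : ℕ} (hd : d ≠ Module.finrank k W) (v : Fin d → W) :
    topForm k W (ExteriorAlgebra.ιMulti k d v) = 0 := by
  rw [topForm, ExteriorAlgebra.liftAlternating_apply_ιMulti, Pi.single_eq_of_ne hd,
    AlternatingMap.zero_apply]

theorem topForm_of_mem {d : ℕ} (hd : d ≠ Module.finrank k W) {x : ExteriorAlgebra k W}
    (hx : x ∈ ⋀[k]^d W) : topForm k W x = 0 := by
  rw [← ExteriorAlgebra.ιMulti_span_fixedDegree] at hx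
  induction hx using Submodule.span_induction with
  | mem x hx => obtain ⟨v, rfl⟩ := hx; exact topForm_ιMulti_of_ne hd v
  | zero => simp
  | add x y _ _ hx hy => rw [map_add, hx, hy, add_zero]
  | smul c x _ hx => rw [map_smul, hx, smul_zero]

theorem topForm_map (g : W →ₗ[k] W) (x : ExteriorAlgebra k W) :
    topForm k W (ExteriorAlgebra.map g x) = LinearMap.det g * topForm k W x := by
  have h : topForm k W ∘ₗ (ExteriorAlgebra.map g).toLinearMap =
      LinearMap.det g • topForm k W := by
    refine ExteriorAlgebra.lhom_ext ?_
    intro d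
    ext v
    change topForm k W (ExteriorAlgebra.map g (ExteriorAlgebra.ιMulti k d v)) =
      LinearMap.det g * topForm k W (ExteriorAlgebra.ιMulti k d v)
    rw [ExteriorAlgebra.map_apply_ιMulti]
    by_cases hd : d = Module.finrank k W
    · subst hd
      rw [topForm_ιMulti, topForm_ιMulti, Module.Basis.det_comp]
    · rw [topForm_ιMulti_of_ne hd, topForm_ιMulti_of_ne hd, mul_zero]
  exact LinearMap.congr_fun h x

/-- The sign rule `v x = (-1)^d x v` in degree `d`, stated through the automorphism induced by `-1`
so that it holds for all `x` and is multiplicative. -/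
theorem ι_mul_eq_map_neg_mul_ι {W : Type*} [AddCommGroup W] [Module k W] (v : W)
    (x : ExteriorAlgebra k W) :
    ExteriorAlgebra.ι k v * x =
      ExteriorAlgebra.map (-LinearMap.id : W →ₗ[k] W) x * ExteriorAlgebra.ι k v := by
  induction x using ExteriorAlgebra.induction with
  | algebraMap r => rw [AlgHom.commutes, Algebra.commutes]
  | ι w =>
    rw [ExteriorAlgebra.map_apply_ι, LinearMap.neg_apply, LinearMap.id_apply, map_neg, neg_mul,
      eq_neg_iff_add_eq_zero, ExteriorAlgebra.ι_add_mul_swap]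
  | mul x y hx hy => rw [← mul_assoc, hx, mul_assoc, hy, map_mul, mul_assoc]
  | add x y hx hy => rw [mul_add, hx, hy, map_add, add_mul]

/-- Moving `v` past `x` applies the automorphism induced by `-1` to `x v`, up to one more sign from
`v`; on the top degree `n` that automorphism acts by `det(-1) = (-1)^n`. The exponent `n + 1` has
the parity of `n - 1`. -/
theorem topForm_ι_mul (v : W) (x : ExteriorAlgebra k W) :
    topForm k W (ExteriorAlgebra.ι k v * x) =
      (-1) ^ (Module.finrank k W + 1) * topForm k W (x * ExteriorAlgebra.ι k v) := by
  have h1 : ExteriorAlgebra.map (-LinearMap.id : W →ₗ[k] W) x * ExteriorAlgebra.ι k v =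
      -ExteriorAlgebra.map (-LinearMap.id : W →ₗ[k] W) (x * ExteriorAlgebra.ι k v) := by
    rw [map_mul, ExteriorAlgebra.map_apply_ι, LinearMap.neg_apply, LinearMap.id_apply, map_neg,
      mul_neg, neg_neg]
  have h2 : LinearMap.det (-LinearMap.id : W →ₗ[k] W) = (-1) ^ Module.finrank k W := by
    rw [← neg_one_smul k (LinearMap.id : W →ₗ[k] W), LinearMap.det_smul, LinearMap.det_id, mul_one]
  rw [ι_mul_eq_map_neg_mul_ι, h1, map_neg, topForm_map, h2, pow_succ]
  ring

variable (k W) in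
/-- The sign `(-1) ^ (n - 1)`, where `n` is the dimension of `W`. -/
def topSign : kˣ := (-1) ^ (Module.finrank k W + 1)

/-- Both sides are multiplicative in `x`, so moving single vectors suffices. Scaling by `(-1)^{n-1}`
is thus the Nakayama automorphism. -/
theorem topForm_mul_comm (x y : ExteriorAlgebra k W) :
    topForm k W (x * y) = topForm k W
      (y * ExteriorAlgebra.map ((topSign k W : k) • LinearMap.id : W →ₗ[k] W) x) := by
  induction x using ExteriorAlgebra.induction generalizing y with
  | algebraMap r => rw [AlgHom.commutes, Algebra.commutes]
  | ι w =>
    rw [ExteriorAlgebra.map_apply_ι, LinearMap.smul_apply, LinearMap.id_apply, map_smul,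
      mul_smul_comm, map_smul, topForm_ι_mul, smul_eq_mul, topSign]
    simp
  | mul x z hx hz => rw [mul_assoc, hx, mul_assoc, hz, map_mul (ExteriorAlgebra.map _),
      mul_assoc]
  | add x z hx hz => rw [add_mul, map_add, hx, hz, map_add, mul_add, map_add]

/-- In the basis of the `b_S` the element `b_{Sᶜ}` pairs nontrivially with `b_S` only, so it reads
off the coefficient of `x` at `S`. -/
theorem topForm_nondegenerate {x : ExteriorAlgebra k W}
    (hx : ∀ y, topForm k W (y * x) = 0) : x = 0 := by
  classical
  set n := Module.finrank k W with hn
  let b := Module.finBasis k W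
  have hzero : ∀ S T : Finset (Fin n), T ≠ S →
      topForm k W (b.ExteriorAlgebra Sᶜ * b.ExteriorAlgebra T) = 0 := by
    intro S T hST
    let s : Set.powersetCard (Fin n) (Sᶜ).card := Set.powersetCard.ofCard rfl
    let t : Set.powersetCard (Fin n) T.card := Set.powersetCard.ofCard rfl
    have hs : b.ExteriorAlgebra Sᶜ = b.ExteriorAlgebra (s : Finset (Fin n)) := rfl
    have ht : b.ExteriorAlgebra T = b.ExteriorAlgebra (t : Finset (Fin n)) := rfl
    rw [hs, ht]
    by_cases hd : Disjoint s.val t.val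
    · rw [ExteriorAlgebra.basis_mul_of_disjoint b s t hd]
      rw [ExteriorAlgebra.basis_apply_powersetCard, Units.smul_def, map_zsmul]
      rw [topForm_ιMulti_of_ne, smul_zero]
      intro hcard
      apply hST
      have hsub : T ⊆ S := by
        have h1 : Disjoint Sᶜ T := hd
        have := h1.symm.le_compl_right
        rwa [compl_compl] at this
      refine Finset.eq_of_subset_of_card_le hsub ?_
      rw [Finset.card_compl, Fintype.card_fin] at hcard
      have := Finset.card_le_univ S
      rw [Fintype.card_fin] at this
      omega
    · rw [ExteriorAlgebra.basis_mul_of_not_disjoint b s t hd, map_zero]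
  -- The form vanishes on every other basis vector, so vanishing here would make it zero, contrary
  -- to `det b = 1`.
  have huniv : topForm k W (b.ExteriorAlgebra Finset.univ) ≠ 0 := by
    intro h0
    have h1 : topForm k W = 0 := by
      refine b.ExteriorAlgebra.ext fun T => ?_
      rw [LinearMap.zero_apply]
      by_cases hT : T = Finset.univ
      · rw [hT, h0]
      · rw [ExteriorAlgebra.basis_apply_ofCard b rfl, topForm_ιMulti_of_ne]
        intro hc
        exact hT (Finset.card_eq_iff_eq_univ T |>.1 (by rw [hc, Fintype.card_fin]))
    have h2 := topForm_ιMulti (k := k) b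
    rw [h1, LinearMap.zero_apply, Module.Basis.det_self] at h2
    exact zero_ne_one h2
  have hne : ∀ S : Finset (Fin n),
      topForm k W (b.ExteriorAlgebra Sᶜ * b.ExteriorAlgebra S) ≠ 0 := by
    intro S
    let s : Set.powersetCard (Fin n) (Sᶜ).card := Set.powersetCard.ofCard rfl
    let t : Set.powersetCard (Fin n) S.card := Set.powersetCard.ofCard rfl
    have hs : b.ExteriorAlgebra Sᶜ = b.ExteriorAlgebra (s : Finset (Fin n)) := rfl
    have ht : b.ExteriorAlgebra S = b.ExteriorAlgebra (t : Finset (Fin n)) := rfl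
    rw [hs, ht]
    have hd : Disjoint s.val t.val := disjoint_compl_left
    rw [ExteriorAlgebra.basis_mul_of_disjoint b s t hd, Units.smul_def, map_zsmul]
    have hU : (Set.powersetCard.disjUnion hd : Finset (Fin n)) = Finset.univ := by
      rw [Set.powersetCard.coe_disjUnion, Finset.disjUnion_eq_union]
      exact compl_sup_eq_top
    rw [hU]
    generalize (Set.powersetCard.permOfDisjoint hd).sign = c
    rcases Int.units_eq_one_or c with rfl | rfl <;> simpa using huniv
  have hrepr : ∀ S, b.ExteriorAlgebra.repr x S = 0 := by
    intro S
    have h1 := hx (b.ExteriorAlgebra Sᶜ)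
    rw [← b.ExteriorAlgebra.sum_repr x, Finset.mul_sum, map_sum, Finset.sum_eq_single S] at h1
    · rw [mul_smul_comm, map_smul] at h1
      exact (smul_eq_zero.1 h1).resolve_right (hne S)
    · intro T _ hT
      rw [mul_smul_comm, map_smul, hzero S T hT, smul_zero]
    · simp
  rw [← b.ExteriorAlgebra.sum_repr x]
  exact Finset.sum_eq_zero fun S _ => by rw [hrepr, zero_smul]

instance : FiniteDimensional k (ExteriorAlgebra k W) :=
  Module.Finite.of_basis (Module.finBasis k W).ExteriorAlgebra

theorem finrank_exteriorAlgebra :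
    Module.finrank k (ExteriorAlgebra k W) = 2 ^ Module.finrank k W := by
  rw [Module.finrank_eq_card_basis (Module.finBasis k W).ExteriorAlgebra, Fintype.card_finset,
    Fintype.card_fin]

theorem exteriorPower_eq_bot {d : ℕ} (hd : Module.finrank k W < d) : ⋀[k]^d W = ⊥ := by
  rw [← Submodule.finrank_eq_zero (R := k), exteriorPower.finrank_eq, Nat.choose_eq_zero_of_lt hd]

end TopForm

/-! ### Skew group algebras: homomorphisms, grading and Frobenius form -/

section SkewHom

variable {k : Type*} [Field k] {W W' : Type*} [AddCommGroup W] [Module k W] [AddCommGroup W']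
  [Module k W'] {H : Subgroup (W ≃ₗ[k] W)} {H' : Subgroup (W' ≃ₗ[k] W')}

theorem subgroup_smul_eq (h : H) (x : ExteriorAlgebra k W) :
    h • x = ExteriorAlgebra.map (((h : W ≃ₗ[k] W) : W →ₗ[k] W)) x := rfl

/-- The exterior algebra inside the skew group algebra. -/
def exteriorToSkew (H : Subgroup (W ≃ₗ[k] W)) : ExteriorAlgebra k W →ₐ[k] ExteriorSkew H where
  __ := SkewMonoidAlgebra.singleOneRingHom
  commutes' _ := rfl

theorem exteriorToSkew_apply (x : ExteriorAlgebra k W) :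
    exteriorToSkew H x = SkewMonoidAlgebra.single 1 x := rfl

theorem exteriorSkew_induction {P : ExteriorSkew H → Prop} (a : ExteriorSkew H) (h0 : P 0)
    (hadd : ∀ x y, P x → P y → P (x + y))
    (hs : ∀ (h : H) (x : ExteriorAlgebra k W), P (SkewMonoidAlgebra.single h x)) : P a := by
  refine SkewMonoidAlgebra.induction_on a h0 ?_ ?_
  · intro g x
    exact hs g x
  · intro x y
    exact hadd x y

/-- The homomorphism of skew group algebras `x h ↦ χ(h) f(x) g(h)`. -/
def skewHom (f : ExteriorAlgebra k W →ₐ[k] ExteriorAlgebra k W') (g : H →* H') (χ : H →* kˣ)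
    (hfg : ∀ (h : H) (x : ExteriorAlgebra k W), f (h • x) = g h • f x) :
    ExteriorSkew H →ₐ[k] ExteriorSkew H' :=
  SkewMonoidAlgebra.liftNCAlgHom ((exteriorToSkew H').comp f)
    { toFun := fun h => (χ h : k) • SkewMonoidAlgebra.single (g h) 1
      map_one' := by
        rw [map_one, map_one, Units.val_one, one_smul, SkewMonoidAlgebra.one_def]
      map_mul' := fun a b => by
        rw [smul_mul_smul_comm, SkewMonoidAlgebra.single_mul_single, smul_one, mul_one, map_mul,
          map_mul, Units.val_mul] }
    (by
      intro x h
      change (SkewMonoidAlgebra.single 1 (f (h • x)) : ExteriorSkew H') *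
          ((χ h : k) • (SkewMonoidAlgebra.single (g h) 1 : ExteriorSkew H')) =
        ((χ h : k) • (SkewMonoidAlgebra.single (g h) 1 : ExteriorSkew H')) *
          SkewMonoidAlgebra.single 1 (f x)
      rw [mul_smul_comm, smul_mul_assoc, SkewMonoidAlgebra.single_mul_single,
        SkewMonoidAlgebra.single_mul_single, one_smul, mul_one, one_mul, mul_one, one_mul, hfg])

theorem skewHom_single (f : ExteriorAlgebra k W →ₐ[k] ExteriorAlgebra k W') (g : H →* H')
    (χ : H →* kˣ) (hfg : ∀ (h : H) (x : ExteriorAlgebra k W), f (h • x) = g h • f x) (h : H)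
    (x : ExteriorAlgebra k W) :
    skewHom f g χ hfg (SkewMonoidAlgebra.single h x) =
      SkewMonoidAlgebra.single (g h) ((χ h : k) • f x) := by
  refine (SkewMonoidAlgebra.liftNC_single _ _ _ _).trans ?_
  change (SkewMonoidAlgebra.single 1 (f x) : ExteriorSkew H') *
    ((χ h : k) • (SkewMonoidAlgebra.single (g h) 1 : ExteriorSkew H')) = _
  rw [mul_smul_comm, SkewMonoidAlgebra.single_mul_single, one_smul, mul_one, one_mul,
    SkewMonoidAlgebra.smul_single]

theorem map_smul_id_smul (c : k) (h : H) (x : ExteriorAlgebra k W) :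
    ExteriorAlgebra.map (c • LinearMap.id : W →ₗ[k] W) (h • x) =
      h • ExteriorAlgebra.map (c • LinearMap.id : W →ₗ[k] W) x := by
  rw [subgroup_smul_eq, subgroup_smul_eq, ← AlgHom.comp_apply, ← AlgHom.comp_apply,
    ExteriorAlgebra.map_comp_map, ExteriorAlgebra.map_comp_map, LinearMap.smul_comp,
    LinearMap.comp_smul, LinearMap.id_comp, LinearMap.comp_id]

theorem map_smul_id_map_smul_id (c d : k) (x : ExteriorAlgebra k W) :
    ExteriorAlgebra.map (c • LinearMap.id : W →ₗ[k] W)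
      (ExteriorAlgebra.map (d • LinearMap.id : W →ₗ[k] W) x) =
      ExteriorAlgebra.map ((c * d) • LinearMap.id : W →ₗ[k] W) x := by
  rw [← AlgHom.comp_apply, ExteriorAlgebra.map_comp_map, LinearMap.smul_comp,
    LinearMap.id_comp, smul_smul]

theorem map_smul_id_of_mem {d : ℕ} {x : ExteriorAlgebra k W} (hx : x ∈ ⋀[k]^d W) (c : k) :
    ExteriorAlgebra.map (c • LinearMap.id : W →ₗ[k] W) x = c ^ d • x := by
  rw [← ExteriorAlgebra.ιMulti_span_fixedDegree] at hx
  induction hx using Submodule.span_induction with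
  | mem x hx =>
    obtain ⟨v, rfl⟩ := hx
    rw [ExteriorAlgebra.map_apply_ιMulti]
    refine ((ExteriorAlgebra.ιMulti k d).toMultilinearMap.map_smul_univ (fun _ => c) v).trans ?_
    rw [Finset.prod_const, Finset.card_univ, Fintype.card_fin]
    rfl
  | zero => simp
  | add x y _ _ hx hy => rw [map_add, hx, hy, smul_add]
  | smul r x _ hx => rw [map_smul, hx, smul_comm]

/-- The endomorphism `x h ↦ χ(h) c ^ d x h`, `x ∈ ⋀^d W`, of the skew group algebra. -/
def skewTwistHom (c : k) (χ : H →* kˣ) : ExteriorSkew H →ₐ[k] ExteriorSkew H :=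
  skewHom (ExteriorAlgebra.map (c • LinearMap.id)) (MonoidHom.id H) χ (map_smul_id_smul c)

theorem skewTwistHom_single (c : k) (χ : H →* kˣ) (h : H) (x : ExteriorAlgebra k W) :
    skewTwistHom c χ (SkewMonoidAlgebra.single h x) = SkewMonoidAlgebra.single h
      ((χ h : k) • ExteriorAlgebra.map (c • LinearMap.id : W →ₗ[k] W) x) :=
  skewHom_single _ _ _ _ _ _

theorem skewTwistHom_skewTwistHom {c d : k} {χ ψ : H →* kˣ} (hcd : c * d = 1) (hχ : χ * ψ = 1)
    (a : ExteriorSkew H) : skewTwistHom c χ (skewTwistHom d ψ a) = a := by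
  induction a using exteriorSkew_induction with
  | h0 => simp
  | hadd x y hx hy => rw [map_add, map_add, hx, hy]
  | hs h x =>
    have h1 : (χ h : k) * (ψ h : k) = 1 := by
      rw [← Units.val_mul, ← MonoidHom.mul_apply, hχ, MonoidHom.one_apply, Units.val_one]
    rw [skewTwistHom_single, skewTwistHom_single, map_smul, smul_smul, h1, one_smul,
      map_smul_id_map_smul_id, hcd, one_smul, ExteriorAlgebra.map_id]
    rfl

/-- The automorphism `x h ↦ χ(h) c ^ d x h`, `x ∈ ⋀^d W`, of the skew group algebra. -/
def skewTwist (c : kˣ) (χ : H →* kˣ) : ExteriorSkew H ≃ₐ[k] ExteriorSkew H :=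
  AlgEquiv.ofAlgHom (skewTwistHom (c : k) χ) (skewTwistHom ((c⁻¹ : kˣ) : k) χ⁻¹)
    (AlgHom.ext fun a => skewTwistHom_skewTwistHom c.mul_inv (mul_inv_cancel χ) a)
    (AlgHom.ext fun a => skewTwistHom_skewTwistHom c.inv_mul (inv_mul_cancel χ) a)

theorem skewTwist_single (c : kˣ) (χ : H →* kˣ) (h : H) (x : ExteriorAlgebra k W) :
    skewTwist c χ (SkewMonoidAlgebra.single h x) = SkewMonoidAlgebra.single h
      ((χ h : k) • ExteriorAlgebra.map ((c : k) • LinearMap.id : W →ₗ[k] W) x) :=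
  skewTwistHom_single _ _ _ _

theorem single_mem_exteriorSkewDegree {d : ℕ} (h : H) {x : ExteriorAlgebra k W}
    (hx : x ∈ ⋀[k]^d W) : SkewMonoidAlgebra.single h x ∈ exteriorSkewDegree H d :=
  Submodule.subset_span ⟨x, hx, h, rfl⟩

theorem skewHom_mem {f : ExteriorAlgebra k W →ₐ[k] ExteriorAlgebra k W'} {g : H →* H'}
    {χ : H →* kˣ} {hfg : ∀ (h : H) (x : ExteriorAlgebra k W), f (h • x) = g h • f x} {d : ℕ}
    (hf : ∀ x ∈ ⋀[k]^d W, f x ∈ ⋀[k]^d W') {a : ExteriorSkew H}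
    (ha : a ∈ exteriorSkewDegree H d) : skewHom f g χ hfg a ∈ exteriorSkewDegree H' d := by
  induction ha using Submodule.span_induction with
  | mem a ha =>
    obtain ⟨x, hx, h, rfl⟩ := ha
    rw [skewHom_single]
    exact single_mem_exteriorSkewDegree _ (Submodule.smul_mem _ _ (hf x hx))
  | zero => rw [map_zero]; exact Submodule.zero_mem _
  | add x y _ _ hx hy => rw [map_add]; exact Submodule.add_mem _ hx hy
  | smul r x _ hx => rw [map_smul]; exact Submodule.smul_mem _ _ hx

theorem exteriorAlgebra_map_mem (f : W →ₗ[k] W') {d : ℕ} {x : ExteriorAlgebra k W}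
    (hx : x ∈ ⋀[k]^d W) : ExteriorAlgebra.map f x ∈ ⋀[k]^d W' := by
  rw [← ExteriorAlgebra.ιMulti_span_fixedDegree] at hx ⊢
  induction hx using Submodule.span_induction with
  | mem x hx =>
    obtain ⟨v, rfl⟩ := hx
    rw [ExteriorAlgebra.map_apply_ιMulti]
    exact Submodule.subset_span ⟨_, rfl⟩
  | zero => rw [map_zero]; exact Submodule.zero_mem _
  | add x y _ _ hx hy => rw [map_add]; exact Submodule.add_mem _ hx hy
  | smul r x _ hx => rw [map_smul]; exact Submodule.smul_mem _ _ hx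

theorem skewTwistHom_mem (c : k) (χ : H →* kˣ) {d : ℕ} {a : ExteriorSkew H}
    (ha : a ∈ exteriorSkewDegree H d) : skewTwistHom c χ a ∈ exteriorSkewDegree H d := by
  unfold skewTwistHom
  exact skewHom_mem (fun _ hx => exteriorAlgebra_map_mem _ hx) ha

theorem skewTwist_mem (c : kˣ) (χ : H →* kˣ) {d : ℕ} {a : ExteriorSkew H}
    (ha : a ∈ exteriorSkewDegree H d) : skewTwist c χ a ∈ exteriorSkewDegree H d :=
  skewTwistHom_mem (c : k) χ ha

theorem exteriorSkewDegree_le_eigenspace (c : k) (d : ℕ) :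
    exteriorSkewDegree H d ≤
      Module.End.eigenspace (skewTwistHom (H := H) c 1).toLinearMap (c ^ d) := by
  refine Submodule.span_le.2 ?_
  rintro _ ⟨x, hx, h, rfl⟩
  refine Module.End.mem_eigenspace_iff.2 ?_
  rw [AlgHom.toLinearMap_apply, skewTwistHom_single, map_smul_id_of_mem hx, MonoidHom.one_apply,
    Units.val_one, one_smul, SkewMonoidAlgebra.smul_single]

theorem iSup_exteriorSkewDegree : ⨆ d, exteriorSkewDegree H d = ⊤ := by
  classical
  refine eq_top_iff.2 fun a _ => ?_
  induction a using exteriorSkew_induction with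
  | h0 => exact Submodule.zero_mem _
  | hadd x y hx hy => exact Submodule.add_mem _ (hx trivial) (hy trivial)
  | hs h x =>
    rw [← DirectSum.sum_support_decompose (fun i : ℕ => ⋀[k]^i W) x]
    have : ∀ s : Finset ℕ, (SkewMonoidAlgebra.single h
        (∑ i ∈ s, (DirectSum.decompose (fun i : ℕ => ⋀[k]^i W) x i : ExteriorAlgebra k W)) :
          ExteriorSkew H) = ∑ i ∈ s, SkewMonoidAlgebra.single h
        (DirectSum.decompose (fun i : ℕ => ⋀[k]^i W) x i : ExteriorAlgebra k W) := fun s =>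
      map_sum (SkewMonoidAlgebra.singleAddHom h) _ s
    rw [this]
    exact Submodule.sum_mem _ fun i _ =>
      Submodule.mem_iSup_of_mem i (single_mem_exteriorSkewDegree h (SetLike.coe_mem _))

/-- The degree `d` part lies in the eigenspace with eigenvalue `2^d` of the endomorphism induced by
the scalar `2`; these eigenvalues are distinct in characteristic zero, so the sum is direct. -/
theorem isInternal_exteriorSkewDegree [CharZero k] :
    DirectSum.IsInternal (exteriorSkewDegree H) := by
  rw [DirectSum.isInternal_submodule_iff_iSupIndep_and_iSup_eq_top]
  refine ⟨?_, iSup_exteriorSkewDegree⟩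
  have h2 : Function.Injective fun d : ℕ => (2 : k) ^ d := fun a b hab => by
    have h3 : (((2 ^ a : ℕ)) : k) = ((2 ^ b : ℕ) : k) := by push_cast; exact hab
    exact Nat.pow_right_injective le_rfl (Nat.cast_injective h3)
  exact ((Module.End.eigenspaces_iSupIndep _).comp h2).mono
    (exteriorSkewDegree_le_eigenspace (H := H) (2 : k))

instance exteriorSkewDegree_gradedMonoid : SetLike.GradedMonoid (exteriorSkewDegree H) where
  one_mem := single_mem_exteriorSkewDegree 1 (SetLike.GradedOne.one_mem (A := fun i : ℕ => ⋀[k]^i W))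
  mul_mem i j a b ha hb := by
    induction ha using Submodule.span_induction with
    | zero => rw [zero_mul]; exact Submodule.zero_mem _
    | add x y _ _ hx hy => rw [add_mul]; exact Submodule.add_mem _ hx hy
    | smul r x _ hx => rw [smul_mul_assoc]; exact Submodule.smul_mem _ _ hx
    | mem a ha =>
      obtain ⟨x, hx, h, rfl⟩ := ha
      induction hb using Submodule.span_induction with
      | zero => rw [mul_zero]; exact Submodule.zero_mem _
      | add x y _ _ hx hy => rw [mul_add]; exact Submodule.add_mem _ hx hy
      | smul r x _ hx => rw [mul_smul_comm]; exact Submodule.smul_mem _ _ hx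
      | mem b hb =>
        obtain ⟨y, hy, g, rfl⟩ := hb
        rw [SkewMonoidAlgebra.single_mul_single]
        exact single_mem_exteriorSkewDegree _
          (SetLike.GradedMul.mul_mem (A := fun i : ℕ => ⋀[k]^i W) hx (exteriorAlgebra_map_mem _ hy))

instance exteriorSkewDegree_gradedAlgebra [CharZero k] : GradedAlgebra (exteriorSkewDegree H) where
  toDecomposition := isInternal_exteriorSkewDegree.chooseDecomposition

/-- The determinant character of a subgroup of `GL(W)`. -/
def subgroupDet (H : Subgroup (W ≃ₗ[k] W)) : H →* kˣ := LinearEquiv.det.comp H.subtype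

theorem subgroupDet_apply (h : H) :
    (subgroupDet H h : k) = LinearMap.det ((h : W ≃ₗ[k] W) : W →ₗ[k] W) :=
  LinearEquiv.coe_det _

variable [FiniteDimensional k W]

theorem exteriorSkewDegree_eq_bot {d : ℕ} (hd : Module.finrank k W < d) :
    exteriorSkewDegree H d = ⊥ := by
  refine (Submodule.span_eq_bot).2 ?_
  rintro _ ⟨x, hx, h, rfl⟩
  rw [exteriorPower_eq_bot hd, Submodule.mem_bot] at hx
  rw [hx, SkewMonoidAlgebra.single_zero]

instance [Finite H] : FiniteDimensional k (ExteriorSkew H) :=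
  Module.Finite.equiv (SkewMonoidAlgebra.coeffLinearEquiv (S := k)).symm

theorem finrank_exteriorSkew [Finite H] :
    Module.finrank k (ExteriorSkew H) = Nat.card H * 2 ^ Module.finrank k W := by
  have := Fintype.ofFinite H
  rw [(SkewMonoidAlgebra.coeffLinearEquiv (S := k)).finrank_eq,
    (Finsupp.linearEquivFunOnFinite k (ExteriorAlgebra k W) H).finrank_eq,
    Module.finrank_pi_fintype, Finset.sum_const, finrank_exteriorAlgebra, Finset.card_univ,
    smul_eq_mul, Nat.card_eq_fintype_card]

/-- The form `∑ x_h h ↦ topForm x_1` on the skew group algebra. -/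
def skewForm (H : Subgroup (W ≃ₗ[k] W)) : ExteriorSkew H →ₗ[k] k :=
  topForm k W ∘ₗ Finsupp.lapply 1 ∘ₗ
    (SkewMonoidAlgebra.coeffLinearEquiv (S := k) (k := ExteriorAlgebra k W) (G := H)).toLinearMap

theorem skewForm_apply (a : ExteriorSkew H) : skewForm H a = topForm k W (a.coeff 1) := rfl

/-- Everything reduces to `⋀W` by comparing coefficients at `1`. The twist combines the sign of
`topForm_mul_comm` with the factor `det h` by which `h` scales the top degree. -/
theorem isGradedFrobenius_skewForm :
    IsGradedFrobenius (exteriorSkewDegree H) (Module.finrank k W) (skewForm H)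
      (skewTwist (topSign k W) (subgroupDet H)) where
  nondegenerate a ha := by
    refine SkewMonoidAlgebra.ext fun h => ?_
    rw [SkewMonoidAlgebra.coeff_zero, Finsupp.zero_apply]
    have h1 : h⁻¹ • a.coeff h = 0 := by
      refine topForm_nondegenerate fun y => ?_
      -- The coefficient of `(y h⁻¹) a` at `1` is `y · h⁻¹(a_h)`, which isolates `a_h`.
      have h2 := ha (SkewMonoidAlgebra.single h⁻¹ y)
      rwa [skewForm_apply, SkewMonoidAlgebra.coeff_single_mul, inv_inv, mul_one] at h2
    exact (smul_eq_zero_iff_eq _).1 h1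
  nakayama a b := by
    induction a using exteriorSkew_induction with
    | h0 => simp
    | hadd x y hx hy => simp only [map_add, mul_add, add_mul, hx, hy]
    | hs h x =>
      rw [skewTwist_single, skewForm_apply, skewForm_apply, SkewMonoidAlgebra.coeff_single_mul,
        SkewMonoidAlgebra.coeff_mul_single, mul_one, one_mul, topForm_mul_comm, smul_comm,
        mul_smul_comm, map_smul]
      set z := b.coeff h⁻¹
      set x' := ExteriorAlgebra.map ((topSign k W : k) • LinearMap.id : W →ₗ[k] W) x
      -- Pulling out `h` costs the factor `det h` in the top form, which is the character in the
      -- Nakayama automorphism.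
      have h1 : h • z * x' = h • (z * h⁻¹ • x') := by rw [smul_mul', smul_inv_smul]
      rw [h1, subgroup_smul_eq, topForm_map, smul_eq_mul, subgroupDet_apply]
  eq_zero d hd a ha := by
    induction ha using Submodule.span_induction with
    | mem a ha =>
      classical
      obtain ⟨x, hx, h, rfl⟩ := ha
      rw [skewForm_apply, SkewMonoidAlgebra.coeff_single_apply]
      split_ifs
      · exact topForm_of_mem hd hx
      · exact map_zero _
    | zero => exact map_zero _
    | add x y _ _ hx hy => rw [map_add, hx, hy, add_zero]
    | smul c x _ hx => rw [map_smul, hx, smul_zero]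
  map_mem _ _ ha := skewTwist_mem _ _ ha

end SkewHom

/-! ### Eigenspace idempotents of an element with `c ^ m = 1` -/

section RootIdempotent

variable {k : Type*} [Field k] {R : Type*} [Ring R] [Algebra k R] {m : ℕ} {ξ : kˣ}

/-- The power `ξ ^ (-t)` of an `m`-th root of unity, for `t ∈ ℤ/m`. -/
def rootPow (ξ : kˣ) (t : ZMod m) : kˣ := (ξ⁻¹) ^ t.val

theorem rootPow_pow (hξ : ξ ^ m = 1) (t : ZMod m) : rootPow ξ t ^ m = 1 := by
  rw [rootPow, ← pow_mul, mul_comm, pow_mul, inv_pow, hξ, inv_one, one_pow]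

/-- The idempotent that projects onto the eigenspace of `c`, `c ^ m = 1`, with eigenvalue
`ξ ^ t`. -/
def rootIdempotent (ξ : kˣ) (c : R) (t : ZMod m) : R :=
  (m : k)⁻¹ • ∑ a ∈ Finset.range m, (rootPow ξ t : k) ^ a • c ^ a

theorem commute_rootIdempotent {c a : R} (h : Commute c a) (t : ZMod m) :
    Commute (rootIdempotent ξ c t) a :=
  (Commute.sum_left _ _ _ fun i _ => (h.pow_left i).smul_left _).smul_left _

/-- Multiplying by `ξ^{-t} c` permutes the summands cyclically: the term with exponent `m` is again
the one with exponent `0`. -/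
theorem mul_rootIdempotent (hξ : ξ ^ m = 1) {c : R} (hc : c ^ m = 1) (t : ZMod m) :
    (rootPow ξ t : k) • (c * rootIdempotent ξ c t) = rootIdempotent ξ c t := by
  rw [rootIdempotent, mul_smul_comm, smul_comm, Finset.mul_sum, Finset.smul_sum]
  congr 1
  have h1 : ∀ a : ℕ, (rootPow ξ t : k) • (c * (rootPow ξ t : k) ^ a • c ^ a) =
      (rootPow ξ t : k) ^ (a + 1) • c ^ (a + 1) := fun a => by
    rw [mul_smul_comm, smul_smul, ← pow_succ', ← pow_succ']
  simp only [h1]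
  have h2 := Finset.sum_range_succ (fun a : ℕ => (rootPow ξ t : k) ^ a • c ^ a) m
  rw [Finset.sum_range_succ', ← Units.val_pow_eq_pow_val _ m, rootPow_pow hξ, hc, pow_zero,
    pow_zero, Units.val_one] at h2
  exact add_right_cancel h2

theorem pow_mul_rootIdempotent (hξ : ξ ^ m = 1) {c : R} (hc : c ^ m = 1) (t : ZMod m) (a : ℕ) :
    c ^ a * rootIdempotent ξ c t = (((rootPow ξ t)⁻¹ : kˣ) : k) ^ a • rootIdempotent ξ c t := by
  have h1 : c * rootIdempotent ξ c t =
      (((rootPow ξ t)⁻¹ : kˣ) : k) • rootIdempotent ξ c t := by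
    nth_rw 2 [← mul_rootIdempotent hξ hc t]
    rw [smul_smul, Units.inv_mul, one_smul]
  induction a with
  | zero => simp
  | succ a ih => rw [pow_succ, mul_assoc, h1, mul_smul_comm, ih, smul_smul, pow_succ']

variable [NeZero m]

theorem rootPow_add_one (hξ : ξ ^ m = 1) (t : ZMod m) :
    rootPow ξ (t + 1) = ξ⁻¹ * rootPow ξ t := by
  have h : (ξ⁻¹) ^ m = 1 := by rw [inv_pow, hξ, inv_one]
  have hmod : ∀ n : ℕ, (ξ⁻¹) ^ (n % m) = (ξ⁻¹) ^ n := fun n => (pow_eq_pow_mod n h).symm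
  rw [rootPow, rootPow, ZMod.val_add, ZMod.val_one_eq_one_mod, hmod, pow_add, hmod, pow_one,
    mul_comm]

theorem rootPow_injective (hξ : IsPrimitiveRoot ξ m) :
    Function.Injective (rootPow (m := m) ξ) := fun s t h => by
  refine ZMod.val_injective m (hξ.inv.pow_inj (ZMod.val_lt s) (ZMod.val_lt t) h)

/-- The substitution `t ↦ t + 1` multiplies the sum by `ξ^{-a} ≠ 1`. -/
theorem sum_rootPow_pow (hξ : IsPrimitiveRoot ξ m) {a : ℕ} (ha0 : a ≠ 0) (ha : a < m) :
    ∑ t : ZMod m, (rootPow ξ t : k) ^ a = 0 := by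
  have h1 : ∑ t : ZMod m, (rootPow ξ t : k) ^ a =
      ((ξ⁻¹ : kˣ) : k) ^ a * ∑ t : ZMod m, (rootPow ξ t : k) ^ a := by
    rw [Finset.mul_sum, ← Equiv.sum_comp (Equiv.addRight (1 : ZMod m))]
    refine Finset.sum_congr rfl fun t _ => ?_
    rw [Equiv.coe_addRight, rootPow_add_one hξ.pow_eq_one, Units.val_mul, mul_pow]
  by_contra h
  refine hξ.inv.pow_ne_one_of_pos_of_lt ha0 ha (Units.ext ?_)
  rw [Units.val_pow_eq_pow_val, Units.val_one]
  exact mul_right_cancel₀ h (h1.symm.trans (one_mul _).symm)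

/-- As `c` acts on `ε_t` by `ξ^t`, the product `ε_s ε_t` is `ε_t` times an averaged geometric sum in
`ξ^{t-s}`. In `∑ ε_t` only the power `c^0` survives. -/
theorem completeOrthogonalIdempotents_rootIdempotent [CharZero k] (hξ : IsPrimitiveRoot ξ m)
    {c : R} (hc : c ^ m = 1) :
    CompleteOrthogonalIdempotents (rootIdempotent (m := m) ξ c) := by
  have hm : (m : k) ≠ 0 := Nat.cast_ne_zero.2 (NeZero.ne m)
  have hmul : ∀ s t : ZMod m, rootIdempotent ξ c s * rootIdempotent ξ c t =
      ((m : k)⁻¹ * ∑ a ∈ Finset.range m, ((rootPow ξ s * (rootPow ξ t)⁻¹ : kˣ) : k) ^ a) •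
        rootIdempotent ξ c t := fun s t => by
    nth_rw 1 [rootIdempotent]
    rw [smul_mul_assoc, Finset.sum_mul, mul_smul, Finset.sum_smul]
    congr 1
    refine Finset.sum_congr rfl fun a _ => ?_
    rw [smul_mul_assoc, pow_mul_rootIdempotent hξ.pow_eq_one hc, smul_smul, ← mul_pow,
      Units.val_mul]
  refine ⟨⟨fun t => ?_, fun s t hst => ?_⟩, ?_⟩
  · rw [IsIdempotentElem, hmul, mul_inv_cancel]
    simp [hm]
  · have h1 : rootPow ξ s * (rootPow ξ t)⁻¹ ≠ 1 := fun h =>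
      hst (rootPow_injective hξ (mul_inv_eq_one.1 h))
    have h2 : ((rootPow ξ s * (rootPow ξ t)⁻¹ : kˣ) : k) - 1 ≠ 0 := fun h =>
      h1 (Units.ext (sub_eq_zero.1 h))
    have h3 := mul_geom_sum ((rootPow ξ s * (rootPow ξ t)⁻¹ : kˣ) : k) m
    rw [← Units.val_pow_eq_pow_val, mul_pow, inv_pow, rootPow_pow hξ.pow_eq_one,
      rootPow_pow hξ.pow_eq_one, inv_one, mul_one, Units.val_one, sub_self] at h3
    change rootIdempotent ξ c s * rootIdempotent ξ c t = 0
    rw [hmul, (mul_eq_zero.1 h3).resolve_left h2, mul_zero, zero_smul]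
  · simp only [rootIdempotent]
    rw [← Finset.smul_sum, Finset.sum_comm]
    simp only [← Finset.sum_smul]
    rw [Finset.sum_eq_single 0]
    · simp [hm, ZMod.card]
    · intro a ha ha0
      rw [sum_rootPow_pow hξ ha0 (Finset.mem_range.1 ha), zero_smul]
    · intro h
      exact absurd (Finset.mem_range.2 (NeZero.pos m)) h

/-- `c y = ξ y c` means that `y` carries the eigenvalue `ξ^t` to `ξ^{t+1}`; hence the connecting
arrows raise the index by one. -/
theorem mul_rootIdempotent_of_mul (hξ : ξ ^ m = 1) {c y : R} (hcy : c * y = (ξ : k) • (y * c))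
    (t : ZMod m) : y * rootIdempotent ξ c t = rootIdempotent ξ c (t + 1) * y := by
  have h1 : y * c = ((ξ⁻¹ : kˣ) : k) • (c * y) := by
    rw [hcy, smul_smul, Units.inv_mul, one_smul]
  have h2 : ∀ a : ℕ, y * c ^ a = ((ξ⁻¹ : kˣ) : k) ^ a • (c ^ a * y) := fun a => by
    induction a with
    | zero => simp
    | succ a ih =>
      rw [pow_succ', ← mul_assoc, h1, smul_mul_assoc, mul_assoc, ih, mul_smul_comm, smul_smul,
        ← mul_assoc, ← pow_succ', ← pow_succ']
  rw [rootIdempotent, rootIdempotent, mul_smul_comm, smul_mul_assoc, Finset.mul_sum,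
    Finset.sum_mul]
  congr 1
  refine Finset.sum_congr rfl fun a _ => ?_
  rw [mul_smul_comm, h2, smul_smul, smul_mul_assoc, rootPow_add_one hξ, Units.val_mul, mul_pow,
    mul_comm]

/-- Replacing `c` by `ξ c` turns the coefficient `ξ^{-t a}` into `ξ^{-(t-1) a}`. For the Nakayama
automorphism of the extension this is the translation `t ↦ t - 1`. -/
theorem map_rootIdempotent (hξ : ξ ^ m = 1) {c : R} {σ : R ≃ₐ[k] R} (hσ : σ c = (ξ : k) • c)
    (t : ZMod m) : σ (rootIdempotent ξ c t) = rootIdempotent ξ c (t - 1) := by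
  have h1 : (rootPow ξ (t - 1) : k) = rootPow ξ t * ξ := by
    have h2 := rootPow_add_one hξ (t - 1)
    rw [sub_add_cancel] at h2
    rw [h2, Units.val_mul, mul_right_comm, Units.inv_mul, one_mul]
  rw [rootIdempotent, rootIdempotent, map_smul, map_sum]
  congr 1
  refine Finset.sum_congr rfl fun a _ => ?_
  rw [map_smul, map_pow, hσ, smul_pow, smul_smul, ← mul_pow, h1]

end RootIdempotent

/-! ### The group `G̃` and its determinant character -/

section CyclicGroup

variable {k : Type*} [Field k] {V : Type*} [AddCommGroup V] [Module k V]
  {G : Subgroup (V ≃ₗ[k] V)} {ξ : kˣ} {m : ℕ}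

/-- The embedding of `G` into its cyclic extension. -/
def toCyclicExtension (G : Subgroup (V ≃ₗ[k] V)) (ξ : kˣ) : G →* cyclicExtension G ξ :=
  (detEmbedding.comp G.subtype).codRestrict _ fun g =>
    Subgroup.mem_sup_left ⟨g, g.2, rfl⟩

/-- The generator `diag(1, …, 1, ξ)` as an element of the cyclic extension. -/
def cyclicGenerator (G : Subgroup (V ≃ₗ[k] V)) (ξ : kˣ) : cyclicExtension G ξ :=
  ⟨lastScaling V ξ, Subgroup.mem_sup_right (Subgroup.mem_zpowers _)⟩

theorem toCyclicExtension_apply (g : G) (x : V × k) :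
    (toCyclicExtension G ξ g : (V × k) ≃ₗ[k] (V × k)) x =
      ((g : V ≃ₗ[k] V) x.1, (((LinearEquiv.det (g : V ≃ₗ[k] V))⁻¹ : kˣ) : k) • x.2) := rfl

theorem lastScaling_pow_apply (n : ℕ) (x : V × k) :
    (lastScaling V ξ ^ n) x = (x.1, ((ξ ^ n : kˣ) : k) • x.2) := by
  induction n with
  | zero => simp
  | succ n ih =>
    rw [pow_succ', LinearEquiv.mul_apply, ih, pow_succ', Units.val_mul, mul_smul]
    rfl

theorem cyclicGenerator_pow_apply (n : ℕ) (x : V × k) :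
    ((cyclicGenerator G ξ ^ n : cyclicExtension G ξ) : (V × k) ≃ₗ[k] (V × k)) x =
      (x.1, ((ξ ^ n : kˣ) : k) • x.2) :=
  lastScaling_pow_apply n x

theorem cyclicGenerator_pow (hξ : ξ ^ m = 1) : cyclicGenerator G ξ ^ m = 1 := by
  refine Subtype.ext (LinearEquiv.ext fun x => ?_)
  rw [cyclicGenerator_pow_apply, hξ, Units.val_one, one_smul]
  rfl

theorem commute_lastScaling (g : V ≃ₗ[k] V) : Commute (detEmbedding g) (lastScaling V ξ) := by
  refine LinearEquiv.ext fun x => Prod.ext rfl ?_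
  exact smul_comm ((LinearEquiv.det g)⁻¹ : kˣ) ξ x.2

theorem commute_cyclicGenerator (g : G) :
    Commute (toCyclicExtension G ξ g) (cyclicGenerator G ξ) :=
  Subtype.ext (commute_lastScaling (g : V ≃ₗ[k] V))

theorem exists_eq_mul_pow [NeZero m] (hξ : ξ ^ m = 1) (h : cyclicExtension G ξ) :
    ∃ g : G, ∃ n < m, h = toCyclicExtension G ξ g * cyclicGenerator G ξ ^ n := by
  have hcomm : ∀ (g : G) (z : Multiplicative ℤ),
      Commute ((detEmbedding.comp G.subtype) g) (zpowersHom _ (lastScaling V ξ) z) :=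
    fun g z => (commute_lastScaling (g : V ≃ₗ[k] V)).zpow_right _
  -- `G'` and the scaling commute, so the subgroup they generate is the image of the direct product.
  have hr : (MonoidHom.noncommCoprod _ _ hcomm).range = cyclicExtension G ξ := by
    rw [MonoidHom.noncommCoprod_range, MonoidHom.range_comp, Subgroup.range_subtype]
    rfl
  obtain ⟨h, hh⟩ := h
  have hh' := hh
  rw [← hr] at hh'
  obtain ⟨⟨g, z⟩, hz⟩ := hh'
  have hm : (0 : ℤ) < m := Nat.cast_pos.2 (NeZero.pos m)
  refine ⟨g, (z.toAdd % m).toNat, ?_, Subtype.ext ?_⟩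
  · exact (Int.toNat_lt (Int.emod_nonneg _ hm.ne')).2 (Int.emod_lt_of_pos _ hm)
  · have h1 : (lastScaling V ξ) ^ (m : ℤ) = 1 := by
      rw [zpow_natCast]
      exact congrArg Subtype.val (cyclicGenerator_pow (G := G) hξ)
    have h2 : (lastScaling V ξ) ^ z.toAdd = (lastScaling V ξ) ^ (z.toAdd % m).toNat := by
      rw [zpow_eq_zpow_emod _ h1, ← zpow_natCast, Int.toNat_of_nonneg (Int.emod_nonneg _ hm.ne')]
    refine hz.symm.trans ((MonoidHom.noncommCoprod_apply _ _ _ _).trans ?_)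
    exact congrArg (fun w => detEmbedding (g : V ≃ₗ[k] V) * w) h2

/-- The component in `V` recovers `g`; then the image of `(0, 1)` recovers `ξ^n`, hence `n < m`.
Consequently `|G̃| = m |G|`. -/
theorem bijective_mul_pow [NeZero m] (hξ : IsPrimitiveRoot ξ m) :
    Function.Bijective fun x : G × Fin m =>
      toCyclicExtension G ξ x.1 * cyclicGenerator G ξ ^ (x.2 : ℕ) := by
  refine ⟨?_, fun h => ?_⟩
  · rintro ⟨g, n⟩ ⟨g', n'⟩ h
    have hv : ∀ x : V × k, _ = _ := fun x =>
      congrArg (fun w : cyclicExtension G ξ => (w : (V × k) ≃ₗ[k] (V × k)) x) h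
    simp only [Subgroup.coe_mul, LinearEquiv.mul_apply, cyclicGenerator_pow_apply,
      toCyclicExtension_apply] at hv
    have hg : g = g' := by
      refine Subtype.ext (LinearEquiv.ext fun v => ?_)
      exact congrArg Prod.fst (hv (v, 0))
    subst hg
    have h2 := congrArg Prod.snd (hv (0, 1))
    simp only [smul_eq_mul, mul_one] at h2
    have h3 : ξ ^ (n : ℕ) = ξ ^ (n' : ℕ) := Units.ext (mul_left_cancel₀ (Units.ne_zero _) h2)
    rw [Fin.ext (hξ.pow_inj n.2 n'.2 h3)]
  · obtain ⟨g, n, hn, rfl⟩ := exists_eq_mul_pow hξ.pow_eq_one h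
    exact ⟨(g, ⟨n, hn⟩), rfl⟩

theorem finite_cyclicExtension [Finite G] [NeZero m] (hξ : IsPrimitiveRoot ξ m) :
    Finite (cyclicExtension G ξ) :=
  Finite.of_surjective _ (bijective_mul_pow (G := G) hξ).2

theorem card_cyclicExtension [NeZero m] (hξ : IsPrimitiveRoot ξ m) :
    Nat.card (cyclicExtension G ξ) = Nat.card G * m := by
  rw [← Nat.card_congr (Equiv.ofBijective _ (bijective_mul_pow (G := G) hξ)), Nat.card_prod,
    Nat.card_fin]

variable [FiniteDimensional k V]

theorem subgroupDet_toCyclicExtension (g : G) :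
    subgroupDet (cyclicExtension G ξ) (toCyclicExtension G ξ g) = 1 := by
  refine Units.ext ?_
  rw [subgroupDet_apply]
  have h1 : (((toCyclicExtension G ξ g : (V × k) ≃ₗ[k] (V × k))) : (V × k) →ₗ[k] (V × k)) =
      LinearMap.prodMap ((g : V ≃ₗ[k] V) : V →ₗ[k] V)
        ((((LinearEquiv.det (g : V ≃ₗ[k] V))⁻¹ : kˣ) : k) • LinearMap.id) := rfl
  rw [h1, LinearMap.det_prodMap, LinearMap.det_smul, LinearMap.det_id, Module.finrank_self,
    pow_one, mul_one, ← LinearEquiv.coe_det, Units.mul_inv, Units.val_one]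

theorem subgroupDet_cyclicGenerator :
    subgroupDet (cyclicExtension G ξ) (cyclicGenerator G ξ) = ξ := by
  refine Units.ext ?_
  rw [subgroupDet_apply]
  have h1 : (((cyclicGenerator G ξ : (V × k) ≃ₗ[k] (V × k))) : (V × k) →ₗ[k] (V × k)) =
      LinearMap.prodMap LinearMap.id ((ξ : k) • LinearMap.id) := rfl
  rw [h1, LinearMap.det_prodMap, LinearMap.det_smul, LinearMap.det_id, LinearMap.det_id,
    Module.finrank_self, pow_one, mul_one, one_mul]

end CyclicGroup

/-! ### The skew group algebra of `G̃` as a cyclic extension -/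

section CyclicSkew

variable {k : Type*} [Field k] {V : Type*} [AddCommGroup V] [Module k V]
  {G : Subgroup (V ≃ₗ[k] V)} {ξ : kˣ} {m : ℕ}

/-- The embedding of `⋀V * G` into the skew group algebra of the cyclic extension. -/
def cyclicSkewHom (G : Subgroup (V ≃ₗ[k] V)) (ξ : kˣ) :
    ExteriorSkew G →ₐ[k] ExteriorSkew (cyclicExtension G ξ) :=
  skewHom (ExteriorAlgebra.map (LinearMap.inl k V k)) (toCyclicExtension G ξ) 1 fun g x => by
    rw [subgroup_smul_eq, subgroup_smul_eq, ← AlgHom.comp_apply, ← AlgHom.comp_apply,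
      ExteriorAlgebra.map_comp_map, ExteriorAlgebra.map_comp_map]
    congr 2
    refine LinearMap.ext fun v => Prod.ext rfl ?_
    exact (smul_zero (A := k) ((LinearEquiv.det (g : V ≃ₗ[k] V))⁻¹ : kˣ)).symm

theorem cyclicSkewHom_single (g : G) (x : ExteriorAlgebra k V) :
    cyclicSkewHom G ξ (SkewMonoidAlgebra.single g x) = SkewMonoidAlgebra.single
      (toCyclicExtension G ξ g) (ExteriorAlgebra.map (LinearMap.inl k V k) x) := by
  rw [cyclicSkewHom, skewHom_single, MonoidHom.one_apply, Units.val_one, one_smul]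

/-- The generator `diag(1, …, 1, ξ)` as an element of the skew group algebra. -/
def skewGenerator (G : Subgroup (V ≃ₗ[k] V)) (ξ : kˣ) : ExteriorSkew (cyclicExtension G ξ) :=
  SkewMonoidAlgebra.single (cyclicGenerator G ξ) 1

/-- The last basis vector of `V ⊕ k` as an element of the skew group algebra. -/
def lastVector (G : Subgroup (V ≃ₗ[k] V)) (ξ : kˣ) : ExteriorSkew (cyclicExtension G ξ) :=
  SkewMonoidAlgebra.single 1 (ExteriorAlgebra.ι k (0, 1))

theorem skewGenerator_pow (n : ℕ) :
    skewGenerator G ξ ^ n = SkewMonoidAlgebra.single (cyclicGenerator G ξ ^ n) 1 := by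
  induction n with
  | zero => rw [pow_zero, pow_zero]; rfl
  | succ n ih =>
    rw [pow_succ, ih, skewGenerator, SkewMonoidAlgebra.single_mul_single, smul_one, mul_one,
      ← pow_succ]

theorem commute_skewGenerator (a : ExteriorSkew G) :
    Commute (skewGenerator G ξ) (cyclicSkewHom G ξ a) := by
  induction a using exteriorSkew_induction with
  | h0 => rw [map_zero]; exact Commute.zero_right _
  | hadd x y hx hy => rw [map_add]; exact hx.add_right hy
  | hs g x =>
    have h1 : cyclicGenerator G ξ • ExteriorAlgebra.map (LinearMap.inl k V k) x =
        ExteriorAlgebra.map (LinearMap.inl k V k) x := by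
      rw [subgroup_smul_eq, ← AlgHom.comp_apply, ExteriorAlgebra.map_comp_map]
      congr 2
      refine LinearMap.ext fun v => Prod.ext rfl ?_
      exact smul_zero (A := k) ξ
    rw [Commute, SemiconjBy, cyclicSkewHom_single, skewGenerator,
      SkewMonoidAlgebra.single_mul_single, SkewMonoidAlgebra.single_mul_single, smul_one, mul_one,
      one_mul, h1, (commute_cyclicGenerator g).eq]

theorem skewGenerator_mul_lastVector :
    skewGenerator G ξ * lastVector G ξ = (ξ : k) • (lastVector G ξ * skewGenerator G ξ) := by
  have h1 : cyclicGenerator G ξ • ExteriorAlgebra.ι k ((0, 1) : V × k) =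
      (ξ : k) • ExteriorAlgebra.ι k ((0, 1) : V × k) := by
    rw [subgroup_smul_eq, ExteriorAlgebra.map_apply_ι, ← map_smul]
    congr 1
    exact Prod.ext (smul_zero _).symm rfl
  rw [skewGenerator, lastVector, SkewMonoidAlgebra.single_mul_single,
    SkewMonoidAlgebra.single_mul_single, h1, one_mul, smul_one, mul_one, mul_one, one_mul,
    SkewMonoidAlgebra.smul_single]

theorem lastVector_mul_self : lastVector G ξ * lastVector G ξ = 0 := by
  rw [lastVector, SkewMonoidAlgebra.single_mul_single, one_smul, ExteriorAlgebra.ι_sq_zero,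
    SkewMonoidAlgebra.single_zero]

theorem map_inl_map_neg (x : ExteriorAlgebra k V) :
    ExteriorAlgebra.map (LinearMap.inl k V k)
        (ExteriorAlgebra.map (((-1 : kˣ) : k) • LinearMap.id : V →ₗ[k] V) x) =
      ExteriorAlgebra.map (-LinearMap.id : V × k →ₗ[k] V × k)
        (ExteriorAlgebra.map (LinearMap.inl k V k) x) := by
  rw [← AlgHom.comp_apply, ← AlgHom.comp_apply, ExteriorAlgebra.map_comp_map,
    ExteriorAlgebra.map_comp_map, Units.val_neg, Units.val_one, neg_one_smul, LinearMap.comp_neg,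
    LinearMap.neg_comp, LinearMap.comp_id, LinearMap.id_comp]

/-- Passing `x` of degree `d` costs `(-1)^d`, and passing `g'` costs `det g`, because `g'` scales
the last vector by `det(g)⁻¹`. -/
theorem lastVector_mul_map (a : ExteriorSkew G) :
    lastVector G ξ * cyclicSkewHom G ξ a =
      cyclicSkewHom G ξ (skewTwist (-1) (subgroupDet G) a) * lastVector G ξ := by
  induction a using exteriorSkew_induction with
  | h0 => simp
  | hadd x y hx hy => simp only [map_add, mul_add, add_mul, hx, hy]
  | hs g x =>
    have h1 : toCyclicExtension G ξ g • ExteriorAlgebra.ι k ((0, 1) : V × k) =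
        (((subgroupDet G g)⁻¹ : kˣ) : k) • ExteriorAlgebra.ι k ((0, 1) : V × k) := by
      rw [subgroup_smul_eq, ExteriorAlgebra.map_apply_ι, ← map_smul]
      congr 1
      exact Prod.ext ((map_zero (g : V ≃ₗ[k] V)).trans (smul_zero _).symm) rfl
    rw [skewTwist_single, cyclicSkewHom_single, cyclicSkewHom_single, lastVector,
      SkewMonoidAlgebra.single_mul_single, SkewMonoidAlgebra.single_mul_single, h1, one_smul,
      one_mul, mul_one, map_smul, smul_mul_smul_comm, Units.mul_inv, one_smul, map_inl_map_neg,
      ι_mul_eq_map_neg_mul_ι]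

theorem cyclicSkewHom_mem {d : ℕ} {a : ExteriorSkew G} (ha : a ∈ exteriorSkewDegree G d) :
    cyclicSkewHom G ξ a ∈ exteriorSkewDegree (cyclicExtension G ξ) d := by
  unfold cyclicSkewHom
  exact skewHom_mem (fun _ hx => exteriorAlgebra_map_mem _ hx) ha

theorem lastVector_mem : lastVector G ξ ∈ exteriorSkewDegree (cyclicExtension G ξ) 1 := by
  refine single_mem_exteriorSkewDegree _ ?_
  exact (pow_one (LinearMap.range (ExteriorAlgebra.ι k (M := V × k)))).ge ⟨_, rfl⟩

theorem rootIdempotent_skewGenerator_mem (t : ZMod m) :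
    rootIdempotent ξ (skewGenerator G ξ) t ∈ exteriorSkewDegree (cyclicExtension G ξ) 0 := by
  refine Submodule.smul_mem _ _ (Submodule.sum_mem _ fun a _ => Submodule.smul_mem _ _ ?_)
  rw [skewGenerator_pow]
  exact single_mem_exteriorSkewDegree _
    (SetLike.GradedOne.one_mem (A := fun i : ℕ => ⋀[k]^i (V × k)))

theorem skewGenerator_pow_eq_one (hξ : ξ ^ m = 1) : skewGenerator G ξ ^ m = 1 := by
  rw [skewGenerator_pow, cyclicGenerator_pow hξ]
  rfl

variable [NeZero m]

/-- The map `(a, b) ↦ ∑ t, (a_t + b_t y) ε_t`. -/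
def cyclicSkewSum (G : Subgroup (V ≃ₗ[k] V)) (ξ : kˣ) (m : ℕ) [NeZero m] :
    (ZMod m → ExteriorSkew G) × (ZMod m → ExteriorSkew G) →ₗ[k]
      ExteriorSkew (cyclicExtension G ξ) where
  toFun x := ∑ t, (cyclicSkewHom G ξ (x.1 t) * rootIdempotent ξ (skewGenerator G ξ) t +
    cyclicSkewHom G ξ (x.2 t) * lastVector G ξ * rootIdempotent ξ (skewGenerator G ξ) t)
  map_add' x y := by
    rw [← Finset.sum_add_distrib]
    refine Finset.sum_congr rfl fun t _ => ?_
    simp only [Prod.fst_add, Prod.snd_add, Pi.add_apply, map_add, add_mul]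
    abel
  map_smul' c x := by
    rw [RingHom.id_apply, Finset.smul_sum]
    refine Finset.sum_congr rfl fun t _ => ?_
    simp only [Prod.smul_fst, Prod.smul_snd, Pi.smul_apply, map_smul, smul_mul_assoc, smul_add]

theorem cyclicSkewSum_apply (a b : ZMod m → ExteriorSkew G) :
    cyclicSkewSum G ξ m (a, b) =
      ∑ t, (cyclicSkewHom G ξ (a t) * rootIdempotent ξ (skewGenerator G ξ) t +
        cyclicSkewHom G ξ (b t) * lastVector G ξ * rootIdempotent ξ (skewGenerator G ξ) t) := rfl

theorem map_mul_mem_range (a : ExteriorSkew G) {r : ExteriorSkew (cyclicExtension G ξ)}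
    (hr : r ∈ LinearMap.range (cyclicSkewSum G ξ m)) :
    cyclicSkewHom G ξ a * r ∈ LinearMap.range (cyclicSkewSum G ξ m) := by
  obtain ⟨⟨x, y⟩, rfl⟩ := hr
  refine ⟨(fun t => a * x t, fun t => a * y t), ?_⟩
  rw [cyclicSkewSum_apply, cyclicSkewSum_apply, Finset.mul_sum]
  refine Finset.sum_congr rfl fun t _ => ?_
  simp only [map_mul, mul_add, mul_assoc]

theorem lastVector_mul_mem_range {r : ExteriorSkew (cyclicExtension G ξ)}
    (hr : r ∈ LinearMap.range (cyclicSkewSum G ξ m)) :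
    lastVector G ξ * r ∈ LinearMap.range (cyclicSkewSum G ξ m) := by
  obtain ⟨⟨x, y⟩, rfl⟩ := hr
  -- `y (a + b y) ε_t = τ(a) y ε_t`, as `y² = 0`.
  refine ⟨(0, fun t => skewTwist (-1) (subgroupDet G) (x t)), ?_⟩
  rw [cyclicSkewSum_apply, cyclicSkewSum_apply, Finset.mul_sum]
  refine Finset.sum_congr rfl fun t _ => ?_
  rw [Pi.zero_apply, map_zero, zero_mul, zero_add, mul_add, ← mul_assoc, ← mul_assoc, ← mul_assoc,
    lastVector_mul_map, lastVector_mul_map, mul_assoc _ (lastVector G ξ) (lastVector G ξ),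
    lastVector_mul_self, mul_zero, zero_mul, add_zero]

theorem skewGenerator_mul_mem_range (hξ : ξ ^ m = 1) {r : ExteriorSkew (cyclicExtension G ξ)}
    (hr : r ∈ LinearMap.range (cyclicSkewSum G ξ m)) :
    skewGenerator G ξ * r ∈ LinearMap.range (cyclicSkewSum G ξ m) := by
  obtain ⟨⟨x, y⟩, rfl⟩ := hr
  -- `c` acts on `ε_t` by `ξ^t`, the inverse of `rootPow ξ t`; passing `y` contributes a further
  -- `ξ`.
  refine ⟨(fun t => (((rootPow ξ t)⁻¹ : kˣ) : k) • x t,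
    fun t => ((((rootPow ξ t)⁻¹ : kˣ) : k) * ξ) • y t), ?_⟩
  rw [cyclicSkewSum_apply, cyclicSkewSum_apply, Finset.mul_sum]
  refine Finset.sum_congr rfl fun t _ => ?_
  have h1 := pow_mul_rootIdempotent hξ (skewGenerator_pow_eq_one (G := G) hξ) t 1
  rw [pow_one, pow_one] at h1
  have hx : skewGenerator G ξ * (cyclicSkewHom G ξ (x t) *
      rootIdempotent ξ (skewGenerator G ξ) t) = (((rootPow ξ t)⁻¹ : kˣ) : k) •
        (cyclicSkewHom G ξ (x t) * rootIdempotent ξ (skewGenerator G ξ) t) := by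
    rw [← mul_assoc, (commute_skewGenerator (x t)).eq, mul_assoc, h1, mul_smul_comm]
  have hy : skewGenerator G ξ * (cyclicSkewHom G ξ (y t) * lastVector G ξ *
      rootIdempotent ξ (skewGenerator G ξ) t) = ((((rootPow ξ t)⁻¹ : kˣ) : k) * ξ) •
        (cyclicSkewHom G ξ (y t) * lastVector G ξ *
          rootIdempotent ξ (skewGenerator G ξ) t) := by
    rw [← mul_assoc, ← mul_assoc, (commute_skewGenerator (y t)).eq,
      mul_assoc _ (skewGenerator G ξ) (lastVector G ξ), skewGenerator_mul_lastVector,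
      mul_smul_comm, smul_mul_assoc, ← mul_assoc, mul_assoc _ (skewGenerator G ξ), h1,
      mul_smul_comm, smul_smul, mul_comm]
  rw [mul_add, hx, hy]
  simp only [map_smul, smul_mul_assoc]

theorem single_one_mul_mem_range (x : ExteriorAlgebra k (V × k))
    {r : ExteriorSkew (cyclicExtension G ξ)} (hr : r ∈ LinearMap.range (cyclicSkewSum G ξ m)) :
    exteriorToSkew _ x * r ∈ LinearMap.range (cyclicSkewSum G ξ m) := by
  induction x using ExteriorAlgebra.induction generalizing r with
  | algebraMap c =>
    rw [AlgHom.commutes, ← Algebra.smul_def]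
    exact Submodule.smul_mem _ _ hr
  | ι v =>
    have h1 : exteriorToSkew (cyclicExtension G ξ) (ExteriorAlgebra.ι k v) =
        cyclicSkewHom G ξ (SkewMonoidAlgebra.single 1 (ExteriorAlgebra.ι k v.1)) +
          v.2 • lastVector G ξ := by
      have h2 : v = (v.1, 0) + v.2 • ((0, 1) : V × k) := by simp
      rw [cyclicSkewHom_single, map_one, ExteriorAlgebra.map_apply_ι, LinearMap.inl_apply,
        lastVector, ← exteriorToSkew_apply, ← exteriorToSkew_apply, ← map_smul, ← map_smul,
        ← map_add, ← map_add, ← h2]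
    rw [h1, add_mul, smul_mul_assoc]
    exact Submodule.add_mem _ (map_mul_mem_range _ hr)
      (Submodule.smul_mem _ _ (lastVector_mul_mem_range hr))
  | mul x y hx hy => rw [map_mul, mul_assoc]; exact hx (hy hr)
  | add x y hx hy => rw [map_add, add_mul]; exact Submodule.add_mem _ (hx hr) (hy hr)

variable [CharZero k]

/-- The range contains `1 = ∑ ε_t` and is stable under left multiplication by `⋀V'`, by `G'` and by
`c`, which generate the algebra. -/
theorem range_cyclicSkewSum (hξ : IsPrimitiveRoot ξ m) :
    LinearMap.range (cyclicSkewSum G ξ m) = ⊤ := by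
  have hc := completeOrthogonalIdempotents_rootIdempotent hξ
    (skewGenerator_pow_eq_one (G := G) hξ.pow_eq_one)
  have hone : (1 : ExteriorSkew (cyclicExtension G ξ)) ∈
      LinearMap.range (cyclicSkewSum G ξ m) := by
    refine ⟨(fun _ => 1, 0), ?_⟩
    rw [cyclicSkewSum_apply, ← hc.complete]
    refine Finset.sum_congr rfl fun t _ => ?_
    rw [Pi.zero_apply, map_zero, zero_mul, zero_mul, add_zero, map_one, one_mul]
  refine eq_top_iff.2 fun r _ => ?_
  induction r using exteriorSkew_induction with
  | h0 => exact Submodule.zero_mem _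
  | hadd x y hx hy => exact Submodule.add_mem _ (hx trivial) (hy trivial)
  | hs h x =>
    obtain ⟨g, n, -, rfl⟩ := exists_eq_mul_pow hξ.pow_eq_one h
    have h1 : (SkewMonoidAlgebra.single (toCyclicExtension G ξ g * cyclicGenerator G ξ ^ n) x :
        ExteriorSkew (cyclicExtension G ξ)) = exteriorToSkew _ x *
          (cyclicSkewHom G ξ (SkewMonoidAlgebra.single g 1) * (skewGenerator G ξ ^ n * 1)) := by
      rw [mul_one, skewGenerator_pow, cyclicSkewHom_single, map_one,
        SkewMonoidAlgebra.single_mul_single, smul_one, mul_one, exteriorToSkew_apply,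
        SkewMonoidAlgebra.single_mul_single, smul_one, mul_one, one_mul]
    rw [h1]
    refine single_one_mul_mem_range _ (map_mul_mem_range _ ?_)
    clear h1
    induction n with
    | zero => rwa [pow_zero, mul_one]
    | succ n ih =>
      rw [pow_succ', mul_assoc]
      exact skewGenerator_mul_mem_range hξ.pow_eq_one (ih trivial)

variable [FiniteDimensional k V] [Finite G]

/-- A surjection between spaces of equal dimension: `2 · m · |G| 2^s = (m |G|) 2^{s+1}`. -/
theorem injective_cyclicSkewSum (hξ : IsPrimitiveRoot ξ m) :
    Function.Injective (cyclicSkewSum G ξ m) := by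
  have := finite_cyclicExtension (G := G) hξ
  refine (LinearMap.injective_iff_surjective_of_finrank_eq_finrank ?_).2
    (LinearMap.range_eq_top.1 (range_cyclicSkewSum hξ))
  rw [finrank_exteriorSkew, card_cyclicExtension hξ, Module.finrank_prod, Module.finrank_prod,
    Module.finrank_self, Module.finrank_pi_fintype, Finset.sum_const, Finset.card_univ, ZMod.card,
    finrank_exteriorSkew, smul_eq_mul]
  ring

theorem isCyclicExtension (hξ : IsPrimitiveRoot ξ m) :
    IsCyclicExtension (exteriorSkewDegree G) (exteriorSkewDegree (cyclicExtension G ξ))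
      (cyclicSkewHom G ξ) (skewTwist (-1) (subgroupDet G))
      (rootIdempotent (m := m) ξ (skewGenerator G ξ)) (lastVector G ξ) where
  complete := completeOrthogonalIdempotents_rootIdempotent hξ
    (skewGenerator_pow_eq_one hξ.pow_eq_one)
  commute t a := commute_rootIdempotent (commute_skewGenerator a) t
  mul_map := lastVector_mul_map
  mul_self := lastVector_mul_self
  shift := mul_rootIdempotent_of_mul hξ.pow_eq_one skewGenerator_mul_lastVector
  map_mem _ _ ha := cyclicSkewHom_mem ha
  idem_mem := rootIdempotent_skewGenerator_mem
  mem := lastVector_mem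
  exists_eq_sum r := by
    obtain ⟨⟨a, b⟩, h⟩ := LinearMap.range_eq_top.1 (range_cyclicSkewSum (G := G) hξ) r
    exact ⟨a, b, h.symm⟩
  eq_zero a b h := by
    have h1 : (a, b) = (0 : (ZMod m → ExteriorSkew G) × (ZMod m → ExteriorSkew G)) :=
      injective_cyclicSkewSum hξ (h.trans (map_zero _).symm)
    exact ⟨congrArg Prod.fst h1, congrArg Prod.snd h1⟩

end CyclicSkew

/-! ### Comparing the twist by the last vector with the Nakayama automorphisms -/

section Twist

variable {k : Type*} [Field k] {W : Type*} [AddCommGroup W] [Module k W]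
  {H : Subgroup (W ≃ₗ[k] W)}

theorem skewTwist_of_mem {d : ℕ} {a : ExteriorSkew H} (ha : a ∈ exteriorSkewDegree H d)
    (c c' : kˣ) (χ : H →* kˣ) :
    (c' : k) ^ d • skewTwist c χ a = (c : k) ^ d • skewTwist c' χ a := by
  induction ha using Submodule.span_induction with
  | mem a ha =>
    obtain ⟨x, hx, h, rfl⟩ := ha
    rw [skewTwist_single, skewTwist_single, map_smul_id_of_mem hx, map_smul_id_of_mem hx,
      SkewMonoidAlgebra.smul_single, SkewMonoidAlgebra.smul_single, smul_smul, smul_smul, smul_smul,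
      smul_smul]
    congr 2
    ring
  | zero => simp
  | add x y _ _ hx hy => rw [map_add, map_add, smul_add, smul_add, hx, hy]
  | smul r x _ hx => rw [map_smul, map_smul, smul_comm, hx, smul_comm]

theorem skewTwist_zero {a : ExteriorSkew H} (ha : a ∈ exteriorSkewDegree H 0)
    (c c' : kˣ) (χ : H →* kˣ) : skewTwist c χ a = skewTwist c' χ a := by
  simpa using skewTwist_of_mem ha c c' χ

variable {V : Type*} [AddCommGroup V] [Module k V]
  {G : Subgroup (V ≃ₗ[k] V)} {ξ : kˣ}

/-- The origin of `σ̃`: in degree one, commuting with the last vector gives the sign `-1` and the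
Nakayama automorphism gives `(-1)^{s+1}`. -/
theorem skewTwist_neg_one {a : ExteriorSkew G} (ha : a ∈ exteriorSkewDegree G 1)
    (χ : G →* kˣ) :
    skewTwist (-1) χ a = (-1 : k) ^ Module.finrank k V • skewTwist (topSign k V) χ a := by
  have h1 := skewTwist_of_mem ha (-1) (topSign k V) χ
  have h2 : (topSign k V : k) = -(-1) ^ Module.finrank k V := by
    rw [topSign, Units.val_pow_eq_pow_val, Units.val_neg, Units.val_one, pow_succ, mul_neg_one]
  rw [pow_one, pow_one, h2, Units.val_neg, Units.val_one, neg_smul, neg_smul, one_smul,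
    neg_inj] at h1
  rw [← h1, smul_smul, ← mul_pow, neg_one_mul, neg_neg, one_pow, one_smul]

variable [FiniteDimensional k V]

/-- In degree zero only the character acts, and it is trivial on `G'` because `G'` lies in `SL(V ⊕
k)`. -/
theorem skewTwist_cyclicSkewHom {a : ExteriorSkew G} (ha : a ∈ exteriorSkewDegree G 0)
    (c : kˣ) :
    skewTwist c (subgroupDet (cyclicExtension G ξ)) (cyclicSkewHom G ξ a) =
      cyclicSkewHom G ξ a := by
  induction ha using Submodule.span_induction with
  | mem a ha =>
    obtain ⟨x, hx, h, rfl⟩ := ha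
    rw [cyclicSkewHom_single, skewTwist_single, subgroupDet_toCyclicExtension,
      map_smul_id_of_mem (exteriorAlgebra_map_mem _ hx), pow_zero, one_smul, Units.val_one,
      one_smul]
  | zero => simp
  | add x y _ _ hx hy => rw [map_add, map_add, hx, hy]
  | smul r x _ hx => rw [map_smul, map_smul, hx]

theorem skewTwist_skewGenerator (c : kˣ) :
    skewTwist c (subgroupDet (cyclicExtension G ξ)) (skewGenerator G ξ) =
      (ξ : k) • skewGenerator G ξ := by
  rw [skewGenerator, skewTwist_single, subgroupDet_cyclicGenerator, map_one,
    SkewMonoidAlgebra.smul_single]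

end Twist

/-! ### The main theorem -/

theorem mainTheorem2 {k : Type*} [Field k] [IsAlgClosed k] [CharZero k]
    {V : Type*} [AddCommGroup V] [Module k V] [FiniteDimensional k V]
    (G : Subgroup (V ≃ₗ[k] V)) [Finite G]
    (m : ℕ) [NeZero m] (ξ : kˣ) (hξ : IsPrimitiveRoot ξ m)
    {Q : Type*} [Quiver Q] [Fintype Q] (θ : Set (PathAlgebra k Q))
    (hθ : IsBoundQuiverOfBasic (exteriorSkewDegree G) θ)
    (ν : Equiv.Perm Q) (N : BoundAlgebra θ ≃ₐ[k] BoundAlgebra θ)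
    (hN : IsNakayamaAutomorphism θ ν N) :
    IsBoundQuiverOfBasic (exteriorSkewDegree (cyclicExtension G ξ))
        (cyclicRelations θ ν N (Module.finrank k V) m) ∧
      IsStableTranslationQuiver (cyclicRelations θ ν N (Module.finrank k V) m)
        (cyclicShift ν m) (Module.finrank k V + 1) ∧
      ∃ N' : BoundAlgebra (cyclicRelations θ ν N (Module.finrank k V) m) ≃ₐ[k]
          BoundAlgebra (cyclicRelations θ ν N (Module.finrank k V) m),
        IsNakayamaAutomorphism (cyclicRelations θ ν N (Module.finrank k V) m)
          (cyclicShift ν m) N' := by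
  have := finite_cyclicExtension (G := G) hξ
  obtain ⟨e, φ, h⟩ := hθ.exists_isRealization
  obtain ⟨u, hu0, -, -, hvertex, harrow, hzero, hex⟩ :=
    h.exists_intertwiner (fun d hd => exteriorSkewDegree_eq_bot hd) isGradedFrobenius_skewForm hN
  -- The intertwiner was obtained for `ρ`, while the last vector acts by `τ`. They agree in degree
  -- zero, so vertices and generation carry over unchanged, and only the arrows acquire the sign.
  have hτ : ∀ a ∈ exteriorSkewDegree G 0, skewTwist (-1) (subgroupDet G) a =
      skewTwist (topSign k V) (subgroupDet G) a := fun a ha => skewTwist_zero ha _ _ _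
  have hu : IsRealization.IsIntertwiner e φ ν N (skewTwist (-1) (subgroupDet G))
      (Module.finrank k V) u :=
    { vertex := fun i => by rw [hτ _ (h.degree_zero i), hvertex]
      arrow := fun i j a => by
        rw [skewTwist_neg_one (h.map_arrow i j a), mul_smul_comm, harrow]
      eq_zero := hzero
      exists_eq := fun z => by rw [hτ _ h.sum_mem_zero]; exact hex z }
  obtain ⟨Φ, hΦ⟩ := h.exists_cyclic (isCyclicExtension hξ) hu0 hu hN
  have hrank : Module.finrank k (V × k) = Module.finrank k V + 1 := by
    rw [Module.finrank_prod, Module.finrank_self]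
  have hbot : ∀ d, Module.finrank k (V × k) < d →
      exteriorSkewDegree (cyclicExtension G ξ) d = ⊥ := fun d hd => exteriorSkewDegree_eq_bot hd
  -- The Nakayama automorphism of the large algebra fixes the images of the `e_i` and multiplies `c`
  -- by `ξ`, so it only lowers the index `t`.
  have hshift : ∀ x : CyclicVertex ν m,
      skewTwist (topSign k (V × k)) (subgroupDet (cyclicExtension G ξ))
        (IsRealization.cyclicIdempotent ν e (cyclicSkewHom G ξ)
          (rootIdempotent ξ (skewGenerator G ξ)) x) =
      IsRealization.cyclicIdempotent ν e (cyclicSkewHom G ξ)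
          (rootIdempotent ξ (skewGenerator G ξ)) (cyclicShift ν m x) := fun x => by
    rw [IsRealization.cyclicIdempotent, IsRealization.cyclicIdempotent, map_mul,
      skewTwist_cyclicSkewHom (h.degree_zero _),
      map_rootIdempotent hξ.pow_eq_one (skewTwist_skewGenerator _)]
    rfl
  refine ⟨hΦ.isBoundQuiverOfBasic hbot, ?_,
    hΦ.exists_isNakayamaAutomorphism isGradedFrobenius_skewForm hshift⟩
  rw [← hrank]
  exact hΦ.isStableTranslationQuiver hbot isGradedFrobenius_skewForm hshift

end
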